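/- Let $0<k_1<k_2$ and let $e_1,e_2,e_3\in\mathbb R$ be given by $k_1^2=e_2-e_3$, $k_2^2=e_1-e_3$, $e_1+e_2+e_3=0$. Then there are $\omega,\omega'>0$ such that the Weierstrass function $\wp$ with half-periods $\omega$ and $i\omega'$ satisfies $\wp(\omega)=e_1$, $\wp(\omega+i\omega')=e_2$, $\wp(i\omega')=e_3$. For any such $\omega,\omega'$, let $\Lambda=2\omega\mathbb Z+2i\omega'\mathbb Z$, let $\sigma,\zeta$ be the Weierstrass functions of $\Lambda$, and let $$\varphi(x,z)=\frac{\sigma(x-\omega-i\omega'+z)\,\sigma(\omega+i\omega')}{\sigma(x-\omega-i\omega')\,\sigma(\omega+i\omega'-z)}\,e^{-\zeta(z)x}.$$ Let $D=\mathbb C\setminus([ik_1,ik_2]\cup[-ik_2,-ik_1])$. On $D$ the relation $k^2=e_3-\wp(z)$ has a branch $z=z(k)\notin\Lambda$ that is holomorphic modulo $\Lambda$ and satisfies $k\,z(k)\to -i$ as $|k|\to\infty$. For any such branch the function $$\chi(k,x)=\left(\frac{k^2+k_1^2}{k^2+k_2^2}\right)^{1/4}\varphi(x,z(k))\,e^{ikx},\qquad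 k\in D,\ x\in\mathbb R,$$ with the principal branch of the fourth root, has the following properties, for a function $Q:\mathbb R\to\mathbb C$ and every $x\in\mathbb R$. 1. $\chi(\cdot,x)$ is analytic on $D$, and for $p\in(-k_2,-k_1)\cup(k_1,k_2)$ it has non-tangential limits $\chi^{\pm}(ip,x)=\lim_{\varepsilon\to0^+}\chi(ip\pm\varepsilon,x)$ from the right ($+$) and from the left ($-$). 2. For $p\in(k_1,k_2)$, $$\chi^+(ip,x)-\chi^-(ip,x)=ie^{-2px}\,[\chi^+(-ip,x)+\chi^-(-ip,x)],$$ $$\chi^+(-ip,x)-\chi^-(-ip,x)=-ie^{2px}\,[\chi^+(ip,x)+\chi^-(ip,x)].$$ 3. $\chi(k,x)=1+\frac{i}{2k}Q(x)+O(k^{-2})$ as $|k|\to\infty$, $\operatorname{Im}k\ne0$. 4. There are a constant $\alpha<1$, independent of $x$, and constants $C(x)$ such that $|\chi(k,x)|<C(x)\,|k-c|^{-\alpha}$ for $k\in D$ near each $c\in\{\pm ik_1,\pm ik_2\}$. That is, $\chi$ satisfies the contour problem of primitive potentials on $[k_1,k_2]$ with dressing functions $R_1=R_2=1$ at $t=0$.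 Moreover, $Q$ is differentiable, and the potential $u(x)=Q'(x)$ is the elliptic one-gap potential $$u(x)=2\wp(x+i\omega'-\omega)+e_3 .$$ -/

import Mathlib

open Filter Topology Asymptotics

noncomputable section

namespace PrimitivePotential

/-- The Weierstrass zeta function
`ζ(z) = 1/z + ∑_{l ≠ 0} (1/(z - l) + 1/l + z/l²)`, summed over the nonzero periods `l`. -/
def weierstrassZeta (L : PeriodPair) (z : ℂ) : ℂ :=
  1 / z + ∑' l : {l : ℂ // l ∈ L.lattice ∧ l ≠ 0},
    (1 / (z - l) + 1 / (l : ℂ) + z / (l : ℂ) ^ 2)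

/-- The Weierstrass sigma function
`σ(z) = z ∏_{l ≠ 0} (1 - z/l) exp(z/l + z²/(2l²))`, the product over the nonzero periods `l`. -/
def weierstrassSigma (L : PeriodPair) (z : ℂ) : ℂ :=
  z * ∏' l : {l : ℂ // l ∈ L.lattice ∧ l ≠ 0},
    ((1 - z / l) * Complex.exp (z / l + z ^ 2 / (2 * (l : ℂ) ^ 2)))

/-- The pair of periods `2ω`, `2iω'` (that is, half-periods `ω` and `iω'`), `ω, ω' > 0`. -/
def rectPeriods (ω ω' : ℝ) (hω : 0 < ω) (hω' : 0 < ω') : PeriodPair where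
  ω₁ := 2 * ω
  ω₂ := 2 * (Complex.I * ω')
  indep := by
    rw [LinearIndependent.pair_iff]
    intro s t h
    have h1 := congrArg Complex.re h
    have h2 := congrArg Complex.im h
    simp at h1 h2
    exact ⟨h1.resolve_right hω.ne', h2.resolve_right hω'.ne'⟩

/-- `e₃`, where `e₁ + e₂ + e₃ = 0`, `k₁² = e₂ - e₃`, `k₂² = e₁ - e₃`. -/
def e₃ (k₁ k₂ : ℝ) : ℝ := -(k₁ ^ 2 + k₂ ^ 2) / 3

/-- `e₂ = e₃ + k₁²`. -/
def e₂ (k₁ k₂ : ℝ) : ℝ := e₃ k₁ k₂ + k₁ ^ 2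

/-- `e₁ = e₃ + k₂²`. -/
def e₁ (k₁ k₂ : ℝ) : ℝ := e₃ k₁ k₂ + k₂ ^ 2

/-- `ω` and `iω'` are half-periods of the Weierstrass function with
`℘(ω) = e₁`, `℘(ω + iω') = e₂`, `℘(iω') = e₃`. -/
def AreHalfPeriods (k₁ k₂ ω ω' : ℝ) (hω : 0 < ω) (hω' : 0 < ω') : Prop :=
  (rectPeriods ω ω' hω hω').weierstrassP ω = e₁ k₁ k₂ ∧
  (rectPeriods ω ω' hω hω').weierstrassP (ω + Complex.I * ω') = e₂ k₁ k₂ ∧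
  (rectPeriods ω ω' hω hω').weierstrassP (Complex.I * ω') = e₃ k₁ k₂

/-- The complex plane without the two closed cuts `[ik₁, ik₂]` and `[-ik₂, -ik₁]`. -/
def cutPlane (k₁ k₂ : ℝ) : Set ℂ :=
  {k : ℂ | ¬ (k.re = 0 ∧ k₁ ≤ |k.im| ∧ |k.im| ≤ k₂)}

/-- The solution
`φ(x,z) = σ(x - ω - iω' + z) σ(ω + iω') / (σ(x - ω - iω') σ(ω + iω' - z)) · exp(-ζ(z) x)`
of the Lamé equation; here `w = ω + iω'`. -/
def lamePhi (L : PeriodPair) (w : ℂ) (x : ℝ) (z : ℂ) : ℂ :=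
  weierstrassSigma L (x - w + z) * weierstrassSigma L w /
    (weierstrassSigma L (x - w) * weierstrassSigma L (w - z)) *
    Complex.exp (-weierstrassZeta L z * x)

/-- `k ↦ z k` is the branch, on the cut plane, of the relation `k² = e - ℘(z)` normalized by
`z ∼ -i/k` as `k → ∞` (so that `φ(x, z) ∼ e^{-x/z}` behaves like `e^{-ikx}`).
The branch is holomorphic modulo the period lattice: near each point of the cut plane it differs
from a holomorphic function by periods. -/
structure IsSpectralBranch (L : PeriodPair) (k₁ k₂ : ℝ) (e : ℂ) (z : ℂ → ℂ) : Prop where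
  notMem_lattice : ∀ k ∈ cutPlane k₁ k₂, z k ∉ L.lattice
  sq_eq : ∀ k ∈ cutPlane k₁ k₂, k ^ 2 = e - L.weierstrassP (z k)
  analytic_mod_lattice : ∀ k₀ ∈ cutPlane k₁ k₂, ∃ f : ℂ → ℂ, AnalyticAt ℂ f k₀ ∧
    ∀ᶠ k in 𝓝 k₀, z k - f k ∈ L.lattice
  at_infinity : Tendsto (fun k : ℂ => k * z k) (Bornology.cobounded ℂ) (𝓝 (-Complex.I))

/-- `χ(k,x) = ((k² + k₁²)/(k² + k₂²))^{1/4} φ(x, z(k)) e^{ikx}`, with the principal branch of the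
fourth root. -/
def chi (L : PeriodPair) (w : ℂ) (k₁ k₂ : ℝ) (z : ℂ → ℂ) (k : ℂ) (x : ℝ) : ℂ :=
  ((k ^ 2 + (k₁ : ℂ) ^ 2) / (k ^ 2 + (k₂ : ℂ) ^ 2)) ^ (1 / 4 : ℂ) *
    lamePhi L w x (z k) * Complex.exp (Complex.I * k * x)

/-- `f` has the non-tangential limit `l` at the point `ip` of the imaginary axis,
from the right if `s = 1` and from the left if `s = -1`. -/
def HasNontangentialLimit (s : ℝ) (f : ℂ → ℂ) (p : ℝ) (l : ℂ) : Prop :=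
  ∀ M : ℝ, 0 < M →
    Tendsto f (𝓝[{k : ℂ | 0 < s * k.re ∧ |k.im - p| ≤ M * (s * k.re)}] (Complex.I * p)) (𝓝 l)

/-- The contour problem of primitive potentials with dressing functions `R₁`, `R₂`, at the
moment of time `t`, for `χ(k,x) = χ(k,x,t)`, with coefficient `Q(x) = Q(x,t)` at infinity. -/
structure SolvesContourProblem (k₁ k₂ : ℝ) (R₁ R₂ : ℝ → ℝ) (t : ℝ)
    (χ : ℂ → ℝ → ℂ) (Q : ℝ → ℂ) : Prop where
  /-- Analyticity off the cuts. -/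
  analytic : ∀ x : ℝ, AnalyticOnNhd ℂ (fun k => χ k x) (cutPlane k₁ k₂)
  /-- Existence of the boundary values `χ⁺(ip,x)`, `χ⁻(ip,x)` (denoted `χp p x`, `χm p x`),
  and the jump relations. -/
  jumps : ∃ χp χm : ℝ → ℝ → ℂ,
    (∀ x p : ℝ, k₁ < |p| → |p| < k₂ →
      HasNontangentialLimit 1 (fun k => χ k x) p (χp p x) ∧
      HasNontangentialLimit (-1) (fun k => χ k x) p (χm p x)) ∧
    (∀ x p : ℝ, k₁ < p → p < k₂ →
      χp p x - χm p x =
        Complex.I * R₁ p * Real.exp (-2 * p * x + 8 * p ^ 3 * t) * (χp (-p) x + χm (-p) x)) ∧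
    (∀ x p : ℝ, k₁ < p → p < k₂ →
      χp (-p) x - χm (-p) x =
        -Complex.I * R₂ p * Real.exp (2 * p * x - 8 * p ^ 3 * t) * (χp p x + χm p x))
  /-- `χ = 1 + (i/2k) Q + O(1/k²)` as `|k| → ∞`, `Im k ≠ 0`. -/
  asymptotic : ∀ x : ℝ,
    (fun k : ℂ => χ k x - (1 + Complex.I / (2 * k) * Q x))
      =O[Bornology.cobounded ℂ ⊓ 𝓟 {k : ℂ | k.im ≠ 0}] (fun k : ℂ => 1 / k ^ 2)
  /-- Near each endpoint `c = ±ik₁, ±ik₂` one has `|χ| < C(x) / |k - c|^α`, with `α < 1`. -/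
  endpoints : ∃ α : ℝ, α < 1 ∧ ∀ x : ℝ, ∃ C : ℝ,
    ∀ c ∈ ({Complex.I * k₁, -(Complex.I * k₁), Complex.I * k₂, -(Complex.I * k₂)} : Set ℂ),
      ∀ᶠ k in 𝓝[cutPlane k₁ k₂] c, ‖χ k x‖ < C / ‖k - c‖ ^ α

end PrimitivePotential

end

/-!
By the cubic relation for `℘'`, a solution `z` of `k² = e₃ - ℘(z)` satisfies `℘'(z) = ± 2ikS`,
where `S² = (k² + k₁²)(k² + k₂²)`, and it is determined modulo `Λ` by the sign. On the cut plane
`S` has the single-valued choice `S ∼ k²`, and `k z(k) → -i` selects `℘'(z(k)) = 2ikS`. As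
`φ(x, ·)` is periodic, `χ` does not depend on the branch.

Across a cut `S` changes sign while `S(-k) = S(k)`, so that for some `v` the boundary values of
`z(k)` are, modulo `Λ`, `v` on the right and `-v` on the left of `ip`, and the same at `-ip`. The
two boundary values of the fourth root differ by the factor `i`, interchanged between `ip` and
`-ip`; the jump relations follow. At infinity `z` is a local parameter, and the essential
singularities of `e^{-ζ(z)x}` and `e^{ikx}` cancel because `ik = 1/z + O(z)`; the coefficient
`Q(x) = -2ζ(x - w) - 2ζ(w) + e₃x`, `w = ω + iω'`, is read off from the derivative in `z`. At the
endpoints of the cuts, `|φ(x, z)|² |℘(z) - ℘(w)|` is locally bounded, which bounds `|χ|⁴ |k - c|`.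

The half-periods exist because summing the series of `℘` row by row expresses
`(e₂ - e₃) / (e₁ - e₂)` as a continuous function of `ω' / ω`, which tends to `0` at infinity and
is inverted when `ω` and `ω'` are interchanged. It therefore takes every positive
value, and scaling the lattice does the rest.
-/

noncomputable section

namespace PrimitivePotential

/-! ### The Weierstrass zeta and sigma functions -/

/-- The nonzero periods, the index type of the series for `ζ` and of the product for `σ`. -/
abbrev NonzeroPeriod (L : PeriodPair) : Type := {l : ℂ // l ∈ L.lattice ∧ l ≠ 0}

section ZetaSigma

variable (L : PeriodPair)

lemma injective_nonzeroPeriod_toLattice :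
    Function.Injective fun l : NonzeroPeriod L => (⟨l.1, l.2.1⟩ : L.lattice) :=
  fun _ _ h => Subtype.ext (congrArg (fun l : L.lattice => (l : ℂ)) h)

lemma hasSum_nonzeroPeriod {g : ℂ → ℂ} {a : ℂ}
    (h : HasSum (fun l : L.lattice => if l.1 = 0 then 0 else g l) a) :
    HasSum (fun l : NonzeroPeriod L => g l) a := by
  have hsupport : ∀ l ∉ Set.range fun l : NonzeroPeriod L => (⟨l.1, l.2.1⟩ : L.lattice),
      (if l.1 = 0 then 0 else g l) = 0 := by
    intro l hl
    have hl0 : l.1 = 0 := by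
      by_contra h0
      exact hl ⟨⟨l.1, l.2, h0⟩, rfl⟩
    simp [hl0]
  convert! ((injective_nonzeroPeriod_toLattice L).hasSum_iff hsupport).mpr h using 2 with l
  simp [l.2.2]

lemma summable_norm_inv_cube_nonzeroPeriod :
    Summable fun l : NonzeroPeriod L => ‖(l : ℂ)‖⁻¹ ^ 3 := by
  have hlattice := ZLattice.summable_norm_pow_inv L.lattice 3 (by simp)
  exact hlattice.comp_injective (i := fun l : NonzeroPeriod L => (⟨l.1, l.2.1⟩ : L.lattice))
    (injective_nonzeroPeriod_toLattice L)

lemma eventually_le_norm_nonzeroPeriod (R : ℝ) :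
    ∀ᶠ l : NonzeroPeriod L in cofinite, R ≤ ‖(l : ℂ)‖ := by
  have hfinite : (Metric.closedBall (0 : L.lattice) R).Finite :=
    isCompact_iff_finite.mp (isCompact_closedBall (0 : L.lattice) R)
  refine (hfinite.preimage (injective_nonzeroPeriod_toLattice L).injOn).subset fun l hl => ?_
  simp only [Set.mem_compl_iff, Set.mem_ofPred_eq, not_le] at hl
  simpa using hl.le

lemma sub_nonzeroPeriod_ne_zero {z : ℂ} (hz : z ∈ (L.lattice \ {0} : Set ℂ)ᶜ)
    (l : NonzeroPeriod L) : z - l ≠ 0 := by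
  intro h
  apply hz
  rw [sub_eq_zero.mp h]
  exact ⟨l.2.1, l.2.2⟩

/-- The term of the series for `ζ(z)` at the period `l`. -/
def zetaTerm (l z : ℂ) : ℂ := 1 / (z - l) + 1 / l + z / l ^ 2

/-- The regular part `ζ(z) - 1/z` of the Weierstrass zeta function at the origin. -/
def zetaRegular (z : ℂ) : ℂ := ∑' l : NonzeroPeriod L, zetaTerm l z

lemma weierstrassZeta_eq (z : ℂ) : weierstrassZeta L z = 1 / z + zetaRegular L z := rfl

@[simp]
lemma zetaRegular_zero : zetaRegular L 0 = 0 := by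
  simp [zetaRegular, zetaTerm, div_neg]

lemma norm_zetaTerm_le {r : ℝ} {z l : ℂ} (hz : ‖z‖ ≤ r) (hr : 0 < r) (hl : 2 * r ≤ ‖l‖) :
    ‖zetaTerm l z‖ ≤ 2 * r ^ 2 * ‖l‖⁻¹ ^ 3 := by
  have hnorm : 0 < ‖l‖ := by linarith
  have hl0 : l ≠ 0 := norm_pos_iff.mp hnorm
  have hdist : ‖l‖ / 2 ≤ ‖z - l‖ := by
    have := norm_sub_norm_le l z
    rw [norm_sub_rev] at this
    linarith
  have hzl : z - l ≠ 0 := norm_pos_iff.mp (by linarith)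
  have hclosed : zetaTerm l z = z ^ 2 / (l ^ 2 * (z - l)) := by
    rw [zetaTerm]
    field_simp
    ring
  rw [hclosed, norm_div, norm_mul, norm_pow, norm_pow]
  calc ‖z‖ ^ 2 / (‖l‖ ^ 2 * ‖z - l‖) ≤ r ^ 2 / (‖l‖ ^ 2 * (‖l‖ / 2)) := by gcongr
    _ = 2 * r ^ 2 * ‖l‖⁻¹ ^ 3 := by field_simp

lemma hasDerivAt_zetaTerm {z l : ℂ} (h : z - l ≠ 0) :
    HasDerivAt (zetaTerm l) (-(1 / (z - l) ^ 2 - 1 / l ^ 2)) z := by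
  have hinv := ((hasDerivAt_id z).sub_const l).inv h
  have hsum := (hinv.add_const (1 / l)).add ((hasDerivAt_id z).div_const (l ^ 2))
  convert! hsum using 1
  · ext
    simp [zetaTerm]
  · simp only [id_eq]
    ring

lemma hasSumLocallyUniformlyOn_zetaRegular {s : Set ℂ} (hs : IsOpen s) :
    HasSumLocallyUniformlyOn (fun l : NonzeroPeriod L => zetaTerm l) (zetaRegular L) s := by
  refine hasSumLocallyUniformlyOn_of_forall_compact hs fun K _ hK => ?_
  rw [hasSumUniformlyOn_iff_tendstoUniformlyOn]
  obtain ⟨r, hr, hKr⟩ := hK.isBounded.exists_pos_norm_le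
  refine tendstoUniformlyOn_tsum_of_cofinite_eventually
    ((summable_norm_inv_cube_nonzeroPeriod L).mul_left (2 * r ^ 2)) ?_
  filter_upwards [eventually_le_norm_nonzeroPeriod L (2 * r)] with l hl z hz
  exact norm_zetaTerm_le (hKr z hz) hr hl

lemma hasDerivAt_zetaRegular {z : ℂ} (hz : z ∈ (L.lattice \ {0} : Set ℂ)ᶜ) :
    HasDerivAt (zetaRegular L) (-L.weierstrassPExcept 0 z) z := by
  have hopen : IsOpen (L.lattice \ {0} : Set ℂ)ᶜ := L.isOpen_compl_lattice_sdiff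
  have hseries := hasSumLocallyUniformlyOn_zetaRegular L hopen
  have hterms : ∀ (s : Finset (NonzeroPeriod L)), ∀ u ∈ (L.lattice \ {0} : Set ℂ)ᶜ,
      HasDerivAt (fun u => ∑ l ∈ s, zetaTerm l u)
        (∑ l ∈ s, -(1 / (u - l) ^ 2 - 1 / (l : ℂ) ^ 2)) u := fun s u hu =>
    .fun_sum fun l _ => hasDerivAt_zetaTerm (sub_nonzeroPeriod_ne_zero L hu l)
  have hpartial : ∀ᶠ s : Finset (NonzeroPeriod L) in atTop,
      DifferentiableOn ℂ (fun u => ∑ l ∈ s, zetaTerm l u) (L.lattice \ {0} : Set ℂ)ᶜ :=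
    .of_forall fun s u hu => (hterms s u hu).differentiableAt.differentiableWithinAt
  have hderivSum : HasSum (fun l : NonzeroPeriod L => -(1 / (z - l) ^ 2 - 1 / (l : ℂ) ^ 2))
      (deriv (zetaRegular L) z) :=
    (((hasSumLocallyUniformlyOn_iff_tendstoLocallyUniformlyOn.mp hseries).deriv hpartial
      hopen).tendsto_at hz).congr fun s => (hterms s z hz).deriv
  have hP := (hasSum_nonzeroPeriod L (g := fun l => 1 / (z - l) ^ 2 - 1 / l ^ 2)
    (L.hasSum_weierstrassPExcept 0 z)).neg
  rw [← hderivSum.unique hP]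
  exact ((hseries.differentiableOn hpartial hopen).differentiableAt
    (hopen.mem_nhds hz)).hasDerivAt

lemma hasDerivAt_weierstrassZeta {z : ℂ} (hz : z ∉ L.lattice) :
    HasDerivAt (weierstrassZeta L) (-L.weierstrassP z) z := by
  have hz0 : z ≠ 0 := fun h => hz (h ▸ L.lattice.zero_mem)
  have hsum := (hasDerivAt_id z).inv hz0 |>.add
    (hasDerivAt_zetaRegular L (z := z) fun h => hz h.1)
  convert! hsum using 1
  · ext u
    simp [weierstrassZeta_eq]
  · rw [← L.weierstrassPExcept_add 0 z]
    simp only [id_eq, ZeroMemClass.coe_zero, sub_zero]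
    ring

/-- The Weierstrass primary factor of genus two, with a simple zero at `1`;
`σ(z) / z` is the product of its values at `z / l` over the nonzero periods `l`. -/
def primaryFactor (w : ℂ) : ℂ := (1 - w) * Complex.exp (w + w ^ 2 / 2)

lemma hasDerivAt_primaryFactor (w : ℂ) :
    HasDerivAt primaryFactor (-w ^ 2 * Complex.exp (w + w ^ 2 / 2)) w := by
  have hfactor := (hasDerivAt_id w).const_sub 1
  have hexp := ((hasDerivAt_id w).add (((hasDerivAt_id w).pow 2).div_const 2)).cexp
  convert! hfactor.mul hexp using 1
  simp only [id_eq, Pi.add_apply, Pi.pow_apply]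
  ring

lemma differentiable_primaryFactor_div (l : ℂ) : Differentiable ℂ fun z => primaryFactor (z / l) :=
  Differentiable.comp (g := primaryFactor)
    (fun w => (hasDerivAt_primaryFactor w).differentiableAt) (differentiable_id.div_const l)

lemma primaryFactor_eq_zero_iff {w : ℂ} : primaryFactor w = 0 ↔ w = 1 := by
  simp [primaryFactor, Complex.exp_ne_zero, sub_eq_zero, eq_comm (a := w)]

lemma norm_exp_add_sq_div_two_le {u : ℂ} (hu : ‖u‖ ≤ 1) :
    ‖Complex.exp (u + u ^ 2 / 2)‖ ≤ Real.exp 2 := by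
  rw [Complex.norm_exp]
  gcongr
  calc (u + u ^ 2 / 2).re ≤ ‖u + u ^ 2 / 2‖ := Complex.re_le_norm _
    _ ≤ ‖u‖ + ‖u ^ 2 / 2‖ := norm_add_le _ _
    _ = ‖u‖ + ‖u‖ ^ 2 / 2 := by rw [norm_div, norm_pow, Complex.norm_ofNat]
    _ ≤ 2 := by nlinarith [norm_nonneg u]

lemma norm_primaryFactor_sub_one_le {w : ℂ} (hw : ‖w‖ ≤ 1) :
    ‖primaryFactor w - 1‖ ≤ Real.exp 2 * ‖w‖ ^ 3 := by
  have hderiv : ∀ u ∈ Metric.closedBall (0 : ℂ) ‖w‖,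
      ‖-u ^ 2 * Complex.exp (u + u ^ 2 / 2)‖ ≤ ‖w‖ ^ 2 * Real.exp 2 := by
    intro u hu
    have hu' : ‖u‖ ≤ ‖w‖ := by simpa using hu
    rw [norm_mul, norm_neg, norm_pow]
    gcongr
    exact norm_exp_add_sq_div_two_le (hu'.trans hw)
  have hmean := (convex_closedBall (0 : ℂ) ‖w‖).norm_image_sub_le_of_norm_hasDerivWithin_le
    (fun u _ => (hasDerivAt_primaryFactor u).hasDerivWithinAt) hderiv
    (x := 0) (y := w) (by simp) (by simp)
  rw [sub_zero, show primaryFactor 0 = 1 by simp [primaryFactor]] at hmean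
  linarith

lemma norm_primaryFactor_div_sub_one_le {r : ℝ} {z l : ℂ} (hz : ‖z‖ ≤ r) (hr : 0 < r)
    (hl : r ≤ ‖l‖) : ‖primaryFactor (z / l) - 1‖ ≤ Real.exp 2 * r ^ 3 * ‖l‖⁻¹ ^ 3 := by
  have hzl : ‖z / l‖ ≤ 1 := by
    rw [norm_div, div_le_one (hr.trans_le hl)]
    exact hz.trans hl
  refine (norm_primaryFactor_sub_one_le hzl).trans ?_
  rw [norm_div, div_eq_mul_inv, mul_pow, mul_assoc]
  gcongr

/-- The regular part `σ(z) / z` of the Weierstrass sigma function at the origin. -/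
def sigmaProduct (z : ℂ) : ℂ := ∏' l : NonzeroPeriod L, primaryFactor (z / l)

lemma weierstrassSigma_eq (z : ℂ) : weierstrassSigma L z = z * sigmaProduct L z := by
  rw [weierstrassSigma, sigmaProduct]
  congr! 3 with l
  rw [primaryFactor, div_pow, div_div, mul_comm _ 2]

@[simp]
lemma sigmaProduct_zero : sigmaProduct L 0 = 1 := by
  simp [sigmaProduct, primaryFactor]

@[simp]
lemma weierstrassSigma_zero : weierstrassSigma L 0 = 0 := by simp [weierstrassSigma_eq]

lemma hasProdLocallyUniformlyOn_sigmaProduct :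
    HasProdLocallyUniformlyOn (fun (l : NonzeroPeriod L) (z : ℂ) => primaryFactor (z / l))
      (sigmaProduct L) Set.univ := by
  refine hasProdLocallyUniformlyOn_of_forall_compact isOpen_univ fun K _ hK => ?_
  obtain ⟨r, hr, hKr⟩ := hK.isBounded.exists_pos_norm_le
  have hbound : ∀ᶠ l : NonzeroPeriod L in cofinite, ∀ z ∈ K,
      ‖primaryFactor (z / l) - 1‖ ≤ Real.exp 2 * r ^ 3 * ‖(l : ℂ)‖⁻¹ ^ 3 := by
    filter_upwards [eventually_le_norm_nonzeroPeriod L r] with l hl z hz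
    exact norm_primaryFactor_div_sub_one_le (hKr z hz) hr hl
  simpa only [add_sub_cancel, sigmaProduct] using! Summable.hasProdUniformlyOn_one_add hK
    ((summable_norm_inv_cube_nonzeroPeriod L).mul_left (Real.exp 2 * r ^ 3)) hbound
    fun l => ((differentiable_primaryFactor_div l).sub_const 1).continuous.continuousOn

lemma differentiable_sigmaProduct : Differentiable ℂ (sigmaProduct L) := by
  rw [← differentiableOn_univ]
  exact (hasProdLocallyUniformlyOn_sigmaProduct L).differentiableOn
    (.of_forall fun s => .fun_finsetProd fun l _ =>
      (differentiable_primaryFactor_div l).differentiableOn) isOpen_univ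

lemma differentiable_weierstrassSigma : Differentiable ℂ (weierstrassSigma L) := by
  rw [funext (weierstrassSigma_eq L)]
  exact differentiable_id.mul (differentiable_sigmaProduct L)

lemma primaryFactor_div_nonzeroPeriod_ne_zero {z : ℂ} (hz : z ∈ (L.lattice \ {0} : Set ℂ)ᶜ)
    (l : NonzeroPeriod L) : primaryFactor (z / l) ≠ 0 := by
  rw [ne_eq, primaryFactor_eq_zero_iff, div_eq_one_iff_eq l.2.2]
  exact sub_ne_zero.mp (sub_nonzeroPeriod_ne_zero L hz l)

lemma summable_norm_primaryFactor_sub_one (z : ℂ) :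
    Summable fun l : NonzeroPeriod L => ‖primaryFactor (z / l) - 1‖ := by
  refine Summable.of_norm_bounded_eventually
    ((summable_norm_inv_cube_nonzeroPeriod L).mul_left (Real.exp 2 * (‖z‖ + 1) ^ 3)) ?_
  filter_upwards [eventually_le_norm_nonzeroPeriod L (‖z‖ + 1)] with l hl
  rw [norm_norm]
  exact norm_primaryFactor_div_sub_one_le (by linarith) (by positivity) hl

lemma sigmaProduct_ne_zero {z : ℂ} (hz : z ∈ (L.lattice \ {0} : Set ℂ)ᶜ) :
    sigmaProduct L z ≠ 0 := by
  simpa [sigmaProduct] using tprod_one_add_ne_zero_of_summable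
    (f := fun l : NonzeroPeriod L => primaryFactor (z / l) - 1)
    (fun l => by simpa using primaryFactor_div_nonzeroPeriod_ne_zero L hz l)
    (summable_norm_primaryFactor_sub_one L z)

lemma weierstrassSigma_eq_zero_iff {z : ℂ} : weierstrassSigma L z = 0 ↔ z ∈ L.lattice := by
  constructor
  · intro h
    by_contra hz
    rcases mul_eq_zero.mp (weierstrassSigma_eq L z ▸ h) with hz0 | hprod
    · exact hz (hz0 ▸ L.lattice.zero_mem)
    · exact sigmaProduct_ne_zero L (fun hz' => hz hz'.1) hprod
  · intro hz
    by_cases hz0 : z = 0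
    · rw [hz0, weierstrassSigma_zero]
    · have hfactor : ∃ l : NonzeroPeriod L, primaryFactor (z / l) = 0 :=
        ⟨⟨z, hz, hz0⟩, primaryFactor_eq_zero_iff.mpr (div_self hz0)⟩
      rw [weierstrassSigma_eq, sigmaProduct, (hasProd_zero_of_exists_eq_zero hfactor).tprod_eq,
        mul_zero]

lemma weierstrassSigma_ne_zero {z : ℂ} (hz : z ∉ L.lattice) : weierstrassSigma L z ≠ 0 :=
  fun h => hz ((weierstrassSigma_eq_zero_iff L).mp h)

@[simp]
lemma sigmaProduct_neg (z : ℂ) : sigmaProduct L (-z) = sigmaProduct L z := by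
  let negPeriod : NonzeroPeriod L ≃ NonzeroPeriod L :=
    (Equiv.neg ℂ).subtypeEquiv fun l => by simp
  rw [sigmaProduct, ← negPeriod.tprod_eq]
  simp [negPeriod, sigmaProduct, neg_div_neg_eq]

@[simp]
lemma weierstrassSigma_neg (z : ℂ) : weierstrassSigma L (-z) = -weierstrassSigma L z := by
  rw [weierstrassSigma_eq, weierstrassSigma_eq, sigmaProduct_neg, neg_mul]

lemma logDeriv_primaryFactor_div {z l : ℂ} (hl : l ≠ 0) (hzl : z - l ≠ 0) :
    logDeriv (fun z => primaryFactor (z / l)) z = zetaTerm l z := by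
  have hderiv : HasDerivAt (fun z => primaryFactor (z / l))
      (-(z / l) ^ 2 * Complex.exp (z / l + (z / l) ^ 2 / 2) * (1 / l)) z :=
    HasDerivAt.comp (h := fun z => z / l) z (hasDerivAt_primaryFactor (z / l))
      ((hasDerivAt_id z).div_const l)
  have hlz : l - z ≠ 0 := by rwa [← neg_sub, neg_ne_zero]
  have hexp := Complex.exp_ne_zero (z / l + (z / l) ^ 2 / 2)
  rw [logDeriv_apply, hderiv.deriv, primaryFactor, zetaTerm, mul_assoc,
    mul_comm (Complex.exp _), ← mul_assoc, mul_div_mul_right _ _ hexp, one_sub_div hl]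
  rw [← neg_sub z l] at hlz ⊢
  field_simp
  ring

lemma logDeriv_sigmaProduct {z : ℂ} (hz : z ∈ (L.lattice \ {0} : Set ℂ)ᶜ) :
    logDeriv (sigmaProduct L) z = zetaRegular L z := by
  have hterm (l : NonzeroPeriod L) :
      logDeriv (fun z => primaryFactor (z / l)) z = zetaTerm l z :=
    logDeriv_primaryFactor_div l.2.2 (sub_nonzeroPeriod_ne_zero L hz l)
  have hsummable : Summable fun l : NonzeroPeriod L => zetaTerm l z :=
    ((hasSumLocallyUniformlyOn_zetaRegular L L.isOpen_compl_lattice_sdiff).hasSum hz).summable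
  have htsum := logDeriv_tprod_eq_tsum (s := Set.univ) isOpen_univ (Set.mem_univ z)
    (f := fun (l : NonzeroPeriod L) (z : ℂ) => primaryFactor (z / l))
    (primaryFactor_div_nonzeroPeriod_ne_zero L hz)
    (fun l => (differentiable_primaryFactor_div l).differentiableOn)
    (by simpa only [hterm] using hsummable)
    (hasProdLocallyUniformlyOn_sigmaProduct L).multipliableLocallyUniformlyOn
    (sigmaProduct_ne_zero L hz)
  simpa only [hterm] using! htsum

lemma hasDerivAt_weierstrassSigma_zero : HasDerivAt (weierstrassSigma L) 1 0 := by
  rw [funext (weierstrassSigma_eq L)]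
  convert! (hasDerivAt_id (0 : ℂ)).mul ((differentiable_sigmaProduct L) 0).hasDerivAt using 1
  simp

lemma hasDerivAt_weierstrassSigma {z : ℂ} (hz : z ∉ L.lattice) :
    HasDerivAt (weierstrassSigma L) (weierstrassZeta L z * weierstrassSigma L z) z := by
  have hz0 : z ≠ 0 := fun h => hz (h ▸ L.lattice.zero_mem)
  have hz' : z ∈ (L.lattice \ {0} : Set ℂ)ᶜ := fun h => hz h.1
  have hlog := logDeriv_sigmaProduct L hz'
  rw [logDeriv_apply, div_eq_iff (sigmaProduct_ne_zero L hz')] at hlog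
  rw [funext (weierstrassSigma_eq L), weierstrassZeta_eq]
  convert! (hasDerivAt_id z).mul ((differentiable_sigmaProduct L) z).hasDerivAt using 1
  rw [hlog]
  simp only [id]
  field_simp

end ZetaSigma

/-! ### Quasiperiodicity and the addition formula -/

section Quasiperiodicity

variable (L : PeriodPair)

lemma countable_lattice : (L.lattice : Set ℂ).Countable := by
  have : Countable L.lattice := L.latticeEquivProd.toEquiv.countable_iff.mpr inferInstance
  exact Set.to_countable _

lemma isOpen_compl_lattice : IsOpen ((L.lattice : Set ℂ)ᶜ) := L.isClosed_lattice.isOpen_compl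

lemma isPreconnected_compl_lattice : IsPreconnected ((L.lattice : Set ℂ)ᶜ) :=
  ((countable_lattice L).isPathConnected_compl_of_one_lt_rank
    (by simp [Complex.rank_real_complex])).isConnected.isPreconnected

lemma eventually_notMem_lattice {z : ℂ} (hz : z ∉ L.lattice) : ∀ᶠ u in 𝓝 z, u ∉ L.lattice :=
  (isOpen_compl_lattice L).mem_nhds hz

lemma eventually_notMem_lattice_zero : ∀ᶠ u in 𝓝[≠] (0 : ℂ), u ∉ L.lattice := by
  have hnhds : (L.lattice \ {0} : Set ℂ)ᶜ ∈ 𝓝 (0 : ℂ) :=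
    L.isOpen_compl_lattice_sdiff.mem_nhds (by simp)
  filter_upwards [mem_nhdsWithin_of_mem_nhds hnhds, self_mem_nhdsWithin] with u hu hu0 hmem
  exact hu ⟨hmem, hu0⟩

lemma add_notMem_lattice {z l : ℂ} (hl : l ∈ L.lattice) (hz : z ∉ L.lattice) :
    z + l ∉ L.lattice := by
  rwa [Submodule.add_mem_iff_left _ hl]

lemma exists_eq_const_of_hasDerivAt_zero {f : ℂ → ℂ}
    (hf : ∀ z, z ∉ L.lattice → HasDerivAt f 0 z) : ∃ c, ∀ z, z ∉ L.lattice → f z = c :=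
  (isOpen_compl_lattice L).exists_is_const_of_deriv_eq_zero (isPreconnected_compl_lattice L)
    (fun z hz => (hf z hz).differentiableAt.differentiableWithinAt)
    (fun z hz => (hf z hz).deriv)

lemma weierstrassP_add_mem {l : ℂ} (hl : l ∈ L.lattice) (z : ℂ) :
    L.weierstrassP (z + l) = L.weierstrassP z := L.weierstrassP_add_coe z ⟨l, hl⟩

lemma derivWeierstrassP_add_mem {l : ℂ} (hl : l ∈ L.lattice) (z : ℂ) :
    L.derivWeierstrassP (z + l) = L.derivWeierstrassP z := L.derivWeierstrassP_add_coe z ⟨l, hl⟩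

/-- `η` is the quasiperiod of `ζ` at the period `l`, and `c` is the constant of the corresponding
transformation law of `σ`. -/
structure IsQuasiperiod (l η c : ℂ) : Prop where
  zeta_add : ∀ z, z ∉ L.lattice → weierstrassZeta L (z + l) = weierstrassZeta L z + η
  sigma_add : ∀ z, weierstrassSigma L (z + l) = c * Complex.exp (η * z) * weierstrassSigma L z

lemma exists_weierstrassZeta_add {l : ℂ} (hl : l ∈ L.lattice) :
    ∃ η, ∀ z, z ∉ L.lattice → weierstrassZeta L (z + l) = weierstrassZeta L z + η := by
  obtain ⟨η, hη⟩ := exists_eq_const_of_hasDerivAt_zero L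
    (f := fun z => weierstrassZeta L (z + l) - weierstrassZeta L z) fun z hz => by
      have hshift :=
        (hasDerivAt_weierstrassZeta L (add_notMem_lattice L hl hz)).comp_add_const z l
      convert! hshift.sub (hasDerivAt_weierstrassZeta L hz) using 1
      rw [weierstrassP_add_mem L hl, sub_self]
  exact ⟨η, fun z hz => by rw [← hη z hz, add_sub_cancel]⟩

lemma exists_weierstrassSigma_add {l η : ℂ} (hl : l ∈ L.lattice)
    (hη : ∀ z, z ∉ L.lattice → weierstrassZeta L (z + l) = weierstrassZeta L z + η) :
    ∃ c, ∀ z, weierstrassSigma L (z + l) = c * Complex.exp (η * z) * weierstrassSigma L z := by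
  obtain ⟨c, hc⟩ := exists_eq_const_of_hasDerivAt_zero L
    (f := fun z => weierstrassSigma L (z + l) * Complex.exp (-(η * z)) / weierstrassSigma L z)
    fun z hz => by
      have hshift :=
        (hasDerivAt_weierstrassSigma L (add_notMem_lattice L hl hz)).comp_add_const z l
      have hexp : HasDerivAt (fun z => Complex.exp (-(η * z))) _ z :=
        ((hasDerivAt_id z).const_mul η).fun_neg.cexp
      convert! (hshift.mul hexp).div (hasDerivAt_weierstrassSigma L hz)
        (weierstrassSigma_ne_zero L hz) using 1
      rw [hη z hz]
      simp only [id, Pi.mul_apply]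
      ring
  refine ⟨c, fun z => ?_⟩
  by_cases hz : z ∈ L.lattice
  · rw [(weierstrassSigma_eq_zero_iff L).mpr hz,
      (weierstrassSigma_eq_zero_iff L).mpr (add_mem hz hl), mul_zero]
  · have hσ := weierstrassSigma_ne_zero L hz
    rw [← hc z hz, Complex.exp_neg]
    field_simp [Complex.exp_ne_zero (η * z)]

lemma exists_isQuasiperiod {l : ℂ} (hl : l ∈ L.lattice) : ∃ η c, IsQuasiperiod L l η c := by
  obtain ⟨η, hη⟩ := exists_weierstrassZeta_add L hl
  obtain ⟨c, hc⟩ := exists_weierstrassSigma_add L hl hη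
  exact ⟨η, c, hη, hc⟩

variable {L}

-- Going from `-u - l` to `-u` and from `u` to `u + l` compares `σ(u)` with itself, as `σ` is odd.
lemma IsQuasiperiod.sq_eq_exp {l η c : ℂ} (h : IsQuasiperiod L l η c) :
    c ^ 2 = Complex.exp (η * l) := by
  set u := L.ω₁ / 2
  have hσu : weierstrassSigma L u ≠ 0 := weierstrassSigma_ne_zero L L.ω₁_div_two_notMem_lattice
  have hshift := h.sigma_add (-u - l)
  rw [sub_add_cancel, ← neg_add', weierstrassSigma_neg, weierstrassSigma_neg,
    h.sigma_add u] at hshift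
  have hexp : Complex.exp (η * -(u + l)) * Complex.exp (η * u) * Complex.exp (η * l) = 1 := by
    rw [← Complex.exp_add, ← Complex.exp_add, ← Complex.exp_zero]
    ring_nf
  apply mul_right_cancel₀ hσu
  linear_combination (-(c ^ 2 * weierstrassSigma L u)) * hexp +
    Complex.exp (η * l) * hshift

lemma IsQuasiperiod.ne_zero {l η c : ℂ} (h : IsQuasiperiod L l η c) : c ≠ 0 := by
  rintro rfl
  exact Complex.exp_ne_zero (η * l) (by rw [← h.sq_eq_exp, zero_pow two_ne_zero])

variable (L)

lemma eq_const_of_periodic {f g : ℂ → ℂ} (hper : ∀ l ∈ L.lattice, ∀ z, f (z + l) = f z)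
    (hf : ∀ z, z ∉ L.lattice → DifferentiableAt ℂ f z) (hg : DifferentiableAt ℂ g 0)
    (hfg : f =ᶠ[𝓝[≠] 0] g) : ∀ z, z ∉ L.lattice → f z = g 0 := by
  classical
  let F : ℂ → ℂ := fun z => if z ∈ L.lattice then g 0 else f z
  have hFper : ∀ l ∈ L.lattice, ∀ z, F (z + l) = F z := by
    intro l hl z
    simp only [F, Submodule.add_mem_iff_left _ hl, hper l hl]
  have hF0 : DifferentiableAt ℂ F 0 := by
    refine hg.congr_of_eventuallyEq ?_
    rw [eventuallyEq_nhdsWithin_iff] at hfg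
    filter_upwards [hfg, eventually_nhdsWithin_iff.mp (eventually_notMem_lattice_zero L)]
      with u hfu hu
    by_cases hu0 : u = 0
    · simp [F, hu0]
    · simp [F, hu hu0, hfu hu0]
  have hF : Differentiable ℂ F := by
    intro z
    by_cases hz : z ∈ L.lattice
    · have hshift : F = fun u => F (u - z) := by
        ext u
        rw [← hFper z hz (u - z), sub_add_cancel]
      rw [hshift]
      exact DifferentiableAt.comp (f := fun u => u - z) z (by simpa using hF0) (by fun_prop)
    · refine (hf z hz).congr_of_eventuallyEq ?_
      filter_upwards [eventually_notMem_lattice L hz] with u hu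
      simp [F, hu]
  have hbounded := (IsZLattice.isCompact_range_of_periodic L.lattice F hF.continuous
    fun z w hw => hFper w hw z).isBounded
  intro z hz
  simpa [F, hz] using hF.apply_eq_apply_of_bounded hbounded z 0

end Quasiperiodicity

lemma analyticAt_dslope_same {f : ℂ → ℂ} {a : ℂ} (hf : AnalyticAt ℂ f a) :
    AnalyticAt ℂ (dslope f a) a := by
  obtain ⟨p, hp⟩ := hf
  exact ⟨_, hp.has_fpower_series_dslope_fslope⟩

lemma exists_analyticAt_eq_sq_mul {f : ℂ → ℂ} (hf : AnalyticAt ℂ f 0) (hf0 : f 0 = 0)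
    (hf' : HasDerivAt f 0 0) : ∃ g, AnalyticAt ℂ g 0 ∧ ∀ u, f u = u ^ 2 * g u := by
  refine ⟨dslope (dslope f 0) 0, analyticAt_dslope_same (analyticAt_dslope_same hf),
    fun u => ?_⟩
  have hfirst := sub_smul_dslope f 0 u
  have hsecond := sub_smul_dslope (dslope f 0) 0 u
  rw [dslope_same, hf'.deriv] at hsecond
  simp only [hf0, sub_zero, smul_eq_mul] at hfirst hsecond
  rw [← hfirst, ← hsecond, sq, mul_assoc]

lemma hasDerivAt_zero_of_even {f : ℂ → ℂ} (hf : DifferentiableAt ℂ f 0)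
    (heven : ∀ u, f (-u) = f u) : HasDerivAt f 0 0 := by
  have hneg : HasDerivAt (fun u => f (-u)) (deriv f 0 * -1) 0 :=
    HasDerivAt.comp (h := fun u : ℂ => -u) 0 (by simpa using hf.hasDerivAt) (hasDerivAt_neg 0)
  simp only [heven] at hneg
  have hderiv : deriv f 0 = 0 := by linear_combination hf.hasDerivAt.unique hneg / 2
  simpa only [hderiv] using hf.hasDerivAt

section Elliptic

variable (L : PeriodPair)

lemma sq_mul_weierstrassP {u : ℂ} (hu : u ≠ 0) :
    u ^ 2 * L.weierstrassP u = 1 + u ^ 2 * L.weierstrassPExcept 0 u := by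
  have hexcept := L.weierstrassPExcept_add 0 u
  simp only [ZeroMemClass.coe_zero, sub_zero] at hexcept
  rw [← hexcept]
  field_simp
  ring

lemma hasDerivAt_weierstrassP {z : ℂ} (hz : z ∉ L.lattice) :
    HasDerivAt L.weierstrassP (L.derivWeierstrassP z) z := by
  rw [← L.deriv_weierstrassP]
  exact (L.analyticOnNhd_weierstrassP z hz).differentiableAt.hasDerivAt

/-- The quotient of sigma functions `σ(u + v) σ(u - v) / (σ(u)² σ(v)²)`, which the addition formula
`weierstrassSigma_add_mul_sub` identifies with `℘(v) - ℘(u)`. -/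
def sigmaQuotient (v u : ℂ) : ℂ :=
  weierstrassSigma L (u + v) * weierstrassSigma L (u - v) /
    (weierstrassSigma L u ^ 2 * weierstrassSigma L v ^ 2)

lemma sigmaQuotient_self (v : ℂ) : sigmaQuotient L v v = 0 := by
  simp [sigmaQuotient]

lemma sigmaQuotient_add_mem {l : ℂ} (hl : l ∈ L.lattice) (v z : ℂ) :
    sigmaQuotient L v (z + l) = sigmaQuotient L v z := by
  obtain ⟨η, c, hq⟩ := exists_isQuasiperiod L hl
  have hfactor : c * Complex.exp (η * z) ≠ 0 := mul_ne_zero hq.ne_zero (Complex.exp_ne_zero _)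
  have hexp : Complex.exp (η * (z + v)) * Complex.exp (η * (z - v)) = Complex.exp (η * z) ^ 2 := by
    rw [← Complex.exp_add, ← Complex.exp_nat_mul]
    push_cast
    ring_nf
  rw [sigmaQuotient, add_right_comm, add_sub_right_comm, hq.sigma_add, hq.sigma_add, hq.sigma_add,
    mul_pow (c * Complex.exp (η * z)), mul_assoc _ (weierstrassSigma L z ^ 2)]
  refine Eq.trans ?_ (mul_div_mul_left _ _ (pow_ne_zero 2 hfactor))
  congr 1
  linear_combination c ^ 2 * weierstrassSigma L (z + v) * weierstrassSigma L (z - v) * hexp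

lemma differentiableAt_sigmaQuotient {v u : ℂ} (hv : v ∉ L.lattice) (hu : u ∉ L.lattice) :
    DifferentiableAt ℂ (sigmaQuotient L v) u := by
  have hσ := differentiable_weierstrassSigma L
  refine DifferentiableAt.div (by fun_prop) (by fun_prop) ?_
  exact mul_ne_zero (pow_ne_zero 2 (weierstrassSigma_ne_zero L hu))
    (pow_ne_zero 2 (weierstrassSigma_ne_zero L hv))

lemma exists_sq_mul_sigmaQuotient {v : ℂ} (hv : v ∉ L.lattice) :
    ∃ g, AnalyticAt ℂ g 0 ∧ ∀ u ≠ 0, u ^ 2 * sigmaQuotient L v u = -1 + u ^ 2 * g u := by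
  have hσ := differentiable_weierstrassSigma L
  have hprod := differentiable_sigmaProduct L
  have hσv := weierstrassSigma_ne_zero L hv
  let n : ℂ → ℂ := fun u => weierstrassSigma L (u + v) * weierstrassSigma L (u - v) /
    (sigmaProduct L u ^ 2 * weierstrassSigma L v ^ 2) + 1
  have hn : AnalyticAt ℂ n 0 := by
    refine AnalyticAt.add (AnalyticAt.div ?_ ?_ ?_) analyticAt_const
    · exact Differentiable.analyticAt (by fun_prop) 0
    · exact Differentiable.analyticAt (by fun_prop) 0
    · simp [hσv]
  have hn0 : n 0 = 0 := by
    simp only [n, zero_add, zero_sub, weierstrassSigma_neg, sigmaProduct_zero]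
    field_simp
    ring
  have heven (u : ℂ) : n (-u) = n u := by
    simp only [n, sigmaProduct_neg]
    rw [neg_add_eq_sub, ← neg_sub u v, ← neg_add', weierstrassSigma_neg, weierstrassSigma_neg,
      neg_mul_neg, mul_comm (weierstrassSigma L (u - v))]
  obtain ⟨g, hg, hng⟩ := exists_analyticAt_eq_sq_mul hn hn0
    (hasDerivAt_zero_of_even hn.differentiableAt heven)
  refine ⟨g, hg, fun u hu => ?_⟩
  rw [← hng u, sigmaQuotient, weierstrassSigma_eq L u, mul_pow, mul_assoc (u ^ 2),
    ← mul_div_assoc, mul_div_mul_left _ _ (pow_ne_zero 2 hu)]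
  ring

lemma weierstrassSigma_add_mul_sub {u v : ℂ} (hu : u ∉ L.lattice) (hv : v ∉ L.lattice) :
    weierstrassSigma L (u + v) * weierstrassSigma L (u - v) =
      (L.weierstrassP v - L.weierstrassP u) *
        (weierstrassSigma L u ^ 2 * weierstrassSigma L v ^ 2) := by
  obtain ⟨g, hg, hprincipal⟩ := exists_sq_mul_sigmaQuotient L hv
  have hconst := eq_const_of_periodic L
    (f := fun u => sigmaQuotient L v u + L.weierstrassP u)
    (g := fun u => g u + L.weierstrassPExcept 0 u)
    (fun l hl z => by rw [sigmaQuotient_add_mem L hl, weierstrassP_add_mem L hl])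
    (fun z hz => (differentiableAt_sigmaQuotient L hv hz).add
      (hasDerivAt_weierstrassP L hz).differentiableAt)
    (hg.differentiableAt.add (L.analyticAt_weierstrassPExcept 0).differentiableAt)
    (by
      filter_upwards [self_mem_nhdsWithin] with u (hu0 : u ≠ 0)
      apply mul_left_cancel₀ (pow_ne_zero 2 hu0)
      linear_combination hprincipal u hu0 + sq_mul_weierstrassP L hu0)
  have hquotient : sigmaQuotient L v u = L.weierstrassP v - L.weierstrassP u := by
    have hv0 := sigmaQuotient_self L v
    linear_combination hconst u hu - hconst v hv + hv0
  rw [← hquotient, sigmaQuotient, div_mul_cancel₀]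
  exact mul_ne_zero (pow_ne_zero 2 (weierstrassSigma_ne_zero L hu))
    (pow_ne_zero 2 (weierstrassSigma_ne_zero L hv))

lemma sub_or_add_mem_of_weierstrassP_eq {u v : ℂ} (hu : u ∉ L.lattice) (hv : v ∉ L.lattice)
    (h : L.weierstrassP u = L.weierstrassP v) : u - v ∈ L.lattice ∨ u + v ∈ L.lattice := by
  have hσ := weierstrassSigma_add_mul_sub L hu hv
  rw [h, sub_self, zero_mul, mul_eq_zero, weierstrassSigma_eq_zero_iff,
    weierstrassSigma_eq_zero_iff] at hσ
  exact hσ.symm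

lemma exists_weierstrassP_eq (a : ℂ) : ∃ z, z ∉ L.lattice ∧ L.weierstrassP z = a := by
  by_contra! hne
  have hzero := eq_const_of_periodic L (f := fun z => 1 / (L.weierstrassP z - a))
    (g := fun u => u ^ 2 / (1 + u ^ 2 * (L.weierstrassPExcept 0 u - a)))
    (fun l hl z => by simp only [weierstrassP_add_mem L hl])
    (fun z hz => DifferentiableAt.div (by fun_prop)
      ((hasDerivAt_weierstrassP L hz).differentiableAt.sub_const _)
      (sub_ne_zero.mpr (hne z hz)))
    (DifferentiableAt.div (by fun_prop)
      (by have := (L.analyticAt_weierstrassPExcept 0).differentiableAt; fun_prop) (by simp))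
    (by
      filter_upwards [self_mem_nhdsWithin] with u (hu0 : u ≠ 0)
      have hexcept : 1 + u ^ 2 * (L.weierstrassPExcept 0 u - a) =
          u ^ 2 * (L.weierstrassP u - a) := by
        linear_combination -sq_mul_weierstrassP L hu0
      rw [hexcept, ← div_div, div_self (pow_ne_zero 2 hu0)])
    _ L.ω₁_div_two_notMem_lattice
  simp only [ne_eq, OfNat.ofNat_ne_zero, not_false_eq_true, zero_pow, zero_div, one_div,
    inv_eq_zero, sub_eq_zero] at hzero
  exact hne _ L.ω₁_div_two_notMem_lattice hzero

/-- `h` is half of a period without being a period itself. -/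
structure IsHalfPeriod (h : ℂ) : Prop where
  two_mul_mem : 2 * h ∈ L.lattice
  notMem : h ∉ L.lattice

lemma derivWeierstrassP_half {h : ℂ} (hh : 2 * h ∈ L.lattice) : L.derivWeierstrassP h = 0 := by
  have hshift := derivWeierstrassP_add_mem L hh (-h)
  rw [two_mul, neg_add_cancel_left, L.derivWeierstrassP_neg] at hshift
  linear_combination hshift / 2

-- By the addition formula `℘(z) - ℘(h) = -σ(z + h) σ(z - h) / (σ(z)² σ(h)²)`, and `σ(z + h)` is
-- `σ(z - h)` up to an exponential factor, since `2h` is a period.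
lemma exists_weierstrassP_sub_half_eq_sq {h : ℂ} (hh : IsHalfPeriod L h) :
    ∃ η d : ℂ, d ≠ 0 ∧ ∀ z, z ∉ L.lattice → L.weierstrassP z - L.weierstrassP h =
      (d * Complex.exp (η * z) * weierstrassSigma L (z - h) / weierstrassSigma L z) ^ 2 := by
  obtain ⟨η, c, hq⟩ := exists_isQuasiperiod L hh.two_mul_mem
  have hσh := weierstrassSigma_ne_zero L hh.notMem
  obtain ⟨d, hd⟩ := IsAlgClosed.exists_pow_nat_eq
    (-c * Complex.exp (-(η * h)) / weierstrassSigma L h ^ 2) two_pos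
  have hd0 : d ^ 2 ≠ 0 := by
    rw [hd]
    exact div_ne_zero (mul_ne_zero (neg_ne_zero.mpr hq.ne_zero) (Complex.exp_ne_zero _))
      (pow_ne_zero 2 hσh)
  refine ⟨η / 2, d, fun h0 => hd0 (by rw [h0, zero_pow two_ne_zero]), fun z hz => ?_⟩
  have hσz := weierstrassSigma_ne_zero L hz
  have hσadd : weierstrassSigma L (z + h) =
      c * (Complex.exp (η * z) * Complex.exp (-(η * h))) * weierstrassSigma L (z - h) := by
    rw [← Complex.exp_add, ← sub_eq_add_neg, ← mul_sub, ← hq.sigma_add]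
    ring_nf
  have hexp : Complex.exp (η / 2 * z) ^ 2 = Complex.exp (η * z) := by
    rw [← Complex.exp_nat_mul]
    push_cast
    ring_nf
  have haddition := weierstrassSigma_add_mul_sub L hz hh.notMem
  rw [hσadd] at haddition
  rw [div_pow, mul_pow, mul_pow, hd, hexp]
  field_simp
  linear_combination haddition

lemma two_mul_mem_of_weierstrassP_eq {u h : ℂ} (hh : IsHalfPeriod L h) (hu : u ∉ L.lattice)
    (he : L.weierstrassP u = L.weierstrassP h) : 2 * u ∈ L.lattice := by
  rcases sub_or_add_mem_of_weierstrassP_eq L hu hh.notMem he with hmem | hmem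
  · convert! add_mem (add_mem hmem hmem) hh.two_mul_mem using 1
    ring
  · convert! sub_mem (add_mem hmem hmem) hh.two_mul_mem using 1
    ring

end Elliptic

/-! ### The Lamé function and the spectral relation -/

section LamePhi

variable (L : PeriodPair)

lemma lamePhi_add_mem {w l z : ℂ} (hl : l ∈ L.lattice) (hz : z ∉ L.lattice) (x : ℝ) :
    lamePhi L w x (z + l) = lamePhi L w x z := by
  obtain ⟨η, c, hq⟩ := exists_isQuasiperiod L hl
  have hdenominator : weierstrassSigma L (w - z) = c * Complex.exp (η * (w - (z + l))) *
      weierstrassSigma L (w - (z + l)) := by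
    rw [← hq.sigma_add, sub_add_eq_sub_sub, sub_add_cancel]
  have hexp : Complex.exp (-(weierstrassZeta L z + η) * x) =
      Complex.exp (-weierstrassZeta L z * x) * Complex.exp (-(η * x)) := by
    rw [← Complex.exp_add]
    ring_nf
  have hfactors : (c * Complex.exp (η * (w - (z + l))))⁻¹ =
      c * Complex.exp (η * (x - w + z)) * Complex.exp (-(η * x)) := by
    apply inv_eq_of_mul_eq_one_left
    have hcancel : Complex.exp (η * l) * Complex.exp (η * (w - (z + l))) *
        Complex.exp (η * (x - w + z)) * Complex.exp (-(η * x)) = 1 := by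
      rw [← Complex.exp_add, ← Complex.exp_add, ← Complex.exp_add, ← Complex.exp_zero]
      ring_nf
    rw [← hcancel, ← hq.sq_eq_exp]
    ring
  rw [lamePhi, lamePhi, hq.zeta_add z hz, hdenominator, ← add_assoc, hq.sigma_add, hexp,
    div_eq_mul_inv, div_eq_mul_inv, mul_inv, mul_inv, mul_inv (c * _), hfactors]
  ring

lemma analyticAt_weierstrassZeta {z : ℂ} (hz : z ∉ L.lattice) :
    AnalyticAt ℂ (weierstrassZeta L) z := by
  have hdiff : DifferentiableOn ℂ (weierstrassZeta L) ((L.lattice : Set ℂ)ᶜ) := fun z hz =>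
    (hasDerivAt_weierstrassZeta L hz).differentiableAt.differentiableWithinAt
  exact hdiff.analyticAt ((isOpen_compl_lattice L).mem_nhds hz)

lemma analyticAt_lamePhi {w z : ℂ} {x : ℝ} (hx : x - w ∉ L.lattice) (hz : z ∉ L.lattice)
    (hwz : w - z ∉ L.lattice) : AnalyticAt ℂ (lamePhi L w x) z := by
  have hζ := analyticAt_weierstrassZeta L hz
  have hnum : AnalyticAt ℂ (fun z => weierstrassSigma L (x - w + z)) z :=
    Differentiable.analyticAt ((differentiable_weierstrassSigma L).comp (by fun_prop)) z
  have hden : AnalyticAt ℂ (fun z => weierstrassSigma L (w - z)) z :=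
    Differentiable.analyticAt ((differentiable_weierstrassSigma L).comp (by fun_prop)) z
  exact ((hnum.mul analyticAt_const).div (analyticAt_const.mul hden)
    (mul_ne_zero (weierstrassSigma_ne_zero L hx) (weierstrassSigma_ne_zero L hwz))).mul
    ((hζ.neg.mul analyticAt_const).cexp)

-- The double pole of `φ²` at the half-period `w` is compensated by the double zero of `℘ - ℘(w)`.
lemma exists_norm_sq_lamePhi_le {w : ℂ} (hw : IsHalfPeriod L w) (x : ℝ) :
    ∃ K : ℂ → ℂ, (∀ u, u ∉ L.lattice → ContinuousAt K u) ∧ ∀ u, u ∉ L.lattice →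
      ‖lamePhi L w x u‖ ^ 2 * ‖L.weierstrassP u - L.weierstrassP w‖ ≤ ‖K u‖ := by
  obtain ⟨η, d, -, hsq⟩ := exists_weierstrassP_sub_half_eq_sq L hw
  refine ⟨fun u => (weierstrassSigma L (x - w + u) * weierstrassSigma L w /
    weierstrassSigma L (x - w) * Complex.exp (-weierstrassZeta L u * x) *
      (d * Complex.exp (η * u) / weierstrassSigma L u)) ^ 2, fun u hu => ?_, fun u hu => ?_⟩
  · have hζ := (analyticAt_weierstrassZeta L hu).continuousAt
    have hσ := (differentiable_weierstrassSigma L).continuous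
    have hσu := weierstrassSigma_ne_zero L hu
    fun_prop (disch := assumption)
  · have hodd : weierstrassSigma L (u - w) = -weierstrassSigma L (w - u) := by
      rw [← weierstrassSigma_neg, neg_sub]
    rw [← norm_pow, ← norm_mul, hsq u hu, lamePhi, hodd]
    by_cases hwu : weierstrassSigma L (w - u) = 0
    · simp only [hwu, mul_zero, div_zero, zero_mul, norm_zero, ne_eq, OfNat.ofNat_ne_zero,
        not_false_eq_true, zero_pow, norm_nonneg]
    · by_cases hxw : weierstrassSigma L (x - w) = 0
      · simp [hxw]
      · have hσu := weierstrassSigma_ne_zero L hu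
        apply le_of_eq
        congr 1
        field_simp

end LamePhi

/-- The numbers `e₁, e₂, e₃` determined by `k₁, k₂` are the values of `℘` at the half-periods
`h₁, w, h₃`. The lattice need not be rectangular. -/
structure HalfPeriodValues (L : PeriodPair) (k₁ k₂ : ℝ) (h₁ w h₃ : ℂ) : Prop where
  pos : 0 < k₁
  lt : k₁ < k₂
  isHalfPeriod_h₁ : IsHalfPeriod L h₁
  isHalfPeriod_w : IsHalfPeriod L w
  isHalfPeriod_h₃ : IsHalfPeriod L h₃
  weierstrassP_h₁ : L.weierstrassP h₁ = e₁ k₁ k₂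
  weierstrassP_w : L.weierstrassP w = e₂ k₁ k₂
  weierstrassP_h₃ : L.weierstrassP h₃ = e₃ k₁ k₂

lemma ofReal_e₁ (k₁ k₂ : ℝ) : ((e₁ k₁ k₂ : ℝ) : ℂ) = e₃ k₁ k₂ + (k₂ : ℂ) ^ 2 := by
  simp [e₁]

lemma ofReal_e₂ (k₁ k₂ : ℝ) : ((e₂ k₁ k₂ : ℝ) : ℂ) = e₃ k₁ k₂ + (k₁ : ℂ) ^ 2 := by
  simp [e₂]

lemma ofReal_e₃ (k₁ k₂ : ℝ) : ((e₃ k₁ k₂ : ℝ) : ℂ) = -((k₁ : ℂ) ^ 2 + (k₂ : ℂ) ^ 2) / 3 := by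
  simp [e₃]

namespace HalfPeriodValues

variable {L : PeriodPair} {k₁ k₂ : ℝ} {h₁ w h₃ : ℂ} (H : HalfPeriodValues L k₁ k₂ h₁ w h₃)
include H

lemma sq_sub_sq_ne_zero : (k₁ : ℂ) ^ 2 - (k₂ : ℂ) ^ 2 ≠ 0 := by
  have hlt : k₁ ^ 2 < k₂ ^ 2 := pow_lt_pow_left₀ H.lt H.pos.le two_ne_zero
  exact_mod_cast (sub_neg.mpr hlt).ne

lemma k₁_ne_zero : (k₁ : ℂ) ≠ 0 := by exact_mod_cast H.pos.ne'

lemma k₂_ne_zero : (k₂ : ℂ) ≠ 0 := by exact_mod_cast (H.pos.trans H.lt).ne'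

lemma g₂_eq : L.g₂ = 4 / 3 * (((k₁ : ℂ) ^ 2) ^ 2 - (k₁ : ℂ) ^ 2 * (k₂ : ℂ) ^ 2 +
    ((k₂ : ℂ) ^ 2) ^ 2) := by
  have hcubic₁ := L.derivWeierstrassP_sq h₁ H.isHalfPeriod_h₁.notMem
  have hcubic₂ := L.derivWeierstrassP_sq w H.isHalfPeriod_w.notMem
  rw [derivWeierstrassP_half L H.isHalfPeriod_h₁.two_mul_mem, H.weierstrassP_h₁, ofReal_e₁,
    ofReal_e₃] at hcubic₁
  rw [derivWeierstrassP_half L H.isHalfPeriod_w.two_mul_mem, H.weierstrassP_w, ofReal_e₂,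
    ofReal_e₃] at hcubic₂
  apply mul_left_cancel₀ H.sq_sub_sq_ne_zero
  linear_combination hcubic₂ - hcubic₁

lemma derivWeierstrassP_sq {z k : ℂ} (hz : z ∉ L.lattice)
    (hk : k ^ 2 = e₃ k₁ k₂ - L.weierstrassP z) :
    L.derivWeierstrassP z ^ 2 =
      -4 * k ^ 2 * ((k ^ 2 + (k₁ : ℂ) ^ 2) * (k ^ 2 + (k₂ : ℂ) ^ 2)) := by
  have hcubic₃ := L.derivWeierstrassP_sq h₃ H.isHalfPeriod_h₃.notMem
  rw [derivWeierstrassP_half L H.isHalfPeriod_h₃.two_mul_mem, H.weierstrassP_h₃, ofReal_e₃,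
    H.g₂_eq] at hcubic₃
  have hP : L.weierstrassP z = e₃ k₁ k₂ - k ^ 2 := by rw [hk, sub_sub_cancel]
  rw [L.derivWeierstrassP_sq z hz, hP, ofReal_e₃, H.g₂_eq]
  linear_combination -hcubic₃

lemma two_mul_mem_of_derivWeierstrassP_eq_zero {v : ℂ} (hv : v ∉ L.lattice)
    (h : L.derivWeierstrassP v = 0) : 2 * v ∈ L.lattice := by
  obtain ⟨k, hk⟩ := IsAlgClosed.exists_pow_nat_eq
    ((e₃ k₁ k₂ : ℂ) - L.weierstrassP v) two_pos
  have hcubic := H.derivWeierstrassP_sq hv hk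
  have hroot : (k ^ 2) * ((k ^ 2 + (k₁ : ℂ) ^ 2) * (k ^ 2 + (k₂ : ℂ) ^ 2)) = 0 := by
    rw [h] at hcubic
    linear_combination hcubic / 4
  rw [mul_eq_zero, mul_eq_zero, hk] at hroot
  rcases hroot with h₃root | wroot | h₁root
  · refine two_mul_mem_of_weierstrassP_eq L H.isHalfPeriod_h₃ hv ?_
    rw [H.weierstrassP_h₃]
    linear_combination -h₃root
  · refine two_mul_mem_of_weierstrassP_eq L H.isHalfPeriod_w hv ?_
    rw [H.weierstrassP_w, ofReal_e₂]
    linear_combination -wroot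
  · refine two_mul_mem_of_weierstrassP_eq L H.isHalfPeriod_h₁ hv ?_
    rw [H.weierstrassP_h₁, ofReal_e₁]
    linear_combination -h₁root

lemma sub_mem_of_weierstrassP_eq_of_derivWeierstrassP_eq {u v : ℂ} (hu : u ∉ L.lattice)
    (hv : v ∉ L.lattice) (h : L.weierstrassP u = L.weierstrassP v)
    (h' : L.derivWeierstrassP u = L.derivWeierstrassP v) : u - v ∈ L.lattice := by
  rcases sub_or_add_mem_of_weierstrassP_eq L hu hv h with hsub | hadd
  · exact hsub
  · have hodd := derivWeierstrassP_add_mem L hadd (-v)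
    rw [neg_add_cancel_comm_assoc, L.derivWeierstrassP_neg, h'] at hodd
    have hhalf := H.two_mul_mem_of_derivWeierstrassP_eq_zero hv (by linear_combination hodd / 2)
    convert! sub_mem hadd hhalf using 1
    ring

end HalfPeriodValues

/-! ### Local solutions of the spectral relation -/

lemma exists_analyticAt_rightInverse {F : ℂ → ℂ} {z₀ : ℂ} (hF : AnalyticAt ℂ F z₀)
    (hF' : deriv F z₀ ≠ 0) :
    ∃ f : ℂ → ℂ, AnalyticAt ℂ f (F z₀) ∧ f (F z₀) = z₀ ∧ ∀ᶠ k in 𝓝 (F z₀), F (f k) = k :=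
  ⟨_, hF.analyticAt_localInverse hF', HasStrictFDerivAt.localInverse_apply_image ..,
    hF.hasStrictDerivAt.eventually_right_inverse hF'⟩

section HalfPeriodRoot

variable (L : PeriodPair)

lemma exists_analyticAt_sq_eq_weierstrassP_sub {h : ℂ} (hh : IsHalfPeriod L h) :
    ∃ s : ℂ → ℂ, (∀ z, z ∉ L.lattice → AnalyticAt ℂ s z) ∧
      (∀ z, z ∉ L.lattice → L.weierstrassP z - L.weierstrassP h = s z ^ 2) ∧ deriv s h ≠ 0 := by
  obtain ⟨η, d, hd, hsq⟩ := exists_weierstrassP_sub_half_eq_sq L hh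
  have hσ := differentiable_weierstrassSigma L
  refine ⟨_, fun z hz => AnalyticAt.fun_div (Differentiable.analyticAt (by fun_prop) z)
    (hσ.analyticAt z) (weierstrassSigma_ne_zero L hz), hsq, ?_⟩
  have hsimple : HasDerivAt (fun z => weierstrassSigma L (z - h)) 1 h :=
    HasDerivAt.comp_sub_const (f := weierstrassSigma L) h h
      (by simpa using hasDerivAt_weierstrassSigma_zero L)
  have hfactor : DifferentiableAt ℂ (fun z => d * Complex.exp (η * z) / weierstrassSigma L z) h :=
    DifferentiableAt.div (by fun_prop) (by fun_prop) (weierstrassSigma_ne_zero L hh.notMem)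
  have hsplit : (fun z => d * Complex.exp (η * z) * weierstrassSigma L (z - h) /
      weierstrassSigma L z) = fun z => d * Complex.exp (η * z) / weierstrassSigma L z *
        weierstrassSigma L (z - h) := by
    ext z
    rw [mul_div_right_comm]
  rw [hsplit, (hfactor.hasDerivAt.fun_mul hsimple).deriv, sub_self, weierstrassSigma_zero, mul_zero,
    zero_add, mul_one]
  exact div_ne_zero (mul_ne_zero hd (Complex.exp_ne_zero _)) (weierstrassSigma_ne_zero L hh.notMem)

variable {L}

lemma two_mul_mul_deriv_eq_derivWeierstrassP {s : ℂ → ℂ} {e z : ℂ}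
    (hs : ∀ z, z ∉ L.lattice → AnalyticAt ℂ s z)
    (hsq : ∀ z, z ∉ L.lattice → L.weierstrassP z - e = s z ^ 2) (hz : z ∉ L.lattice) :
    2 * s z * deriv s z = L.derivWeierstrassP z := by
  have heq : (fun z => L.weierstrassP z - e) =ᶠ[𝓝 z] fun z => s z ^ 2 := by
    filter_upwards [eventually_notMem_lattice L hz] with u hu
    exact hsq u hu
  have hderiv := ((hs z hz).differentiableAt.hasDerivAt.fun_pow 2).congr_of_eventuallyEq heq
  simpa using hderiv.unique ((hasDerivAt_weierstrassP L hz).sub_const e)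

end HalfPeriodRoot

/-- `f` is a solution of `k² = e - ℘(f(k))`, holomorphic near `k₀`. -/
structure IsLocalSolution (L : PeriodPair) (e : ℂ) (f : ℂ → ℂ) (k₀ : ℂ) : Prop where
  analyticAt : AnalyticAt ℂ f k₀
  eventually_notMem : ∀ᶠ k in 𝓝 k₀, f k ∉ L.lattice
  eventually_sq_eq : ∀ᶠ k in 𝓝 k₀, k ^ 2 = e - L.weierstrassP (f k)

namespace IsLocalSolution

variable {L : PeriodPair} {e : ℂ} {f : ℂ → ℂ} {k₀ : ℂ} (hf : IsLocalSolution L e f k₀)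
include hf

lemma neg : IsLocalSolution L e (-f) k₀ where
  analyticAt := hf.analyticAt.neg
  eventually_notMem := by simpa using hf.eventually_notMem
  eventually_sq_eq := by simpa using hf.eventually_sq_eq

lemma eventually_derivWeierstrassP_mul_deriv :
    ∀ᶠ k in 𝓝 k₀, L.derivWeierstrassP (f k) * deriv f k = -2 * k := by
  filter_upwards [hf.eventually_notMem, hf.eventually_sq_eq.eventually_nhds,
    hf.analyticAt.eventually_analyticAt] with k hk hsq hfk
  have hchain : HasDerivAt (fun k => e - L.weierstrassP (f k)) _ k :=
    (HasDerivAt.comp k (hasDerivAt_weierstrassP L hk) hfk.differentiableAt.hasDerivAt).const_sub _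
  have hpow : HasDerivAt (fun k : ℂ => k ^ 2) (2 * k) k := by
    simpa using (hasDerivAt_id k).fun_pow 2
  linear_combination -(hchain.congr_of_eventuallyEq hsq).unique hpow

end IsLocalSolution

lemma eventually_ne_zero_nhdsNE (k₀ : ℂ) : ∀ᶠ k in 𝓝[≠] k₀, k ≠ 0 := by
  rcases eq_or_ne k₀ 0 with rfl | hk₀
  · exact self_mem_nhdsWithin
  · exact mem_nhdsWithin_of_mem_nhds (isOpen_ne.mem_nhds hk₀)

namespace HalfPeriodValues

variable {L : PeriodPair} {k₁ k₂ : ℝ} {h₁ w h₃ : ℂ} (H : HalfPeriodValues L k₁ k₂ h₁ w h₃)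
include H

lemma eventually_sq_deriv_localSolution {f : ℂ → ℂ} {k₀ : ℂ}
    (hf : IsLocalSolution L (e₃ k₁ k₂) f k₀) :
    ∀ᶠ k in 𝓝 k₀, deriv f k ^ 2 * ((k ^ 2 + (k₁ : ℂ) ^ 2) * (k ^ 2 + (k₂ : ℂ) ^ 2)) = -1 := by
  have hcont : ContinuousAt (fun k =>
      deriv f k ^ 2 * ((k ^ 2 + (k₁ : ℂ) ^ 2) * (k ^ 2 + (k₂ : ℂ) ^ 2))) k₀ := by
    have := hf.analyticAt.deriv.continuousAt
    fun_prop
  -- The relation is divided by `4k²`, so `k = 0` is reached by continuity only.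
  refine (hcont.eventuallyEq_nhds_iff_eventuallyEq_nhdsNE (g := fun _ => -1)
    continuousAt_const).mp ?_
  filter_upwards [eventually_ne_zero_nhdsNE k₀, mem_nhdsWithin_of_mem_nhds hf.eventually_notMem,
    mem_nhdsWithin_of_mem_nhds hf.eventually_sq_eq,
    mem_nhdsWithin_of_mem_nhds hf.eventually_derivWeierstrassP_mul_deriv] with k hk0 hk hsq hderiv
  have hfour : 4 * k ^ 2 ≠ 0 := mul_ne_zero (by norm_num) (pow_ne_zero 2 hk0)
  apply mul_left_cancel₀ hfour
  linear_combination deriv f k ^ 2 * H.derivWeierstrassP_sq hk hsq -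
    (L.derivWeierstrassP (f k) * deriv f k - 2 * k) * hderiv

-- At `k₀ = 0` the solution is `h₃` itself; elsewhere `℘'`, hence `deriv s`, does not vanish.
lemma exists_sq_eq_and_deriv_ne_zero {s : ℂ → ℂ} (hs : ∀ z, z ∉ L.lattice → AnalyticAt ℂ s z)
    (hsq : ∀ z, z ∉ L.lattice → L.weierstrassP z - e₃ k₁ k₂ = s z ^ 2) (hsh₃ : deriv s h₃ ≠ 0)
    {k₀ : ℂ} (hk₁ : k₀ ^ 2 + (k₁ : ℂ) ^ 2 ≠ 0) (hk₂ : k₀ ^ 2 + (k₂ : ℂ) ^ 2 ≠ 0) :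
    ∃ z₀, z₀ ∉ L.lattice ∧ k₀ ^ 2 = e₃ k₁ k₂ - L.weierstrassP z₀ ∧ deriv s z₀ ≠ 0 := by
  rcases eq_or_ne k₀ 0 with rfl | hk₀
  · exact ⟨h₃, H.isHalfPeriod_h₃.notMem, by simp [H.weierstrassP_h₃], hsh₃⟩
  obtain ⟨z₀, hz₀, hP⟩ := exists_weierstrassP_eq L (e₃ k₁ k₂ - k₀ ^ 2)
  have hk : k₀ ^ 2 = e₃ k₁ k₂ - L.weierstrassP z₀ := by rw [hP, sub_sub_cancel]
  refine ⟨z₀, hz₀, hk, fun hderiv => ?_⟩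
  have hcubic := H.derivWeierstrassP_sq hz₀ hk
  rw [← two_mul_mul_deriv_eq_derivWeierstrassP hs hsq hz₀, hderiv] at hcubic
  apply mul_ne_zero (pow_ne_zero 2 hk₀) (mul_ne_zero hk₁ hk₂)
  linear_combination hcubic / 4

-- With `s² = ℘ - e₃`, the relation reads `k = ±i s(z)`, which the inverse function theorem solves.
lemma exists_isLocalSolution {k₀ : ℂ} (hk₁ : k₀ ^ 2 + (k₁ : ℂ) ^ 2 ≠ 0)
    (hk₂ : k₀ ^ 2 + (k₂ : ℂ) ^ 2 ≠ 0) :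
    ∃ f : ℂ → ℂ, IsLocalSolution L (e₃ k₁ k₂) f k₀ := by
  obtain ⟨s, hs, hsq, hsh₃⟩ := exists_analyticAt_sq_eq_weierstrassP_sub L H.isHalfPeriod_h₃
  rw [H.weierstrassP_h₃] at hsq
  obtain ⟨z₀, hz₀, hk₀, hs₀⟩ := H.exists_sq_eq_and_deriv_ne_zero hs hsq hsh₃ hk₁ hk₂
  obtain ⟨κ, hκ, rfl⟩ : ∃ κ : ℂ, κ ^ 2 = -1 ∧ κ * s z₀ = k₀ := by
    have hsquares : (Complex.I * s z₀) ^ 2 = k₀ ^ 2 := by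
      rw [hk₀, mul_pow, Complex.I_sq]
      linear_combination hsq z₀ hz₀
    rcases sq_eq_sq_iff_eq_or_eq_neg.mp hsquares with h | h
    · exact ⟨Complex.I, Complex.I_sq, h⟩
    · exact ⟨-Complex.I, by simp, by linear_combination -h⟩
  have hκ0 : κ ≠ 0 := by
    rintro rfl
    simp at hκ
  obtain ⟨f, hf, hfk₀, hinv⟩ := exists_analyticAt_rightInverse (F := fun z => κ * s z)
    (analyticAt_const.mul (hs z₀ hz₀)) (by
      rw [deriv_const_mul _ (hs z₀ hz₀).differentiableAt]
      exact mul_ne_zero hκ0 hs₀)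
  have hmem : ∀ᶠ k in 𝓝 (κ * s z₀), f k ∉ L.lattice :=
    hf.continuousAt.eventually (by rw [hfk₀]; exact eventually_notMem_lattice L hz₀)
  refine ⟨f, hf, hmem, ?_⟩
  filter_upwards [hmem, hinv] with k hk hkinv
  linear_combination (-(κ * s (f k) + k)) * hkinv + s (f k) ^ 2 * hκ + hsq (f k) hk

end HalfPeriodValues

/-! ### The cut plane and the branches of the spectral relation -/

section CutPlane

/-- The quotient whose fourth root appears in `χ`. -/
def branchRatio (k₁ k₂ : ℝ) (k : ℂ) : ℂ :=
  (k ^ 2 + (k₁ : ℂ) ^ 2) / (k ^ 2 + (k₂ : ℂ) ^ 2)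

/-- The square root of `(k² + k₁²)(k² + k₂²)` on the cut plane that behaves like `k²` at `∞`. -/
def spectralRoot (k₁ k₂ : ℝ) (k : ℂ) : ℂ :=
  (k ^ 2 + (k₂ : ℂ) ^ 2) * branchRatio k₁ k₂ k ^ (1 / 2 : ℂ)

variable {k₁ k₂ : ℝ}

lemma isOpen_cutPlane : IsOpen (cutPlane k₁ k₂) := by
  have hcompl : cutPlane k₁ k₂ = ({k : ℂ | k.re = 0} ∩ ({k : ℂ | k₁ ≤ |k.im|} ∩
      {k : ℂ | |k.im| ≤ k₂}))ᶜ := rfl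
  rw [hcompl, isOpen_compl_iff]
  exact (isClosed_eq Complex.continuous_re continuous_const).inter
    ((isClosed_le continuous_const Complex.continuous_im.abs).inter
      (isClosed_le Complex.continuous_im.abs continuous_const))

lemma mem_cutPlane_of_re_ne_zero {k : ℂ} (hk : k.re ≠ 0) : k ∈ cutPlane k₁ k₂ :=
  fun h => hk h.1

lemma re_eq_zero_and_im_sq_of_sq_eq_neg {k : ℂ} {q : ℝ} (hq : 0 < q) (h : k ^ 2 = -(q : ℂ)) :
    k.re = 0 ∧ k.im ^ 2 = q := by
  have hre := congrArg Complex.re h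
  have him := congrArg Complex.im h
  simp only [sq, Complex.mul_re, Complex.mul_im, Complex.neg_re, Complex.neg_im,
    Complex.ofReal_re, Complex.ofReal_im, neg_zero] at hre him
  have hmul : k.re * k.im = 0 := by linarith
  have hre0 : k.re = 0 := by
    refine (mul_eq_zero.mp hmul).resolve_right fun him0 => ?_
    rw [him0] at hre
    nlinarith [mul_self_nonneg k.re]
  rw [hre0] at hre
  exact ⟨hre0, by linarith⟩

lemma sq_ne_of_mem_cutPlane (hk₁ : 0 < k₁) (hk₂ : k₁ < k₂) {k : ℂ} (hk : k ∈ cutPlane k₁ k₂)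
    {q : ℝ} (hq₁ : k₁ ^ 2 ≤ q) (hq₂ : q ≤ k₂ ^ 2) : k ^ 2 ≠ -(q : ℂ) := by
  intro h
  obtain ⟨hre, him⟩ := re_eq_zero_and_im_sq_of_sq_eq_neg (lt_of_lt_of_le (by positivity) hq₁) h
  have hlower : k₁ ^ 2 ≤ |k.im| ^ 2 := by rwa [sq_abs, him]
  exact hk ⟨hre, (pow_le_pow_iff_left₀ hk₁.le (abs_nonneg _) two_ne_zero).mp hlower,
    abs_le_of_sq_le_sq (him.trans_le hq₂) (hk₁.trans hk₂).le⟩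

lemma sq_add_sq_ne_zero₁ (hk₁ : 0 < k₁) (hk₂ : k₁ < k₂) {k : ℂ} (hk : k ∈ cutPlane k₁ k₂) :
    k ^ 2 + (k₁ : ℂ) ^ 2 ≠ 0 := by
  have := sq_ne_of_mem_cutPlane hk₁ hk₂ hk le_rfl (by gcongr)
  rwa [ne_eq, eq_neg_iff_add_eq_zero, Complex.ofReal_pow] at this

lemma sq_add_sq_ne_zero₂ (hk₁ : 0 < k₁) (hk₂ : k₁ < k₂) {k : ℂ} (hk : k ∈ cutPlane k₁ k₂) :
    k ^ 2 + (k₂ : ℂ) ^ 2 ≠ 0 := by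
  have := sq_ne_of_mem_cutPlane hk₁ hk₂ hk (by gcongr) le_rfl
  rwa [ne_eq, eq_neg_iff_add_eq_zero, Complex.ofReal_pow] at this

-- If `(k² + k₁²)/(k² + k₂²) = -t ≤ 0`, then `-k²` is a convex combination of `k₁²` and `k₂²`.
lemma branchRatio_mem_slitPlane (hk₁ : 0 < k₁) (hk₂ : k₁ < k₂) {k : ℂ}
    (hk : k ∈ cutPlane k₁ k₂) : branchRatio k₁ k₂ k ∈ Complex.slitPlane := by
  by_contra hslit
  rw [Complex.mem_slitPlane_iff, not_or, not_lt, not_not] at hslit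
  obtain ⟨t, ht0, ht⟩ : ∃ t : ℝ, 0 ≤ t ∧ branchRatio k₁ k₂ k = -(t : ℂ) :=
    ⟨-(branchRatio k₁ k₂ k).re, neg_nonneg.mpr hslit.1, by
      apply Complex.ext <;> simp [hslit.2]⟩
  rw [branchRatio, div_eq_iff (sq_add_sq_ne_zero₂ hk₁ hk₂ hk)] at ht
  have hlt : k₁ ^ 2 ≤ k₂ ^ 2 := by gcongr
  have ht1 : (1 + t : ℂ) ≠ 0 := by exact_mod_cast (by positivity : (1 + t : ℝ) ≠ 0)
  refine sq_ne_of_mem_cutPlane hk₁ hk₂ hk (q := (k₁ ^ 2 + t * k₂ ^ 2) / (1 + t)) ?_ ?_ ?_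
  · rw [le_div_iff₀ (by positivity)]
    linarith [mul_le_mul_of_nonneg_left hlt ht0]
  · rw [div_le_iff₀ (by positivity)]
    linarith
  · push_cast
    field_simp
    linear_combination ht

lemma analyticAt_branchRatio {k : ℂ} (h : k ^ 2 + (k₂ : ℂ) ^ 2 ≠ 0) :
    AnalyticAt ℂ (branchRatio k₁ k₂) k := by
  unfold branchRatio
  fun_prop (disch := assumption)

lemma spectralRoot_sq {k : ℂ} (h : k ^ 2 + (k₂ : ℂ) ^ 2 ≠ 0) :
    spectralRoot k₁ k₂ k ^ 2 = (k ^ 2 + (k₁ : ℂ) ^ 2) * (k ^ 2 + (k₂ : ℂ) ^ 2) := by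
  have hsqrt : (branchRatio k₁ k₂ k ^ (1 / 2 : ℂ)) ^ 2 = branchRatio k₁ k₂ k := by
    simp
  rw [spectralRoot, mul_pow, hsqrt, branchRatio]
  field_simp

lemma spectralRoot_ne_zero (hk₁ : 0 < k₁) (hk₂ : k₁ < k₂) {k : ℂ} (hk : k ∈ cutPlane k₁ k₂) :
    spectralRoot k₁ k₂ k ≠ 0 := by
  have hk' := sq_add_sq_ne_zero₂ hk₁ hk₂ hk
  rw [← sq_eq_zero_iff.ne, spectralRoot_sq hk']
  exact mul_ne_zero (sq_add_sq_ne_zero₁ hk₁ hk₂ hk) hk'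

lemma analyticAt_spectralRoot (hk₁ : 0 < k₁) (hk₂ : k₁ < k₂) {k : ℂ}
    (hk : k ∈ cutPlane k₁ k₂) : AnalyticAt ℂ (spectralRoot k₁ k₂) k :=
  (by fun_prop : AnalyticAt ℂ (fun k : ℂ => k ^ 2 + (k₂ : ℂ) ^ 2) k).mul
    ((analyticAt_branchRatio (sq_add_sq_ne_zero₂ hk₁ hk₂ hk)).cpow analyticAt_const
      (branchRatio_mem_slitPlane hk₁ hk₂ hk))

lemma spectralRoot_neg (k : ℂ) : spectralRoot k₁ k₂ (-k) = spectralRoot k₁ k₂ k := by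
  rw [spectralRoot, spectralRoot, branchRatio, branchRatio, neg_sq]

lemma tendsto_inv_sq_cobounded :
    Tendsto (fun k : ℂ => (k ^ 2)⁻¹) (Bornology.cobounded ℂ) (𝓝 0) := by
  simpa using (tendsto_inv₀_cobounded (α := ℂ)).pow 2

lemma tendsto_sq_add_div_sq (a : ℂ) :
    Tendsto (fun k : ℂ => (k ^ 2 + a) / k ^ 2) (Bornology.cobounded ℂ) (𝓝 1) := by
  have hlim := (tendsto_inv_sq_cobounded.const_mul a).const_add 1
  rw [mul_zero, add_zero] at hlim
  refine hlim.congr' ?_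
  filter_upwards [Bornology.eventually_ne_cobounded (0 : ℂ)] with k hk
  field_simp

lemma tendsto_branchRatio_cobounded :
    Tendsto (branchRatio k₁ k₂) (Bornology.cobounded ℂ) (𝓝 1) := by
  have hlim := (tendsto_sq_add_div_sq ((k₁ : ℂ) ^ 2)).div
    (tendsto_sq_add_div_sq ((k₂ : ℂ) ^ 2)) one_ne_zero
  rw [div_one] at hlim
  refine hlim.congr' ?_
  filter_upwards [Bornology.eventually_ne_cobounded (0 : ℂ)] with k hk
  exact div_div_div_cancel_right₀ (pow_ne_zero 2 hk) _ _

lemma tendsto_spectralRoot_div_sq :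
    Tendsto (fun k => spectralRoot k₁ k₂ k / k ^ 2) (Bornology.cobounded ℂ) (𝓝 1) := by
  have hsqrt : ContinuousAt (fun r : ℂ => r ^ (1 / 2 : ℂ)) 1 := continuousAt_cpow_const (by simp)
  have hlim := (tendsto_sq_add_div_sq ((k₂ : ℂ) ^ 2)).mul
    (hsqrt.tendsto.comp (tendsto_branchRatio_cobounded (k₁ := k₁) (k₂ := k₂)))
  rw [Complex.one_cpow, mul_one] at hlim
  exact hlim.congr fun k => div_mul_eq_mul_div _ _ _

end CutPlane

section Pole

variable (L : PeriodPair)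

lemma tendsto_sq_mul_weierstrassP :
    Tendsto (fun u => u ^ 2 * L.weierstrassP u) (𝓝[≠] 0) (𝓝 1) := by
  have hcont : ContinuousAt (fun u => 1 + u ^ 2 * L.weierstrassPExcept 0 u) 0 := by
    have := (L.analyticAt_weierstrassPExcept 0).continuousAt
    fun_prop
  have hlim := hcont.tendsto.mono_left (nhdsWithin_le_nhds (s := {0}ᶜ))
  rw [zero_pow two_ne_zero, zero_mul, add_zero] at hlim
  refine hlim.congr' ?_
  filter_upwards [self_mem_nhdsWithin] with u hu
  exact (sq_mul_weierstrassP L hu).symm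

lemma tendsto_cube_mul_derivWeierstrassP :
    Tendsto (fun u => u ^ 3 * L.derivWeierstrassP u) (𝓝[≠] 0) (𝓝 (-2)) := by
  have hcont : ContinuousAt (fun u => u ^ 3 * L.derivWeierstrassPExcept 0 u - 2) 0 := by
    have := (L.analyticAt_derivWeierstrassPExcept 0).continuousAt
    fun_prop
  have hlim := hcont.tendsto.mono_left (nhdsWithin_le_nhds (s := {0}ᶜ))
  rw [zero_pow three_ne_zero, zero_mul, zero_sub] at hlim
  refine hlim.congr' ?_
  filter_upwards [self_mem_nhdsWithin] with u (hu : u ≠ 0)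
  have hprincipal := L.derivWeierstrassPExcept_sub 0 u
  simp only [ZeroMemClass.coe_zero, sub_zero] at hprincipal
  rw [← hprincipal]
  field_simp

lemma tendsto_zero_of_tendsto_mul_cobounded {z : ℂ → ℂ} {a : ℂ}
    (h : Tendsto (fun k => k * z k) (Bornology.cobounded ℂ) (𝓝 a)) :
    Tendsto z (Bornology.cobounded ℂ) (𝓝 0) := by
  have hlim := (tendsto_inv₀_cobounded (α := ℂ)).mul h
  rw [zero_mul] at hlim
  refine hlim.congr' ?_
  filter_upwards [Bornology.eventually_ne_cobounded (0 : ℂ)] with k hk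
  exact inv_mul_cancel_left₀ hk _

end Pole

namespace IsSpectralBranch

variable {L : PeriodPair} {k₁ k₂ : ℝ} {e : ℂ} {z : ℂ → ℂ} (hz : IsSpectralBranch L k₁ k₂ e z)
include hz

lemma analyticAt_comp {F : ℂ → ℂ} (hF : ∀ u, u ∉ L.lattice → ∀ l ∈ L.lattice, F (u + l) = F u)
    {k₀ : ℂ} (hk₀ : k₀ ∈ cutPlane k₁ k₂) (hFan : AnalyticAt ℂ F (z k₀)) :
    AnalyticAt ℂ (fun k => F (z k)) k₀ := by
  obtain ⟨f, hf, hzf⟩ := hz.analytic_mod_lattice k₀ hk₀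
  set l := z k₀ - f k₀ with hl
  have hshift : AnalyticAt ℂ (fun k => F (f k + l)) k₀ :=
    AnalyticAt.fun_comp (g := F) (by rwa [hl, add_sub_cancel]) (hf.add analyticAt_const)
  refine hshift.congr ?_
  filter_upwards [hzf, isOpen_cutPlane.mem_nhds hk₀] with k hk hkD
  rw [← hF (z k) (hz.notMem_lattice k hkD) (l - (z k - f k)) (sub_mem hzf.self_of_nhds hk)]
  congr 1
  ring

lemma continuousAt_derivWeierstrassP {k : ℂ} (hk : k ∈ cutPlane k₁ k₂) :
    ContinuousAt (fun k => L.derivWeierstrassP (z k)) k :=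
  (hz.analyticAt_comp (fun u _ _ hl => derivWeierstrassP_add_mem L hl u) hk
    (L.analyticOnNhd_derivWeierstrassP _ (hz.notMem_lattice k hk))).continuousAt

lemma tendsto_derivWeierstrassP_div_cube :
    Tendsto (fun k => L.derivWeierstrassP (z k) / k ^ 3) (Bornology.cobounded ℂ)
      (𝓝 (2 * Complex.I)) := by
  have hne : ∀ᶠ k in Bornology.cobounded ℂ, k * z k ≠ 0 :=
    hz.at_infinity.eventually_ne (by simp)
  have hzero : Tendsto z (Bornology.cobounded ℂ) (𝓝[≠] 0) := by
    refine tendsto_nhdsWithin_iff.mpr ⟨tendsto_zero_of_tendsto_mul_cobounded hz.at_infinity, ?_⟩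
    filter_upwards [hne] with k hk
    exact right_ne_zero_of_mul hk
  have hlim := ((tendsto_cube_mul_derivWeierstrassP L).comp hzero).div (hz.at_infinity.pow 3)
    (by simp)
  have hvalue : (-2 : ℂ) / (-Complex.I) ^ 3 = 2 * Complex.I := by
    rw [div_eq_iff (by simp)]
    linear_combination (-2 + 2 * Complex.I ^ 2) * Complex.I_sq
  rw [hvalue] at hlim
  refine hlim.congr' ?_
  filter_upwards [hne] with k hk
  have hk0 := left_ne_zero_of_mul hk
  have hz0 := right_ne_zero_of_mul hk
  simp only [Pi.div_apply, Function.comp_apply]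
  field_simp

end IsSpectralBranch

namespace HalfPeriodValues

variable {L : PeriodPair} {k₁ k₂ : ℝ} {h₁ w h₃ : ℂ} (H : HalfPeriodValues L k₁ k₂ h₁ w h₃)
include H

lemma derivWeierstrassP_sq_eq_spectralRoot {z k : ℂ} (hk : k ∈ cutPlane k₁ k₂)
    (hz : z ∉ L.lattice) (h : k ^ 2 = e₃ k₁ k₂ - L.weierstrassP z) :
    L.derivWeierstrassP z ^ 2 = (2 * Complex.I * k * spectralRoot k₁ k₂ k) ^ 2 := by
  rw [H.derivWeierstrassP_sq hz h, mul_pow,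
    spectralRoot_sq (sq_add_sq_ne_zero₂ H.pos H.lt hk), mul_pow, mul_pow, Complex.I_sq]
  ring

variable {z : ℂ → ℂ} (hz : IsSpectralBranch L k₁ k₂ (e₃ k₁ k₂) z)
include hz

-- The cubic relation fixes `℘'(z(k))` up to a sign, constant on `U`, which is read off at infinity.
lemma derivWeierstrassP_branch_of_frequently_mem {U : Set ℂ} (hU : IsPreconnected U)
    (hUre : ∀ k ∈ U, k.re ≠ 0) (hU_infty : ∃ᶠ k in Bornology.cobounded ℂ, k ∈ U) :
    ∀ k ∈ U, L.derivWeierstrassP (z k) = 2 * Complex.I * k * spectralRoot k₁ k₂ k := by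
  have hUcut : ∀ k ∈ U, k ∈ cutPlane k₁ k₂ := fun k hk => mem_cutPlane_of_re_ne_zero (hUre k hk)
  have hU0 : ∀ k ∈ U, k ≠ 0 := by
    rintro k hk rfl
    exact hUre 0 hk rfl
  have hroot : ContinuousOn (fun k => 2 * Complex.I * k * spectralRoot k₁ k₂ k) U := fun k hk => by
    have := (analyticAt_spectralRoot H.pos H.lt (hUcut k hk)).continuousAt
    exact ContinuousAt.continuousWithinAt (by fun_prop)
  refine (hU.eq_or_eq_neg_of_sq_eq
    (fun k hk => (hz.continuousAt_derivWeierstrassP (hUcut k hk)).continuousWithinAt) hroot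
    (fun k hk => H.derivWeierstrassP_sq_eq_spectralRoot (hUcut k hk)
      (hz.notMem_lattice k (hUcut k hk)) (hz.sq_eq k (hUcut k hk)))
    (fun {k} hk => mul_ne_zero (mul_ne_zero (by simp) (hU0 k hk))
      (spectralRoot_ne_zero H.pos H.lt (hUcut k hk)))).resolve_right fun hneg => ?_
  have hratio : ∀ k ∈ U, L.derivWeierstrassP (z k) / k ^ 3 =
      -(2 * Complex.I) * (spectralRoot k₁ k₂ k / k ^ 2) := fun k hk => by
    have hk0 := hU0 k hk
    have hk' : L.derivWeierstrassP (z k) = -(2 * Complex.I * k * spectralRoot k₁ k₂ k) := hneg hk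
    rw [hk']
    field_simp
  have hsign := tendsto_nhds_unique_of_frequently_eq hz.tendsto_derivWeierstrassP_div_cube
    (tendsto_spectralRoot_div_sq.const_mul (-(2 * Complex.I))) (hU_infty.mono hratio)
  rw [mul_one, self_eq_neg] at hsign
  exact mul_ne_zero two_ne_zero Complex.I_ne_zero hsign

lemma derivWeierstrassP_branch_of_re_ne_zero {k : ℂ} (hk : k.re ≠ 0) :
    L.derivWeierstrassP (z k) = 2 * Complex.I * k * spectralRoot k₁ k₂ k := by
  rcases hk.lt_or_gt with hneg | hpos
  · refine H.derivWeierstrassP_branch_of_frequently_mem hz (U := {k | k.re < 0})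
      (convex_halfSpace_re_lt 0).isPreconnected (fun k hk => ne_of_lt hk) ?_ k hneg
    exact (RCLike.tendsto_ofReal_atBot_cobounded ℂ).frequently
      (eventually_lt_atBot 0).frequently
  · refine H.derivWeierstrassP_branch_of_frequently_mem hz (U := {k | 0 < k.re})
      (convex_halfSpace_re_gt 0).isPreconnected (fun k hk => ne_of_gt hk) ?_ k hpos
    exact (RCLike.tendsto_ofReal_atTop_cobounded ℂ).frequently
      (eventually_gt_atTop 0).frequently

lemma derivWeierstrassP_branch {k : ℂ} (hk : k ∈ cutPlane k₁ k₂) :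
    L.derivWeierstrassP (z k) = 2 * Complex.I * k * spectralRoot k₁ k₂ k := by
  rcases ne_or_eq k.re 0 with hre | hre
  · exact H.derivWeierstrassP_branch_of_re_ne_zero hz hre
  have hroot : ContinuousAt (fun k => 2 * Complex.I * k * spectralRoot k₁ k₂ k) k := by
    have := (analyticAt_spectralRoot H.pos H.lt hk).continuousAt
    fun_prop
  have hclosure : k ∈ closure {k : ℂ | 0 < k.re} := by
    rw [Complex.closure_setOfPred_lt_re]
    exact hre.ge
  have := mem_closure_iff_nhdsWithin_neBot.mp hclosure
  refine tendsto_nhds_unique_of_eventuallyEq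
    ((hz.continuousAt_derivWeierstrassP hk).tendsto.mono_left nhdsWithin_le_nhds)
    (hroot.tendsto.mono_left nhdsWithin_le_nhds) (l := 𝓝[{k : ℂ | 0 < k.re}] k) ?_
  filter_upwards [self_mem_nhdsWithin] with u (hu : 0 < u.re)
  exact H.derivWeierstrassP_branch_of_re_ne_zero hz hu.ne'

lemma branch_sub_mem {k u : ℂ} (hk : k ∈ cutPlane k₁ k₂) (hu : u ∉ L.lattice)
    (h : k ^ 2 = e₃ k₁ k₂ - L.weierstrassP u)
    (h' : L.derivWeierstrassP u = 2 * Complex.I * k * spectralRoot k₁ k₂ k) :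
    z k - u ∈ L.lattice :=
  H.sub_mem_of_weierstrassP_eq_of_derivWeierstrassP_eq (hz.notMem_lattice k hk) hu
    (by linear_combination hz.sq_eq k hk - h) (by rw [H.derivWeierstrassP_branch hz hk, h'])

end HalfPeriodValues

lemma eventually_mem_cutPlane_cobounded {k₁ k₂ : ℝ} :
    ∀ᶠ k in Bornology.cobounded ℂ, k ∈ cutPlane k₁ k₂ := by
  filter_upwards [tendsto_norm_cobounded_atTop.eventually_gt_atTop k₂] with k hk
  rintro ⟨hre, -, him⟩
  have hnorm := Complex.norm_le_abs_re_add_abs_im k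
  rw [hre, abs_zero] at hnorm
  linarith

-- `1/℘` extends holomorphically to `0`, and a nonconstant holomorphic function is open.
lemma eventually_exists_weierstrassP_eq_norm_lt (L : PeriodPair) {ε : ℝ} (hε : 0 < ε) :
    ∀ᶠ c in Bornology.cobounded ℂ, ∃ u, u ∉ L.lattice ∧ L.weierstrassP u = c ∧ ‖u‖ < ε := by
  let B : ℂ → ℂ := fun u => u ^ 2 / (1 + u ^ 2 * L.weierstrassPExcept 0 u)
  have hB0 : B 0 = 0 := by simp [B]
  have hBinv : ∀ u, u ≠ 0 → B u = (L.weierstrassP u)⁻¹ := fun u hu => by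
    simp only [B]
    rw [← sq_mul_weierstrassP L hu, div_mul_cancel_left₀ (pow_ne_zero 2 hu)]
  have hB : AnalyticAt ℂ B 0 := by
    have := L.analyticAt_weierstrassPExcept 0
    exact (analyticAt_id.pow 2).div (by fun_prop) (by simp)
  have hopen : 𝓝 0 ≤ map B (𝓝 0) := by
    refine (hB.eventually_constant_or_nhds_le_map_nhds.resolve_left fun hconst => ?_).trans_eq'
      (by rw [hB0])
    have hfalse : ∀ᶠ _ in 𝓝[≠] (0 : ℂ), False := by
      filter_upwards [mem_nhdsWithin_of_mem_nhds hconst, self_mem_nhdsWithin,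
        (tendsto_sq_mul_weierstrassP L).eventually_ne one_ne_zero] with u hu (hu0 : u ≠ 0) hne
      rw [hB0, hBinv u hu0, inv_eq_zero] at hu
      exact right_ne_zero_of_mul hne hu
    simpa using hfalse.exists
  have hnear : ∀ᶠ u in 𝓝 (0 : ℂ), (u ≠ 0 → u ∉ L.lattice) ∧ ‖u‖ < ε :=
    (eventually_nhdsWithin_iff.mp (eventually_notMem_lattice_zero L)).and
      ((continuous_norm.tendsto' 0 0 norm_zero).eventually_lt_const hε)
  filter_upwards [tendsto_inv₀_cobounded.eventually (hopen (image_mem_map hnear)),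
    Bornology.eventually_ne_cobounded (0 : ℂ)] with c ⟨u, ⟨hu, huε⟩, hBu⟩ hc
  have hu0 : u ≠ 0 := by
    rintro rfl
    exact inv_ne_zero hc (hBu.symm.trans hB0)
  exact ⟨u, hu hu0, inv_injective ((hBinv u hu0).symm.trans hBu), huε⟩

/-- The solutions `u` of `k² = e₃ - ℘(u)` for which `℘'(u)` has the sign of the branches
`z(k)`. -/
def spectralFiber (L : PeriodPair) (k₁ k₂ : ℝ) (k : ℂ) : Set ℂ :=
  {u | u ∉ L.lattice ∧ k ^ 2 = e₃ k₁ k₂ - L.weierstrassP u ∧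
    L.derivWeierstrassP u = 2 * Complex.I * k * spectralRoot k₁ k₂ k}

namespace HalfPeriodValues

variable {L : PeriodPair} {k₁ k₂ : ℝ} {h₁ w h₃ : ℂ} (H : HalfPeriodValues L k₁ k₂ h₁ w h₃)
include H

lemma mem_or_neg_mem_spectralFiber {k u : ℂ} (hk : k ∈ cutPlane k₁ k₂) (hu : u ∉ L.lattice)
    (h : k ^ 2 = e₃ k₁ k₂ - L.weierstrassP u) :
    u ∈ spectralFiber L k₁ k₂ k ∨ -u ∈ spectralFiber L k₁ k₂ k := by
  rcases sq_eq_sq_iff_eq_or_eq_neg.mp (H.derivWeierstrassP_sq_eq_spectralRoot hk hu h) with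
    hpos | hneg
  · exact .inl ⟨hu, h, hpos⟩
  · exact .inr ⟨by simpa using hu, by simpa using h, by rw [L.derivWeierstrassP_neg, hneg, neg_neg]⟩

lemma sub_mem_of_mem_spectralFiber {k u v : ℂ} (hu : u ∈ spectralFiber L k₁ k₂ k)
    (hv : v ∈ spectralFiber L k₁ k₂ k) : u - v ∈ L.lattice :=
  H.sub_mem_of_weierstrassP_eq_of_derivWeierstrassP_eq hu.1 hv.1
    (by linear_combination hu.2.1 - hv.2.1) (by rw [hu.2.2, hv.2.2])

lemma spectralFiber_nonempty {k : ℂ} (hk : k ∈ cutPlane k₁ k₂) :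
    (spectralFiber L k₁ k₂ k).Nonempty := by
  obtain ⟨u, hu, hP⟩ := exists_weierstrassP_eq L (e₃ k₁ k₂ - k ^ 2)
  exact (H.mem_or_neg_mem_spectralFiber hk hu (by rw [hP, sub_sub_cancel])).elim
    (fun h => ⟨_, h⟩) (fun h => ⟨_, h⟩)

-- The point `k₀` may lie on the cut: only the limit of the root along `l` matters.
lemma eventually_mem_spectralFiber {f : ℂ → ℂ} {k₀ S₀ : ℂ}
    (hf : IsLocalSolution L (e₃ k₁ k₂) f k₀) {l : Filter ℂ} (hl : l ≤ 𝓝 k₀)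
    (hlcut : ∀ᶠ k in l, k ∈ cutPlane k₁ k₂) (hS : Tendsto (spectralRoot k₁ k₂) l (𝓝 S₀))
    (h : deriv f k₀ * S₀ = Complex.I) : ∀ᶠ k in l, f k ∈ spectralFiber L k₁ k₂ k := by
  have hlim : Tendsto (fun k => deriv f k * spectralRoot k₁ k₂ k) l (𝓝 Complex.I) := by
    rw [← h]
    exact (hf.analyticAt.deriv.continuousAt.tendsto.mono_left hl).mul hS
  filter_upwards [hl hf.eventually_notMem, hl hf.eventually_sq_eq,
    hl (H.eventually_sq_deriv_localSolution hf), hl hf.eventually_derivWeierstrassP_mul_deriv,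
    hlcut, hlim.eventually_ne (self_ne_neg.mpr Complex.I_ne_zero)]
    with k hmem hsq hderivSq hderiv hcut hne
  have hI : (deriv f k * spectralRoot k₁ k₂ k) ^ 2 = Complex.I ^ 2 := by
    rw [mul_pow, spectralRoot_sq (sq_add_sq_ne_zero₂ H.pos H.lt hcut), hderivSq, Complex.I_sq]
  have hI' := (sq_eq_sq_iff_eq_or_eq_neg.mp hI).resolve_right hne
  refine ⟨hmem, hsq, ?_⟩
  linear_combination (-Complex.I * spectralRoot k₁ k₂ k) * hderiv +
    Complex.I * L.derivWeierstrassP (f k) * hI' + L.derivWeierstrassP (f k) * Complex.I_sq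

lemma exists_isLocalSolution_deriv_mul_eq_I {k₀ S₀ : ℂ} (hk₁ : k₀ ^ 2 + (k₁ : ℂ) ^ 2 ≠ 0)
    (hk₂ : k₀ ^ 2 + (k₂ : ℂ) ^ 2 ≠ 0)
    (hS₀ : S₀ ^ 2 = (k₀ ^ 2 + (k₁ : ℂ) ^ 2) * (k₀ ^ 2 + (k₂ : ℂ) ^ 2)) :
    ∃ f, IsLocalSolution L (e₃ k₁ k₂) f k₀ ∧ deriv f k₀ * S₀ = Complex.I := by
  obtain ⟨f, hf⟩ := H.exists_isLocalSolution hk₁ hk₂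
  have hsq : (deriv f k₀ * S₀) ^ 2 = Complex.I ^ 2 := by
    rw [mul_pow, hS₀, (H.eventually_sq_deriv_localSolution hf).self_of_nhds, Complex.I_sq]
  rcases sq_eq_sq_iff_eq_or_eq_neg.mp hsq with hpos | hneg
  · exact ⟨f, hf, hpos⟩
  · exact ⟨-f, hf.neg, by rw [deriv.neg, neg_mul, hneg, neg_neg]⟩

lemma exists_analyticAt_mem_spectralFiber {k₀ : ℂ} (hk₀ : k₀ ∈ cutPlane k₁ k₂) :
    ∃ f, AnalyticAt ℂ f k₀ ∧ ∀ᶠ k in 𝓝 k₀, f k ∈ spectralFiber L k₁ k₂ k := by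
  have hk₀' := sq_add_sq_ne_zero₂ H.pos H.lt hk₀
  obtain ⟨f, hf, hI⟩ := H.exists_isLocalSolution_deriv_mul_eq_I
    (sq_add_sq_ne_zero₁ H.pos H.lt hk₀) hk₀' (spectralRoot_sq hk₀')
  exact ⟨f, hf.analyticAt, H.eventually_mem_spectralFiber hf le_rfl
    (isOpen_cutPlane.mem_nhds hk₀) (analyticAt_spectralRoot H.pos H.lt hk₀).continuousAt hI⟩

lemma eventually_exists_mem_spectralFiber_norm_lt {ε : ℝ} (hε : 0 < ε) :
    ∀ᶠ k in Bornology.cobounded ℂ, ∃ u ∈ spectralFiber L k₁ k₂ k, ‖u‖ < ε := by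
  have hlim : Tendsto (fun k : ℂ => (e₃ k₁ k₂ : ℂ) - k ^ 2) (Bornology.cobounded ℂ)
      (Bornology.cobounded ℂ) := by
    refine (tendsto_const_sub_cobounded _).comp (tendsto_norm_atTop_iff_cobounded.mp ?_)
    simp only [norm_pow]
    exact (tendsto_pow_atTop two_ne_zero).comp tendsto_norm_cobounded_atTop
  filter_upwards [hlim.eventually (eventually_exists_weierstrassP_eq_norm_lt L hε),
    eventually_mem_cutPlane_cobounded] with k ⟨u, hu, hP, huε⟩ hk
  rcases H.mem_or_neg_mem_spectralFiber hk hu (by rw [hP, sub_sub_cancel]) with hmem | hmem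
  · exact ⟨u, hmem, huε⟩
  · exact ⟨-u, hmem, by rwa [norm_neg]⟩

-- The fibers have points of small norm near infinity: take points of almost minimal norm.
lemma exists_tendsto_zero_mem_spectralFiber :
    ∃ z : ℂ → ℂ, (∀ k ∈ cutPlane k₁ k₂, z k ∈ spectralFiber L k₁ k₂ k) ∧
      Tendsto z (Bornology.cobounded ℂ) (𝓝 0) := by
  have hmin : ∀ k : ℂ, ∃ u, k ∈ cutPlane k₁ k₂ → u ∈ spectralFiber L k₁ k₂ k ∧
      ∀ v ∈ spectralFiber L k₁ k₂ k, ‖u‖ < ‖v‖ + (1 + ‖k‖)⁻¹ := fun k => by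
    by_cases hk : k ∈ cutPlane k₁ k₂
    swap
    · exact ⟨0, fun h => absurd h hk⟩
    have hbdd : BddBelow (norm '' spectralFiber L k₁ k₂ k) :=
      ⟨0, Set.forall_mem_image.mpr fun u _ => norm_nonneg u⟩
    obtain ⟨_, ⟨u, hu, rfl⟩, hlt⟩ := Real.lt_sInf_add_pos
      ((H.spectralFiber_nonempty hk).image norm) (show 0 < (1 + ‖k‖)⁻¹ by positivity)
    exact ⟨u, fun _ => ⟨hu, fun v hv =>
      hlt.trans_le (add_le_add_left (csInf_le hbdd ⟨v, hv, rfl⟩) _)⟩⟩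
  choose z hz using hmin
  refine ⟨z, fun k hk => (hz k hk).1, Metric.tendsto_nhds.mpr fun ε hε => ?_⟩
  have herror : Tendsto (fun k : ℂ => (1 + ‖k‖)⁻¹) (Bornology.cobounded ℂ) (𝓝 0) :=
    (tendsto_atTop_add_const_left _ 1 tendsto_norm_cobounded_atTop).inv_tendsto_atTop
  filter_upwards [H.eventually_exists_mem_spectralFiber_norm_lt (half_pos hε),
    eventually_mem_cutPlane_cobounded, herror.eventually_lt_const (half_pos hε)]
    with k ⟨u, hu, huε⟩ hk hkε
  have := (hz k hk).2 u hu
  rw [dist_zero_right]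
  linarith

-- `(k z)² → -1` by the relation and `(k z)³ → i` by the choice of the sign of `℘'(z)`.
lemma tendsto_mul_of_mem_spectralFiber {z : ℂ → ℂ}
    (hz : ∀ k ∈ cutPlane k₁ k₂, z k ∈ spectralFiber L k₁ k₂ k)
    (hz0 : Tendsto z (Bornology.cobounded ℂ) (𝓝 0)) :
    Tendsto (fun k => k * z k) (Bornology.cobounded ℂ) (𝓝 (-Complex.I)) := by
  have hz1 : Tendsto z (Bornology.cobounded ℂ) (𝓝[≠] 0) := by
    refine tendsto_nhdsWithin_iff.mpr ⟨hz0, ?_⟩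
    filter_upwards [eventually_mem_cutPlane_cobounded] with k hk
    exact ne_of_mem_of_not_mem L.lattice.zero_mem (hz k hk).1 |>.symm
  have hsq : Tendsto (fun k => (k * z k) ^ 2) (Bornology.cobounded ℂ) (𝓝 (-1)) := by
    have hlim := ((hz0.pow 2).const_mul (e₃ k₁ k₂ : ℂ)).sub
      ((tendsto_sq_mul_weierstrassP L).comp hz1)
    rw [zero_pow two_ne_zero, mul_zero, zero_sub] at hlim
    refine hlim.congr' ?_
    filter_upwards [eventually_mem_cutPlane_cobounded] with k hk
    rw [Function.comp_apply, mul_pow, (hz k hk).2.1]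
    ring
  have hcube : Tendsto (fun k => (k * z k) ^ 3) (Bornology.cobounded ℂ)
      (𝓝 (-2 / (2 * Complex.I * 1))) := by
    refine (((tendsto_cube_mul_derivWeierstrassP L).comp hz1).div
      ((tendsto_spectralRoot_div_sq (k₁ := k₁) (k₂ := k₂)).const_mul (2 * Complex.I))
      (by simp)).congr' ?_
    filter_upwards [eventually_mem_cutPlane_cobounded, Bornology.eventually_ne_cobounded (0 : ℂ)]
      with k hk hk0
    have hS := spectralRoot_ne_zero H.pos H.lt hk
    rw [Pi.div_apply, Function.comp_apply, (hz k hk).2.2]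
    field_simp
  have hlim := hcube.div hsq (by simp)
  have hvalue : (-2 / (2 * Complex.I * 1) / -1 : ℂ) = -Complex.I := by
    rw [div_div, div_eq_iff (by simp)]
    linear_combination (-2 : ℂ) * Complex.I_sq
  rw [hvalue] at hlim
  refine hlim.congr' ?_
  filter_upwards [hsq.eventually_ne (b₂ := 0) (by simp)] with k hk
  rw [Pi.div_apply, pow_succ, mul_div_right_comm, div_self hk, one_mul]

theorem exists_isSpectralBranch : ∃ z, IsSpectralBranch L k₁ k₂ (e₃ k₁ k₂) z := by
  obtain ⟨z, hz, hz0⟩ := H.exists_tendsto_zero_mem_spectralFiber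
  refine ⟨z, fun k hk => (hz k hk).1, fun k hk => (hz k hk).2.1, fun k₀ hk₀ => ?_,
    H.tendsto_mul_of_mem_spectralFiber hz hz0⟩
  obtain ⟨f, hf, hmem⟩ := H.exists_analyticAt_mem_spectralFiber hk₀
  refine ⟨f, hf, ?_⟩
  filter_upwards [hmem, isOpen_cutPlane.mem_nhds hk₀] with k hk hkcut
  exact H.sub_mem_of_mem_spectralFiber (hz k hkcut) hk

end HalfPeriodValues

/-! ### Boundary values on the cuts -/

section OneSided

variable {k₁ k₂ : ℝ}

/-- One-sided approach to the point `ip`, from the right if `s = 1` and from the left if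
`s = -1`. -/
def sideFilter (s p : ℝ) : Filter ℂ := 𝓝[{k : ℂ | 0 < s * k.re}] (Complex.I * p)

lemma sideFilter_le (s p : ℝ) : sideFilter s p ≤ 𝓝 (Complex.I * p) := nhdsWithin_le_nhds

lemma sideFilter_one_neBot (p : ℝ) : (sideFilter 1 p).NeBot := by
  rw [sideFilter, ← mem_closure_iff_nhdsWithin_neBot]
  simp only [one_mul]
  rw [Complex.closure_setOfPred_lt_re]
  simp

lemma eventually_mem_cutPlane_sideFilter (s p : ℝ) :
    ∀ᶠ k in sideFilter s p, k ∈ cutPlane k₁ k₂ := by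
  filter_upwards [self_mem_nhdsWithin] with k (hk : 0 < s * k.re)
  exact mem_cutPlane_of_re_ne_zero (right_ne_zero_of_mul hk.ne')

lemma tendsto_neg_sideFilter (s p : ℝ) :
    Tendsto (fun k : ℂ => -k) (sideFilter (-s) (-p)) (sideFilter s p) := by
  refine tendsto_nhdsWithin_iff.mpr ⟨?_, ?_⟩
  · refine Tendsto.mono_left ?_ (sideFilter_le (-s) (-p))
    exact continuous_neg.tendsto' _ _ (by push_cast; ring)
  · filter_upwards [self_mem_nhdsWithin] with k (hk : 0 < -s * k.re)
    simpa using hk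

lemma hasNontangentialLimit_of_tendsto {s p : ℝ} {f : ℂ → ℂ} {l : ℂ}
    (h : Tendsto f (sideFilter s p) (𝓝 l)) : HasNontangentialLimit s f p l :=
  fun _ _ => h.mono_left (nhdsWithin_mono _ fun _ hk => hk.1)

lemma eventually_re_mul_im_pos_sideFilter {s p : ℝ} (hp : p ≠ 0) :
    ∀ᶠ k in sideFilter s p, 0 < s * p * (k.re * k.im) := by
  have him : ∀ᶠ k : ℂ in 𝓝 (Complex.I * p), 0 < p * k.im := by
    have hcont : ContinuousAt (fun k : ℂ => p * k.im) (Complex.I * p) :=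
      (continuous_const.mul Complex.continuous_im).continuousAt
    exact hcont.eventually_const_lt (by simpa using mul_self_pos.mpr hp)
  filter_upwards [sideFilter_le s p him, self_mem_nhdsWithin] with k hk (hk' : 0 < s * k.re)
  linarith [mul_pos hk' hk]

lemma tendsto_exp_I_mul_sideFilter (s p x : ℝ) :
    Tendsto (fun k : ℂ => Complex.exp (Complex.I * k * x)) (sideFilter s p)
      (𝓝 (Real.exp (-(p * x)))) := by
  have hcont : Continuous fun k : ℂ => Complex.exp (Complex.I * k * x) := by fun_prop
  refine (hcont.tendsto' _ _ ?_).mono_left (sideFilter_le s p)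
  rw [← mul_assoc, Complex.I_mul_I]
  push_cast
  ring_nf

lemma I_mul_sq_add (p q : ℝ) :
    (Complex.I * (p : ℂ)) ^ 2 + (q : ℂ) ^ 2 = ((q ^ 2 - p ^ 2 : ℝ) : ℂ) := by
  rw [mul_pow, Complex.I_sq]
  push_cast
  ring

lemma I_mul_sq_add_ne_zero₁ {p : ℝ} (hk₁ : 0 < k₁) (hp₁ : k₁ < |p|) :
    (Complex.I * (p : ℂ)) ^ 2 + (k₁ : ℂ) ^ 2 ≠ 0 := by
  rw [I_mul_sq_add, Complex.ofReal_ne_zero]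
  nlinarith [sq_abs p]

lemma I_mul_sq_add_ne_zero₂ {p : ℝ} (hp₂ : |p| < k₂) :
    (Complex.I * (p : ℂ)) ^ 2 + (k₂ : ℂ) ^ 2 ≠ 0 := by
  rw [I_mul_sq_add, Complex.ofReal_ne_zero]
  nlinarith [sq_abs p, abs_nonneg p]

lemma branchRatio_I_mul (p : ℝ) :
    branchRatio k₁ k₂ (Complex.I * p) = (((k₁ ^ 2 - p ^ 2) / (k₂ ^ 2 - p ^ 2) : ℝ) : ℂ) := by
  rw [branchRatio, I_mul_sq_add, I_mul_sq_add, Complex.ofReal_div]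

lemma branchRatio_I_mul_re_neg {p : ℝ} (hk₁ : 0 < k₁) (hp₁ : k₁ < |p|) (hp₂ : |p| < k₂) :
    (branchRatio k₁ k₂ (Complex.I * p)).re < 0 := by
  rw [branchRatio_I_mul, Complex.ofReal_re]
  exact div_neg_of_neg_of_pos (by nlinarith [sq_abs p]) (by nlinarith [sq_abs p, abs_nonneg p])

lemma branchRatio_im {k : ℂ} (h : k ^ 2 + (k₂ : ℂ) ^ 2 ≠ 0) :
    (branchRatio k₁ k₂ k).im =
      2 * (k₂ ^ 2 - k₁ ^ 2) / Complex.normSq (k ^ 2 + (k₂ : ℂ) ^ 2) * (k.re * k.im) := by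
  have hnormSq : Complex.normSq (k ^ 2 + (k₂ : ℂ) ^ 2) ≠ 0 := by simpa using h
  have hre : ∀ q : ℝ, (k ^ 2 + (q : ℂ) ^ 2).re = k.re ^ 2 - k.im ^ 2 + q ^ 2 := fun q => by
    simp [sq]
  have him : ∀ q : ℝ, (k ^ 2 + (q : ℂ) ^ 2).im = 2 * k.re * k.im := fun q => by
    simp [sq]
    ring
  rw [branchRatio, Complex.div_im, hre, hre, him, him]
  field_simp
  ring

lemma eventually_branchRatio_im_pos {s p : ℝ} (hk₁ : 0 < k₁) (hp₁ : k₁ < |p|) (hp₂ : |p| < k₂) :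
    ∀ᶠ k in sideFilter s p, 0 < s * p * (branchRatio k₁ k₂ k).im := by
  have hp : p ≠ 0 := abs_pos.mp (hk₁.trans hp₁)
  have hden : ∀ᶠ k in sideFilter s p, k ^ 2 + (k₂ : ℂ) ^ 2 ≠ 0 :=
    sideFilter_le s p ((by fun_prop : ContinuousAt (fun k : ℂ => k ^ 2 + (k₂ : ℂ) ^ 2)
      (Complex.I * p)).eventually_ne (I_mul_sq_add_ne_zero₂ hp₂))
  filter_upwards [hden, eventually_re_mul_im_pos_sideFilter hp] with k hk hpos
  rw [branchRatio_im hk, mul_left_comm]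
  have : 0 < k₂ ^ 2 - k₁ ^ 2 := by nlinarith
  have := Complex.normSq_pos.mpr hk
  exact mul_pos (by positivity) hpos

lemma tendsto_branchRatio_sideFilter (s : ℝ) {p : ℝ} (hp₂ : |p| < k₂) :
    Tendsto (branchRatio k₁ k₂) (sideFilter s p) (𝓝 (branchRatio k₁ k₂ (Complex.I * p))) :=
  (analyticAt_branchRatio (I_mul_sq_add_ne_zero₂ hp₂)).continuousAt.tendsto.mono_left
    (sideFilter_le s p)

lemma tendsto_branchRatio_cpow_of_tendsto_log {s p : ℝ} {l : ℂ} (a : ℂ) (hk₁ : 0 < k₁)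
    (hp₁ : k₁ < |p|) (hp₂ : |p| < k₂)
    (h : Tendsto (fun k => Complex.log (branchRatio k₁ k₂ k)) (sideFilter s p) (𝓝 l)) :
    Tendsto (fun k => branchRatio k₁ k₂ k ^ a) (sideFilter s p) (𝓝 (Complex.exp (l * a))) := by
  have hne : branchRatio k₁ k₂ (Complex.I * p) ≠ 0 := fun h0 => by
    simpa [h0] using branchRatio_I_mul_re_neg hk₁ hp₁ hp₂
  refine ((h.mul_const a).cexp).congr' ?_
  filter_upwards [(tendsto_branchRatio_sideFilter s hp₂).eventually_ne hne] with k hk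
  rw [Complex.cpow_def_of_ne_zero hk]

lemma tendsto_branchRatio_cpow_of_pos {s p : ℝ} (a : ℂ) (hk₁ : 0 < k₁) (hp₁ : k₁ < |p|)
    (hp₂ : |p| < k₂) (hs : 0 < s * p) :
    Tendsto (fun k => branchRatio k₁ k₂ k ^ a) (sideFilter s p)
      (𝓝 (Complex.exp ((Real.log ‖branchRatio k₁ k₂ (Complex.I * p)‖ + Real.pi * Complex.I) *
        a))) := by
  refine tendsto_branchRatio_cpow_of_tendsto_log a hk₁ hp₁ hp₂
    ((Complex.tendsto_log_nhdsWithin_im_nonneg_of_re_neg_of_im_zero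
      (branchRatio_I_mul_re_neg hk₁ hp₁ hp₂) (by rw [branchRatio_I_mul, Complex.ofReal_im])).comp
      (tendsto_nhdsWithin_iff.mpr ⟨tendsto_branchRatio_sideFilter s hp₂, ?_⟩))
  filter_upwards [eventually_branchRatio_im_pos hk₁ hp₁ hp₂] with k hk
  exact (pos_of_mul_pos_right hk hs.le).le

lemma tendsto_branchRatio_cpow_of_neg {s p : ℝ} (a : ℂ) (hk₁ : 0 < k₁) (hp₁ : k₁ < |p|)
    (hp₂ : |p| < k₂) (hs : s * p < 0) :
    Tendsto (fun k => branchRatio k₁ k₂ k ^ a) (sideFilter s p)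
      (𝓝 (Complex.exp ((Real.log ‖branchRatio k₁ k₂ (Complex.I * p)‖ - Real.pi * Complex.I) *
        a))) := by
  refine tendsto_branchRatio_cpow_of_tendsto_log a hk₁ hp₁ hp₂
    ((Complex.tendsto_log_nhdsWithin_im_neg_of_re_neg_of_im_zero
      (branchRatio_I_mul_re_neg hk₁ hp₁ hp₂) (by rw [branchRatio_I_mul, Complex.ofReal_im])).comp
      (tendsto_nhdsWithin_iff.mpr ⟨tendsto_branchRatio_sideFilter s hp₂, ?_⟩))
  filter_upwards [eventually_branchRatio_im_pos hk₁ hp₁ hp₂] with k hk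
  exact neg_of_mul_pos_right hk hs.le

lemma exists_tendsto_branchRatio_cpow_quarter {p : ℝ} (hk₁ : 0 < k₁) (hp₁ : k₁ < p)
    (hp₂ : p < k₂) :
    ∃ ρ : ℂ, ∀ s q : ℝ, |q| = p →
      (0 < s * q → Tendsto (fun k => branchRatio k₁ k₂ k ^ (1 / 4 : ℂ)) (sideFilter s q)
        (𝓝 (Complex.I * ρ))) ∧
      (s * q < 0 → Tendsto (fun k => branchRatio k₁ k₂ k ^ (1 / 4 : ℂ)) (sideFilter s q)
        (𝓝 ρ)) := by
  refine ⟨Complex.exp ((Real.log ‖branchRatio k₁ k₂ (Complex.I * p)‖ - Real.pi * Complex.I) *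
    (1 / 4)), fun s q hq => ?_⟩
  have hratio : branchRatio k₁ k₂ (Complex.I * p) = branchRatio k₁ k₂ (Complex.I * q) := by
    rw [branchRatio_I_mul, branchRatio_I_mul, ← hq, sq_abs]
  have hexp (l : ℂ) : Complex.I * Complex.exp ((l - Real.pi * Complex.I) * (1 / 4)) =
      Complex.exp ((l + Real.pi * Complex.I) * (1 / 4)) := by
    nth_rw 1 [← Complex.exp_pi_div_two_mul_I]
    rw [← Complex.exp_add]
    ring_nf
  rw [hratio, hexp]
  subst hq
  exact ⟨tendsto_branchRatio_cpow_of_pos (1 / 4) hk₁ hp₁ hp₂,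
    tendsto_branchRatio_cpow_of_neg (1 / 4) hk₁ hp₁ hp₂⟩

lemma exists_tendsto_spectralRoot_sideFilter {p : ℝ} (hk₁ : 0 < k₁) (hp₁ : k₁ < p)
    (hp₂ : p < k₂) :
    ∃ S₀ : ℂ, Tendsto (spectralRoot k₁ k₂) (sideFilter 1 p) (𝓝 S₀) ∧
      Tendsto (spectralRoot k₁ k₂) (sideFilter (-1) p) (𝓝 (-S₀)) := by
  have hp : 0 < p := hk₁.trans hp₁
  rw [← abs_of_pos hp] at hp₁ hp₂
  have hfactor : ∀ s : ℝ, Tendsto (fun k : ℂ => k ^ 2 + (k₂ : ℂ) ^ 2) (sideFilter s p)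
      (𝓝 ((Complex.I * p) ^ 2 + (k₂ : ℂ) ^ 2)) := fun s =>
    (by fun_prop : ContinuousAt (fun k : ℂ => k ^ 2 + (k₂ : ℂ) ^ 2)
      (Complex.I * p)).tendsto.mono_left (sideFilter_le s p)
  refine ⟨_, (hfactor 1).mul (tendsto_branchRatio_cpow_of_pos (1 / 2) hk₁ hp₁ hp₂
    (by simpa using hp)), ?_⟩
  have hminus := (hfactor (-1)).mul (tendsto_branchRatio_cpow_of_neg (1 / 2) hk₁ hp₁ hp₂
    (by simpa using hp))
  have hexp (l : ℂ) : Complex.exp ((l - Real.pi * Complex.I) * (1 / 2)) =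
      -Complex.exp ((l + Real.pi * Complex.I) * (1 / 2)) := by
    rw [sub_mul, add_mul, sub_eq_add_neg, Complex.exp_add, Complex.exp_add, mul_one_div (_ * _),
      mul_div_right_comm, Complex.exp_neg, Complex.exp_pi_div_two_mul_I, Complex.inv_I, mul_neg]
  rw [hexp, mul_neg] at hminus
  exact hminus

end OneSided

/-- `v` is the one-sided limit at the point `ip` of the cuts of solutions
`u ∈ spectralFiber L k₁ k₂ k`, and hence, modulo periods, of the branches `z(k)`. -/
structure IsSpectralBoundaryValue (L : PeriodPair) (k₁ k₂ s p : ℝ) (v : ℂ) : Prop where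
  notMem_lattice : v ∉ L.lattice
  sq_eq : (Complex.I * p) ^ 2 = e₃ k₁ k₂ - L.weierstrassP v
  exists_tendsto : ∃ g : ℂ → ℂ, Tendsto g (sideFilter s p) (𝓝 v) ∧
    ∀ᶠ k in sideFilter s p, g k ∈ spectralFiber L k₁ k₂ k

lemma neg_mem_spectralFiber {L : PeriodPair} {k₁ k₂ : ℝ} {k u : ℂ}
    (hu : u ∈ spectralFiber L k₁ k₂ k) : -u ∈ spectralFiber L k₁ k₂ (-k) := by
  refine ⟨by simpa using hu.1, by simpa using hu.2.1, ?_⟩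
  rw [L.derivWeierstrassP_neg, hu.2.2, spectralRoot_neg]
  ring

lemma IsSpectralBoundaryValue.neg {L : PeriodPair} {k₁ k₂ s p : ℝ} {v : ℂ}
    (hv : IsSpectralBoundaryValue L k₁ k₂ s p v) :
    IsSpectralBoundaryValue L k₁ k₂ (-s) (-p) (-v) where
  notMem_lattice := by simpa using hv.notMem_lattice
  sq_eq := by simpa using hv.sq_eq
  exists_tendsto := by
    obtain ⟨g, hg, hmem⟩ := hv.exists_tendsto
    refine ⟨fun k => -g (-k), (hg.comp (tendsto_neg_sideFilter s p)).neg, ?_⟩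
    filter_upwards [(tendsto_neg_sideFilter s p).eventually hmem] with k hk
    simpa using neg_mem_spectralFiber hk

namespace HalfPeriodValues

variable {L : PeriodPair} {k₁ k₂ : ℝ} {h₁ w h₃ : ℂ} (H : HalfPeriodValues L k₁ k₂ h₁ w h₃)
include H

lemma w_sub_notMem {k u : ℂ} (h : k ^ 2 = e₃ k₁ k₂ - L.weierstrassP u)
    (hk : k ^ 2 + (k₁ : ℂ) ^ 2 ≠ 0) : w - u ∉ L.lattice := by
  intro hmem
  have hP := weierstrassP_add_mem L hmem u
  rw [add_sub_cancel, H.weierstrassP_w, ofReal_e₂] at hP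
  exact hk (by linear_combination h + hP)

-- The two boundary values of the root `S` of `(k² + k₁²)(k² + k₂²)` at `ip` are opposite, hence
-- so are the limits of the solutions `u` with `℘'(u) = 2ikS`.
lemma exists_isSpectralBoundaryValue {p : ℝ} (hp₁ : k₁ < p) (hp₂ : p < k₂) :
    ∃ v, IsSpectralBoundaryValue L k₁ k₂ 1 p v ∧ IsSpectralBoundaryValue L k₁ k₂ (-1) p (-v) := by
  have hp : |p| = p := abs_of_pos (H.pos.trans hp₁)
  have hne₂ : (Complex.I * (p : ℂ)) ^ 2 + (k₂ : ℂ) ^ 2 ≠ 0 := I_mul_sq_add_ne_zero₂ (by rwa [hp])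
  obtain ⟨S₀, hright, hleft⟩ := exists_tendsto_spectralRoot_sideFilter H.pos hp₁ hp₂
  have hS₀ : S₀ ^ 2 =
      ((Complex.I * p) ^ 2 + (k₁ : ℂ) ^ 2) * ((Complex.I * p) ^ 2 + (k₂ : ℂ) ^ 2) := by
    have hcont : Continuous fun k : ℂ => (k ^ 2 + (k₁ : ℂ) ^ 2) * (k ^ 2 + (k₂ : ℂ) ^ 2) := by
      fun_prop
    have := sideFilter_one_neBot p
    refine tendsto_nhds_unique ((hright.pow 2).congr' ?_)
      ((hcont.tendsto _).mono_left (sideFilter_le 1 p))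
    filter_upwards [eventually_mem_cutPlane_sideFilter (k₁ := k₁) (k₂ := k₂) 1 p] with k hk
    exact spectralRoot_sq (sq_add_sq_ne_zero₂ H.pos H.lt hk)
  obtain ⟨f, hf, hI⟩ := H.exists_isLocalSolution_deriv_mul_eq_I
    (I_mul_sq_add_ne_zero₁ H.pos (by rwa [hp])) hne₂ hS₀
  have hvalue {g : ℂ → ℂ} {s : ℝ} (hg : IsLocalSolution L (e₃ k₁ k₂) g (Complex.I * p))
      (hmem : ∀ᶠ k in sideFilter s p, g k ∈ spectralFiber L k₁ k₂ k) :
      IsSpectralBoundaryValue L k₁ k₂ s p (g (Complex.I * p)) :=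
    ⟨hg.eventually_notMem.self_of_nhds, hg.eventually_sq_eq.self_of_nhds,
      g, hg.analyticAt.continuousAt.tendsto.mono_left (sideFilter_le s p), hmem⟩
  exact ⟨f (Complex.I * p),
    hvalue hf (H.eventually_mem_spectralFiber hf (sideFilter_le 1 p)
      (eventually_mem_cutPlane_sideFilter 1 p) hright hI),
    hvalue hf.neg (H.eventually_mem_spectralFiber hf.neg (sideFilter_le (-1) p)
      (eventually_mem_cutPlane_sideFilter (-1) p) hleft (by rw [deriv.neg, neg_mul_neg, hI]))⟩

variable {z : ℂ → ℂ} (hz : IsSpectralBranch L k₁ k₂ (e₃ k₁ k₂) z)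
include hz

lemma lamePhi_branch_eq {k u : ℂ} (hk : k ∈ cutPlane k₁ k₂) (hu : u ∈ spectralFiber L k₁ k₂ k)
    (x : ℝ) : lamePhi L w x (z k) = lamePhi L w x u := by
  rw [← lamePhi_add_mem L (H.branch_sub_mem hz hk hu.1 hu.2.1 hu.2.2) hu.1 x, add_sub_cancel]

variable (hw : ∀ x : ℝ, (x : ℂ) - w ∉ L.lattice)
include hw

lemma analyticOnNhd_chi (x : ℝ) :
    AnalyticOnNhd ℂ (fun k => chi L w k₁ k₂ z k x) (cutPlane k₁ k₂) := by
  intro k hk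
  have hphi : AnalyticAt ℂ (fun k => lamePhi L w x (z k)) k :=
    hz.analyticAt_comp (fun u hu l hl => lamePhi_add_mem L hl hu x) hk
      (analyticAt_lamePhi L (hw x) (hz.notMem_lattice k hk)
        (H.w_sub_notMem (hz.sq_eq k hk) (sq_add_sq_ne_zero₁ H.pos H.lt hk)))
  have hroot := (analyticAt_branchRatio (k₁ := k₁) (sq_add_sq_ne_zero₂ H.pos H.lt hk)).cpow
    (analyticAt_const (v := (1 / 4 : ℂ))) (branchRatio_mem_slitPlane H.pos H.lt hk)
  have hexp : AnalyticAt ℂ (fun k : ℂ => Complex.exp (Complex.I * k * x)) k := by fun_prop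
  exact (hroot.mul hphi).mul hexp

lemma tendsto_chi {s p : ℝ} {c v : ℂ} (hp₁ : k₁ < |p|)
    (hc : Tendsto (fun k => branchRatio k₁ k₂ k ^ (1 / 4 : ℂ)) (sideFilter s p) (𝓝 c))
    (hv : IsSpectralBoundaryValue L k₁ k₂ s p v) (x : ℝ) :
    Tendsto (fun k => chi L w k₁ k₂ z k x) (sideFilter s p)
      (𝓝 (c * lamePhi L w x v * Real.exp (-(p * x)))) := by
  obtain ⟨g, hg, hmem⟩ := hv.exists_tendsto
  have hcont := (analyticAt_lamePhi L (hw x) hv.notMem_lattice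
    (H.w_sub_notMem hv.sq_eq (I_mul_sq_add_ne_zero₁ H.pos hp₁))).continuousAt
  have hphi : Tendsto (fun k => lamePhi L w x (z k)) (sideFilter s p) (𝓝 (lamePhi L w x v)) := by
    refine (hcont.tendsto.comp hg).congr' ?_
    filter_upwards [eventually_mem_cutPlane_sideFilter s p, hmem] with k hk hk'
    exact (H.lamePhi_branch_eq hz hk hk' x).symm
  exact (hc.mul hphi).mul (tendsto_exp_I_mul_sideFilter s p x)

lemma exists_tendsto_chi {p : ℝ} (hp₁ : k₁ < p) (hp₂ : p < k₂) (x : ℝ) :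
    ∃ A B : ℂ,
      Tendsto (fun k => chi L w k₁ k₂ z k x) (sideFilter 1 p)
        (𝓝 (Complex.I * A * Real.exp (-(p * x)))) ∧
      Tendsto (fun k => chi L w k₁ k₂ z k x) (sideFilter (-1) p)
        (𝓝 (B * Real.exp (-(p * x)))) ∧
      Tendsto (fun k => chi L w k₁ k₂ z k x) (sideFilter 1 (-p))
        (𝓝 (A * Real.exp (p * x))) ∧
      Tendsto (fun k => chi L w k₁ k₂ z k x) (sideFilter (-1) (-p))
        (𝓝 (Complex.I * B * Real.exp (p * x))) := by
  have hp : 0 < p := H.pos.trans hp₁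
  have habs : |p| = p := abs_of_pos hp
  have habs_neg : |-p| = p := by rw [abs_neg, habs]
  obtain ⟨ρ, hρ⟩ := exists_tendsto_branchRatio_cpow_quarter H.pos hp₁ hp₂
  obtain ⟨v, hright, hleft⟩ := H.exists_isSpectralBoundaryValue hp₁ hp₂
  have hleft_neg := hright.neg
  have hright_neg := hleft.neg
  rw [neg_neg, neg_neg] at hright_neg
  refine ⟨ρ * lamePhi L w x v, ρ * lamePhi L w x (-v), ?_⟩
  simp only [← mul_assoc]
  refine ⟨H.tendsto_chi hz hw (by rwa [habs]) ((hρ 1 p habs).1 (by simpa)) hright x,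
    H.tendsto_chi hz hw (by rwa [habs]) ((hρ (-1) p habs).2 (by simpa)) hleft x, ?_, ?_⟩
  · simpa only [neg_mul, neg_neg] using
      H.tendsto_chi hz hw (by rwa [habs_neg]) ((hρ 1 (-p) habs_neg).2 (by simpa)) hright_neg x
  · simpa only [neg_mul, neg_neg] using
      H.tendsto_chi hz hw (by rwa [habs_neg]) ((hρ (-1) (-p) habs_neg).1 (by simpa)) hleft_neg x

lemma exists_tendsto_chi_jump {p : ℝ} (hp₁ : k₁ < p) (hp₂ : p < k₂) (x : ℝ) :
    ∃ Ap Am Bp Bm : ℂ,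
      Tendsto (fun k => chi L w k₁ k₂ z k x) (sideFilter 1 p) (𝓝 Ap) ∧
      Tendsto (fun k => chi L w k₁ k₂ z k x) (sideFilter (-1) p) (𝓝 Am) ∧
      Tendsto (fun k => chi L w k₁ k₂ z k x) (sideFilter 1 (-p)) (𝓝 Bp) ∧
      Tendsto (fun k => chi L w k₁ k₂ z k x) (sideFilter (-1) (-p)) (𝓝 Bm) ∧
      Ap - Am = Complex.I * Real.exp (-2 * p * x) * (Bp + Bm) ∧
      Bp - Bm = -Complex.I * Real.exp (2 * p * x) * (Ap + Am) := by
  obtain ⟨A, B, hAp, hAm, hBp, hBm⟩ := H.exists_tendsto_chi hz hw hp₁ hp₂ x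
  have hexp_neg : (Real.exp (-(p * x)) : ℂ) = Real.exp (-2 * p * x) * Real.exp (p * x) := by
    rw [← Complex.ofReal_mul, ← Real.exp_add]
    ring_nf
  have hexp_pos : (Real.exp (p * x) : ℂ) = Real.exp (2 * p * x) * Real.exp (-(p * x)) := by
    rw [← Complex.ofReal_mul, ← Real.exp_add]
    ring_nf
  refine ⟨_, _, _, _, hAp, hAm, hBp, hBm, ?_, ?_⟩
  · linear_combination (Complex.I * A - B) * hexp_neg -
      B * Real.exp (-2 * p * x) * Real.exp (p * x) * Complex.I_sq
  · linear_combination (A - Complex.I * B) * hexp_pos +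
      A * Real.exp (2 * p * x) * Real.exp (-(p * x)) * Complex.I_sq

theorem exists_jumps : ∃ χp χm : ℝ → ℝ → ℂ,
    (∀ x p : ℝ, k₁ < |p| → |p| < k₂ →
      HasNontangentialLimit 1 (fun k => chi L w k₁ k₂ z k x) p (χp p x) ∧
      HasNontangentialLimit (-1) (fun k => chi L w k₁ k₂ z k x) p (χm p x)) ∧
    (∀ x p : ℝ, k₁ < p → p < k₂ →
      χp p x - χm p x = Complex.I * Real.exp (-2 * p * x) * (χp (-p) x + χm (-p) x)) ∧
    (∀ x p : ℝ, k₁ < p → p < k₂ →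
      χp (-p) x - χm (-p) x = -Complex.I * Real.exp (2 * p * x) * (χp p x + χm p x)) := by
  choose! Ap Am Bp Bm hAp hAm hBp hBm hjump_pos hjump_neg using
    fun (p : ℝ) (hp : k₁ < p ∧ p < k₂) => H.exists_tendsto_chi_jump hz hw hp.1 hp.2
  refine ⟨fun p => if 0 < p then Ap p else Bp (-p), fun p => if 0 < p then Am p else Bm (-p),
    fun x p hp₁ hp₂ => ?_, fun x p hp₁ hp₂ => ?_, fun x p hp₁ hp₂ => ?_⟩
  · by_cases hp : 0 < p
    · rw [abs_of_pos hp] at hp₁ hp₂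
      simp only [if_pos hp]
      exact ⟨hasNontangentialLimit_of_tendsto (hAp p ⟨hp₁, hp₂⟩ x),
        hasNontangentialLimit_of_tendsto (hAm p ⟨hp₁, hp₂⟩ x)⟩
    · rw [abs_of_nonpos (not_lt.mp hp)] at hp₁ hp₂
      have hlimp := hBp (-p) ⟨hp₁, hp₂⟩ x
      have hlimm := hBm (-p) ⟨hp₁, hp₂⟩ x
      rw [neg_neg] at hlimp hlimm
      simp only [if_neg hp]
      exact ⟨hasNontangentialLimit_of_tendsto hlimp, hasNontangentialLimit_of_tendsto hlimm⟩
  all_goals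
    have hp : 0 < p := H.pos.trans hp₁
    simp only [if_pos hp, if_neg (by linarith : ¬ 0 < -p), neg_neg]
  · exact hjump_pos p ⟨hp₁, hp₂⟩ x
  · exact hjump_neg p ⟨hp₁, hp₂⟩ x

end HalfPeriodValues

/-! ### The endpoints of the cuts -/

lemma nhds_le_map_weierstrassP (L : PeriodPair) {u₀ : ℂ} (hu₀ : u₀ ∉ L.lattice) :
    𝓝 (L.weierstrassP u₀) ≤ map L.weierstrassP (𝓝 u₀) := by
  refine (L.analyticOnNhd_weierstrassP u₀ hu₀).eventually_constant_or_nhds_le_map_nhds.resolve_left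
    fun hconst => ?_
  have hP := (L.analyticOnNhd_weierstrassP).eqOn_of_preconnected_of_eventuallyEq
    analyticOnNhd_const (isPreconnected_compl_lattice L) hu₀ hconst
  have hzero : Tendsto (fun u : ℂ => u ^ 2 * L.weierstrassP u) (𝓝[≠] 0) (𝓝 0) := by
    have hcont : Continuous fun u : ℂ => u ^ 2 * L.weierstrassP u₀ := by fun_prop
    refine ((hcont.tendsto' 0 0 (by simp)).mono_left nhdsWithin_le_nhds).congr' ?_
    filter_upwards [eventually_notMem_lattice_zero L] with u hu
    rw [hP hu]
  exact zero_ne_one (tendsto_nhds_unique hzero (tendsto_sq_mul_weierstrassP L))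

lemma exists_sq_add_mul_sq_add_eq_sub_mul {a b c : ℂ} (hc : c ^ 2 = -a ^ 2) (ha : a ≠ 0)
    (hab : b ^ 2 - a ^ 2 ≠ 0) : ∃ g : ℂ → ℂ, Continuous g ∧ g c ≠ 0 ∧
      ∀ k, (k ^ 2 + a ^ 2) * (k ^ 2 + b ^ 2) = (k - c) * g k := by
  have hc0 : c ≠ 0 := by
    rintro rfl
    simp [ha] at hc
  refine ⟨fun k => (k + c) * (k ^ 2 + b ^ 2), by fun_prop, mul_ne_zero ?_ ?_, fun k => ?_⟩
  · rw [← two_mul]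
    exact mul_ne_zero two_ne_zero hc0
  · rwa [hc, neg_add_eq_sub]
  · linear_combination (k ^ 2 + b ^ 2) * hc

lemma norm_chi_pow_four (L : PeriodPair) (w : ℂ) (k₁ k₂ : ℝ) (z : ℂ → ℂ) (k : ℂ) (x : ℝ) :
    ‖chi L w k₁ k₂ z k x‖ ^ 4 = ‖k ^ 2 + (k₁ : ℂ) ^ 2‖ / ‖k ^ 2 + (k₂ : ℂ) ^ 2‖ *
      ‖lamePhi L w x (z k)‖ ^ 4 * ‖Complex.exp (Complex.I * k * x)‖ ^ 4 := by
  have hroot (r : ℂ) : ‖r ^ (1 / 4 : ℂ)‖ ^ 4 = ‖r‖ := by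
    rw [← norm_pow, one_div, Complex.cpow_ofNat_inv_pow]
  rw [chi, norm_mul, norm_mul, mul_pow, mul_pow, hroot, norm_div]

namespace HalfPeriodValues

variable {L : PeriodPair} {k₁ k₂ : ℝ} {h₁ w h₃ : ℂ} (H : HalfPeriodValues L k₁ k₂ h₁ w h₃)
include H

lemma exists_mul_sub_eq {c : ℂ} (hc : c ^ 2 = -(k₁ : ℂ) ^ 2 ∨ c ^ 2 = -(k₂ : ℂ) ^ 2) :
    ∃ g : ℂ → ℂ, Continuous g ∧ g c ≠ 0 ∧
      ∀ k, (k ^ 2 + (k₁ : ℂ) ^ 2) * (k ^ 2 + (k₂ : ℂ) ^ 2) = (k - c) * g k := by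
  have hne := H.sq_sub_sq_ne_zero
  rcases hc with hc | hc
  · exact exists_sq_add_mul_sq_add_eq_sub_mul hc H.k₁_ne_zero (by rwa [← neg_sub, neg_ne_zero])
  · simpa only [mul_comm] using exists_sq_add_mul_sq_add_eq_sub_mul hc H.k₂_ne_zero hne

variable {z : ℂ → ℂ} (hz : IsSpectralBranch L k₁ k₂ (e₃ k₁ k₂) z)
include hz

-- `k² + k₁² = ℘(w) - ℘(z(k))`, so the pole of `φ(x, ·)` at `w` is compensated even at `k = ±ik₁`.
lemma exists_norm_lamePhi_branch_le (c : ℂ) (x : ℝ) :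
    ∃ C, ∀ᶠ k in 𝓝[cutPlane k₁ k₂] c,
      ‖lamePhi L w x (z k)‖ ^ 2 * ‖k ^ 2 + (k₁ : ℂ) ^ 2‖ ≤ C := by
  obtain ⟨K, hK, hKle⟩ := exists_norm_sq_lamePhi_le L H.isHalfPeriod_w x
  obtain ⟨u₀, hu₀, hP⟩ := exists_weierstrassP_eq L (e₃ k₁ k₂ - c ^ 2)
  have hK_neg : ContinuousAt (fun u => K (-u)) u₀ :=
    ContinuousAt.comp (g := K) (hK _ (by simpa using hu₀)) continuous_neg.continuousAt
  set C := max (‖K u₀‖ + 1) (‖K (-u₀)‖ + 1)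
  have hbound : ∀ᶠ u in 𝓝 u₀, u ∉ L.lattice ∧ ‖K u‖ ≤ C ∧ ‖K (-u)‖ ≤ C := by
    filter_upwards [eventually_notMem_lattice L hu₀,
      (hK u₀ hu₀).norm.eventually_le_const (lt_add_one _),
      hK_neg.norm.eventually_le_const (lt_add_one _)] with u hu hpos hneg
    exact ⟨hu, hpos.trans (le_max_left _ _), hneg.trans (le_max_right _ _)⟩
  have himage := nhds_le_map_weierstrassP L hu₀ (image_mem_map hbound)
  rw [hP] at himage
  have hcont : ContinuousAt (fun k : ℂ => (e₃ k₁ k₂ : ℂ) - k ^ 2) c := by fun_prop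
  refine ⟨C, ?_⟩
  filter_upwards [mem_nhdsWithin_of_mem_nhds (hcont.eventually himage), self_mem_nhdsWithin]
    with k ⟨u, ⟨hu, hpos, hneg⟩, huk⟩ hk
  have hsq : k ^ 2 = e₃ k₁ k₂ - L.weierstrassP u := by rw [huk, sub_sub_cancel]
  have hdist : ∀ v, L.weierstrassP v = L.weierstrassP u →
      ‖L.weierstrassP v - L.weierstrassP w‖ = ‖k ^ 2 + (k₁ : ℂ) ^ 2‖ := fun v hv => by
    rw [hv, H.weierstrassP_w, ofReal_e₂, ← norm_neg]
    congr 1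
    linear_combination -hsq
  rcases H.mem_or_neg_mem_spectralFiber hk hu hsq with hmem | hmem
  · rw [H.lamePhi_branch_eq hz hk hmem, ← hdist u rfl]
    exact (hKle u hu).trans hpos
  · rw [H.lamePhi_branch_eq hz hk hmem, ← hdist (-u) (L.weierstrassP_neg u)]
    exact (hKle (-u) hmem.1).trans hneg

lemma exists_norm_chi_pow_four_mul_le (x : ℝ) {c : ℂ}
    (hc : c ^ 2 = -(k₁ : ℂ) ^ 2 ∨ c ^ 2 = -(k₂ : ℂ) ^ 2) :
    ∃ C, ∀ᶠ k in 𝓝[cutPlane k₁ k₂] c, ‖chi L w k₁ k₂ z k x‖ ^ 4 * ‖k - c‖ ≤ C := by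
  obtain ⟨g, hg, hgc, hgk⟩ := H.exists_mul_sub_eq hc
  obtain ⟨C, hphi⟩ := H.exists_norm_lamePhi_branch_le hz c x
  have hfactor : ContinuousAt (fun k : ℂ => ‖Complex.exp (Complex.I * k * x)‖ ^ 4 / ‖g k‖) c :=
    ContinuousAt.div (by fun_prop) (by fun_prop) (norm_ne_zero_iff.mpr hgc)
  refine ⟨C ^ 2 * (‖Complex.exp (Complex.I * c * x)‖ ^ 4 / ‖g c‖ + 1), ?_⟩
  filter_upwards [hphi, mem_nhdsWithin_of_mem_nhds
    (hfactor.eventually_le_const (lt_add_one _)), self_mem_nhdsWithin] with k hphik hfactork hk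
  have hN := norm_ne_zero_iff.mpr (sq_add_sq_ne_zero₁ H.pos H.lt hk)
  have hM := norm_ne_zero_iff.mpr (sq_add_sq_ne_zero₂ H.pos H.lt hk)
  have hprod : ‖k ^ 2 + (k₁ : ℂ) ^ 2‖ * ‖k ^ 2 + (k₂ : ℂ) ^ 2‖ = ‖k - c‖ * ‖g k‖ := by
    rw [← norm_mul, ← norm_mul, hgk]
  have hgk0 : ‖g k‖ ≠ 0 := right_ne_zero_of_mul (hprod ▸ mul_ne_zero hN hM)
  calc ‖chi L w k₁ k₂ z k x‖ ^ 4 * ‖k - c‖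
      = (‖lamePhi L w x (z k)‖ ^ 2 * ‖k ^ 2 + (k₁ : ℂ) ^ 2‖) ^ 2 *
          (‖Complex.exp (Complex.I * k * x)‖ ^ 4 / ‖g k‖) := by
        rw [norm_chi_pow_four]
        field_simp
        linear_combination -‖lamePhi L w x (z k)‖ ^ 4 * hprod
    _ ≤ _ := by gcongr

lemma exists_norm_chi_lt (x : ℝ) {c : ℂ}
    (hc : c ^ 2 = -(k₁ : ℂ) ^ 2 ∨ c ^ 2 = -(k₂ : ℂ) ^ 2) :
    ∃ C, ∀ᶠ k in 𝓝[cutPlane k₁ k₂] c, ‖chi L w k₁ k₂ z k x‖ < C / ‖k - c‖ ^ (1 / 4 : ℝ) := by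
  obtain ⟨C, hC⟩ := H.exists_norm_chi_pow_four_mul_le hz x hc
  obtain ⟨g, -, -, hgk⟩ := H.exists_mul_sub_eq hc
  refine ⟨|C| + 1, ?_⟩
  filter_upwards [hC, self_mem_nhdsWithin] with k hle hk
  have hkc : 0 < ‖k - c‖ := norm_pos_iff.mpr <| left_ne_zero_of_mul <| hgk k ▸
    mul_ne_zero (sq_add_sq_ne_zero₁ H.pos H.lt hk) (sq_add_sq_ne_zero₂ H.pos H.lt hk)
  have hroot : (‖k - c‖ ^ (1 / 4 : ℝ)) ^ 4 = ‖k - c‖ := by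
    simpa using Real.rpow_inv_natCast_pow (norm_nonneg (k - c)) four_ne_zero
  rw [lt_div_iff₀ (by positivity)]
  refine lt_of_pow_lt_pow_left₀ 4 (by positivity) ?_
  calc (‖chi L w k₁ k₂ z k x‖ * ‖k - c‖ ^ (1 / 4 : ℝ)) ^ 4
      = ‖chi L w k₁ k₂ z k x‖ ^ 4 * ‖k - c‖ := by rw [mul_pow, hroot]
    _ ≤ |C| := hle.trans (le_abs_self C)
    _ < |C| + 1 := lt_add_one _
    _ ≤ (|C| + 1) ^ 4 := le_self_pow₀ (by simp) four_ne_zero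

theorem exists_endpoint_bound : ∃ α : ℝ, α < 1 ∧ ∀ x : ℝ, ∃ C : ℝ,
    ∀ c ∈ ({Complex.I * k₁, -(Complex.I * k₁), Complex.I * k₂, -(Complex.I * k₂)} : Set ℂ),
      ∀ᶠ k in 𝓝[cutPlane k₁ k₂] c, ‖chi L w k₁ k₂ z k x‖ < C / ‖k - c‖ ^ α := by
  refine ⟨1 / 4, by norm_num, fun x => ?_⟩
  set E : Set ℂ := {Complex.I * k₁, -(Complex.I * k₁), Complex.I * k₂, -(Complex.I * k₂)}
  have hsq : ∀ c ∈ E, c ^ 2 = -(k₁ : ℂ) ^ 2 ∨ c ^ 2 = -(k₂ : ℂ) ^ 2 := by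
    rintro c (rfl | rfl | rfl | rfl) <;> simp [mul_pow]
  choose! C hC using fun c => H.exists_norm_chi_lt hz x (c := c)
  obtain ⟨B, hB⟩ := ((Set.toFinite E).image C).bddAbove
  refine ⟨B, fun c hc => ?_⟩
  filter_upwards [hC c (hsq c hc)] with k hk
  have := hB ⟨c, hc, rfl⟩
  exact hk.trans_le (by gcongr)

end HalfPeriodValues

/-! ### The expansion at infinity -/

section Infinity

variable (L : PeriodPair)

lemma hasDerivAt_weierstrassPExcept_zero : HasDerivAt (L.weierstrassPExcept 0) 0 0 :=
  hasDerivAt_zero_of_even (L.analyticAt_weierstrassPExcept 0).differentiableAt fun u => by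
    simpa using L.weierstrassPExcept_neg 0 u

lemma analyticAt_zetaRegular_zero : AnalyticAt ℂ (zetaRegular L) 0 :=
  DifferentiableOn.analyticAt
    (fun _ hz => (hasDerivAt_zetaRegular L hz).differentiableAt.differentiableWithinAt)
    (L.isOpen_compl_lattice_sdiff.mem_nhds (by simp))

/-- The function of `z`, regular at `0`, that equals `-(kz)²` when `k² = e - ℘(z)`. -/
def momentumSq (e z : ℂ) : ℂ := 1 + z ^ 2 * (L.weierstrassPExcept 0 z - e)

/-- The square root of `momentumSq` that equals `1` at `0`; it is `ikz` on a branch with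
`kz → -i`. -/
def momentumRoot (e z : ℂ) : ℂ := momentumSq L e z ^ (1 / 2 : ℂ)

/-- The function of `z`, regular at `0`, that equals `ik - 1/z` when `ikz = momentumRoot L e z`.
The difference `(momentumRoot L e z - 1) / z` is rationalized, so that no pole remains. -/
def momentumRegular (e z : ℂ) : ℂ :=
  z * (L.weierstrassPExcept 0 z - e) / (momentumRoot L e z + 1)

/-- The function `χ` at large `k` in terms of the local parameter `z = z(k)` near `0`. The
essential singularities of `e^{ikx}` and `e^{-ζ(z)x}` cancel, which leaves the exponential of
`x` times the difference of the regular parts. -/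
def chiLocal (e w : ℂ) (k₁ k₂ x : ℝ) (z : ℂ) : ℂ :=
  ((momentumSq L e z - (k₁ : ℂ) ^ 2 * z ^ 2) / (momentumSq L e z - (k₂ : ℂ) ^ 2 * z ^ 2)) ^
      (1 / 4 : ℂ) *
    (weierstrassSigma L (x - w + z) * weierstrassSigma L w /
      (weierstrassSigma L (x - w) * weierstrassSigma L (w - z))) *
    Complex.exp (x * (momentumRegular L e z - zetaRegular L z))

/-- The coefficient `Q(x)` of `i/(2k)` in the expansion of `χ(k,x)` at infinity. -/
def chiCoefficient (e w : ℂ) (x : ℝ) : ℂ :=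
  -2 * weierstrassZeta L (x - w) - 2 * weierstrassZeta L w + e * x

variable (e : ℂ)

@[simp]
lemma momentumSq_zero : momentumSq L e 0 = 1 := by simp [momentumSq]

@[simp]
lemma momentumRoot_zero : momentumRoot L e 0 = 1 := by simp [momentumRoot]

@[simp]
lemma momentumRegular_zero : momentumRegular L e 0 = 0 := by simp [momentumRegular]

lemma momentumRoot_sq (z : ℂ) : momentumRoot L e z ^ 2 = momentumSq L e z := by
  rw [momentumRoot, ← Complex.cpow_nat_mul]
  simp

lemma analyticAt_momentumSq : AnalyticAt ℂ (momentumSq L e) 0 :=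
  analyticAt_const.add ((analyticAt_id.pow 2).mul
    ((L.analyticAt_weierstrassPExcept 0).sub analyticAt_const))

lemma analyticAt_momentumRoot : AnalyticAt ℂ (momentumRoot L e) 0 :=
  (analyticAt_momentumSq L e).cpow analyticAt_const (by simp)

lemma analyticAt_momentumRegular : AnalyticAt ℂ (momentumRegular L e) 0 :=
  (analyticAt_id.mul ((L.analyticAt_weierstrassPExcept 0).sub analyticAt_const)).div
    ((analyticAt_momentumRoot L e).add analyticAt_const) (by norm_num)

lemma hasDerivAt_momentumSq_zero : HasDerivAt (momentumSq L e) 0 0 :=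
  ((((hasDerivAt_id (0 : ℂ)).pow 2).mul
    ((hasDerivAt_weierstrassPExcept_zero L).sub_const e)).const_add 1).congr_deriv (by simp)

lemma hasDerivAt_momentumRoot_zero : HasDerivAt (momentumRoot L e) 0 0 :=
  ((hasDerivAt_momentumSq_zero L e).cpow_const (c := (1 / 2 : ℂ)) (by simp)).congr_deriv (by simp)

lemma hasDerivAt_momentumRegular_zero : HasDerivAt (momentumRegular L e) (-e / 2) 0 := by
  have hnumerator := (hasDerivAt_id (0 : ℂ)).mul
    ((hasDerivAt_weierstrassPExcept_zero L).sub_const e)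
  have hdenominator := (hasDerivAt_momentumRoot_zero L e).add_const 1
  refine (hnumerator.div hdenominator (by norm_num)).congr_deriv ?_
  simp only [PeriodPair.weierstrassPExcept_zero, zero_sub, mul_neg, one_mul, id_eq, mul_zero,
    add_zero, momentumRoot_zero, neg_mul, Pi.mul_apply, zero_mul, neg_zero, sub_zero]
  ring

lemma hasDerivAt_momentumSq_sub_zero (a : ℂ) :
    HasDerivAt (fun z => momentumSq L e z - a ^ 2 * z ^ 2) 0 0 :=
  ((hasDerivAt_momentumSq_zero L e).sub
    (((hasDerivAt_id (0 : ℂ)).pow 2).const_mul (a ^ 2))).congr_deriv (by simp)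

variable {e} {w : ℂ} {k₁ k₂ x : ℝ}

lemma chiLocal_zero (hw : w ∉ L.lattice) (hxw : (x : ℂ) - w ∉ L.lattice) :
    chiLocal L e w k₁ k₂ x 0 = 1 := by
  simp [chiLocal, weierstrassSigma_ne_zero L hw, weierstrassSigma_ne_zero L hxw]

lemma analyticAt_chiLocal (hw : w ∉ L.lattice) (hxw : (x : ℂ) - w ∉ L.lattice) :
    AnalyticAt ℂ (chiLocal L e w k₁ k₂ x) 0 := by
  have hratio (a : ℝ) : AnalyticAt ℂ (fun z => momentumSq L e z - (a : ℂ) ^ 2 * z ^ 2) 0 :=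
    (analyticAt_momentumSq L e).sub (by fun_prop)
  have hsigma := (differentiable_weierstrassSigma L).analyticAt
  have hsigmaNum : AnalyticAt ℂ (fun z => weierstrassSigma L (x - w + z)) 0 :=
    AnalyticAt.fun_comp (hsigma _) (by fun_prop)
  have hsigmaDen : AnalyticAt ℂ (fun z => weierstrassSigma L (w - z)) 0 :=
    AnalyticAt.fun_comp (hsigma _) (by fun_prop)
  exact ((((hratio k₁).div (hratio k₂) (by simp)).cpow analyticAt_const (by simp)).mul
    ((hsigmaNum.mul analyticAt_const).div (analyticAt_const.mul hsigmaDen)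
      (by simp [weierstrassSigma_ne_zero L hw, weierstrassSigma_ne_zero L hxw]))).mul
    (analyticAt_const.mul
      ((analyticAt_momentumRegular L e).sub (analyticAt_zetaRegular_zero L))).cexp

lemma hasDerivAt_weierstrassSigma_quotient_zero {y w : ℂ} (hy : y ∉ L.lattice)
    (hw : w ∉ L.lattice) :
    HasDerivAt (fun z => weierstrassSigma L (y + z) * weierstrassSigma L w /
        (weierstrassSigma L y * weierstrassSigma L (w - z)))
      (weierstrassZeta L y + weierstrassZeta L w) 0 := by
  have hσy := weierstrassSigma_ne_zero L hy
  have hσw := weierstrassSigma_ne_zero L hw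
  have hnum : HasDerivAt (fun z => weierstrassSigma L (y + z))
      (weierstrassZeta L y * weierstrassSigma L y) 0 :=
    HasDerivAt.comp_const_add y 0 (by simpa using hasDerivAt_weierstrassSigma L hy)
  have hden : HasDerivAt (fun z => weierstrassSigma L (w - z))
      (-(weierstrassZeta L w * weierstrassSigma L w)) 0 :=
    HasDerivAt.comp_const_sub w 0 (by simpa using hasDerivAt_weierstrassSigma L hw)
  refine ((hnum.mul_const (weierstrassSigma L w)).div (hden.const_mul (weierstrassSigma L y))
    (by simp [hσy, hσw])).congr_deriv ?_
  simp only [add_zero, sub_zero]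
  field_simp
  ring

lemma hasDerivAt_chiLocal_zero (hw : w ∉ L.lattice) (hxw : (x : ℂ) - w ∉ L.lattice) :
    HasDerivAt (chiLocal L e w k₁ k₂ x)
      (weierstrassZeta L (x - w) + weierstrassZeta L w - x * e / 2) 0 := by
  have hratio := ((hasDerivAt_momentumSq_sub_zero L e k₁).div
    (hasDerivAt_momentumSq_sub_zero L e k₂) (by simp)).cpow_const (c := (1 / 4 : ℂ)) (by simp)
  have hexp := (((hasDerivAt_momentumRegular_zero L e).sub
    (hasDerivAt_zetaRegular L (z := 0) (by simp))).const_mul (x : ℂ)).cexp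
  refine ((hratio.mul (hasDerivAt_weierstrassSigma_quotient_zero L hxw hw)).mul hexp).congr_deriv ?_
  have hσw := weierstrassSigma_ne_zero L hw
  have hσxw := weierstrassSigma_ne_zero L hxw
  simp only [Pi.div_apply, Pi.mul_apply, Pi.sub_apply, momentumSq_zero, momentumRegular_zero,
    zetaRegular_zero, PeriodPair.weierstrassPExcept_zero, ne_eq, OfNat.ofNat_ne_zero,
    not_false_eq_true, zero_pow, mul_zero, sub_zero, add_zero, one_ne_zero, div_self,
    Complex.one_cpow, Complex.exp_zero, mul_eq_zero, hσw, hσxw, or_self]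
  ring

variable {L} {z : ℂ → ℂ} (hz : IsSpectralBranch L k₁ k₂ e z)
include hz

lemma IsSpectralBranch.ne_zero {k : ℂ} (hk : k ∈ cutPlane k₁ k₂) : z k ≠ 0 :=
  fun h => hz.notMem_lattice k hk (h ▸ L.lattice.zero_mem)

lemma IsSpectralBranch.tendsto_zero : Tendsto z (Bornology.cobounded ℂ) (𝓝 0) :=
  tendsto_zero_of_tendsto_mul_cobounded hz.at_infinity

lemma IsSpectralBranch.tendsto_momentumRoot :
    Tendsto (fun k => momentumRoot L e (z k)) (Bornology.cobounded ℂ) (𝓝 1) := by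
  have := (analyticAt_momentumRoot L e).continuousAt.tendsto.comp hz.tendsto_zero
  rwa [momentumRoot_zero] at this

lemma IsSpectralBranch.sq_mul_sq {k : ℂ} (hk : k ∈ cutPlane k₁ k₂) :
    k ^ 2 * z k ^ 2 = -momentumSq L e (z k) := by
  rw [hz.sq_eq k hk, momentumSq]
  linear_combination -sq_mul_weierstrassP L (hz.ne_zero hk)

lemma IsSpectralBranch.eventually_I_mul_mul : ∀ᶠ k in Bornology.cobounded ℂ,
    Complex.I * k * z k = momentumRoot L e (z k) := by
  have hsum : Tendsto (fun k => Complex.I * (k * z k) + momentumRoot L e (z k))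
      (Bornology.cobounded ℂ) (𝓝 2) := by
    convert (hz.at_infinity.const_mul Complex.I).add hz.tendsto_momentumRoot using 2
    rw [mul_neg, Complex.I_mul_I]
    norm_num
  filter_upwards [hsum.eventually_ne two_ne_zero, eventually_mem_cutPlane_cobounded]
    with k hsum_ne hk
  have hfactored : (Complex.I * (k * z k) + momentumRoot L e (z k)) *
      (Complex.I * k * z k - momentumRoot L e (z k)) = 0 := by
    linear_combination k ^ 2 * z k ^ 2 * Complex.I_sq - hz.sq_mul_sq hk -
      momentumRoot_sq L e (z k)
  exact sub_eq_zero.mp ((mul_eq_zero.mp hfactored).resolve_left hsum_ne)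

lemma IsSpectralBranch.eventually_I_mul_eq : ∀ᶠ k in Bornology.cobounded ℂ,
    Complex.I * k = 1 / z k + momentumRegular L e (z k) := by
  filter_upwards [hz.eventually_I_mul_mul, eventually_mem_cutPlane_cobounded,
    hz.tendsto_momentumRoot.eventually_ne (show (1 : ℂ) ≠ -1 by norm_num)] with k hroot hk hne
  have hz₀ := hz.ne_zero hk
  have hden : momentumRoot L e (z k) + 1 ≠ 0 := fun h => hne (eq_neg_of_add_eq_zero_left h)
  have hsq := momentumRoot_sq L e (z k)
  rw [momentumSq] at hsq
  rw [eq_div_of_mul_eq hz₀ hroot, momentumRegular]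
  field_simp
  linear_combination hsq

lemma IsSpectralBranch.ratio_eq_momentumSq {k : ℂ} (hk : k ∈ cutPlane k₁ k₂) :
    (k ^ 2 + (k₁ : ℂ) ^ 2) / (k ^ 2 + (k₂ : ℂ) ^ 2) =
      (momentumSq L e (z k) - (k₁ : ℂ) ^ 2 * z k ^ 2) /
        (momentumSq L e (z k) - (k₂ : ℂ) ^ 2 * z k ^ 2) := by
  rw [← mul_div_mul_left _ _ (neg_ne_zero.mpr (pow_ne_zero 2 (hz.ne_zero hk)))]
  congr 1 <;> linear_combination -hz.sq_mul_sq hk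

lemma IsSpectralBranch.eventually_chi_eq (w : ℂ) (x : ℝ) : ∀ᶠ k in Bornology.cobounded ℂ,
    chi L w k₁ k₂ z k x = chiLocal L e w k₁ k₂ x (z k) := by
  filter_upwards [hz.eventually_I_mul_eq, eventually_mem_cutPlane_cobounded] with k hI hk
  rw [chi, chiLocal, lamePhi, hz.ratio_eq_momentumSq hk, weierstrassZeta_eq, hI, mul_assoc,
    mul_assoc, mul_assoc, ← Complex.exp_add]
  congr 4
  ring

lemma IsSpectralBranch.isBigO_sq : (fun k => z k ^ 2) =O[Bornology.cobounded ℂ]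
    fun k => 1 / k ^ 2 := by
  have hbounded := ((hz.at_infinity.pow 2).isBigO_one ℂ).mul
    (isBigO_refl (fun k : ℂ => 1 / k ^ 2) (Bornology.cobounded ℂ))
  simp only [one_mul] at hbounded
  refine hbounded.congr' ?_ .rfl
  filter_upwards [Bornology.eventually_ne_cobounded (0 : ℂ)] with k hk
  field_simp

-- Since `1/k = iz / momentumRoot L e z`, both sides are functions of `z` regular at `0`, and their
-- difference vanishes there to second order.
lemma IsSpectralBranch.chi_isBigO (hw : w ∉ L.lattice) (hxw : (x : ℂ) - w ∉ L.lattice) :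
    (fun k => chi L w k₁ k₂ z k x - (1 + Complex.I / (2 * k) * chiCoefficient L e w x))
      =O[Bornology.cobounded ℂ] fun k => 1 / k ^ 2 := by
  set a := weierstrassZeta L (x - w) + weierstrassZeta L w - x * e / 2 with ha
  let remainder := fun u => chiLocal L e w k₁ k₂ x u - (1 + u * a / momentumRoot L e u)
  have hanalytic : AnalyticAt ℂ remainder 0 := (analyticAt_chiLocal L hw hxw).sub
    (analyticAt_const.add ((analyticAt_id.mul analyticAt_const).div (analyticAt_momentumRoot L e)
      (by simp)))
  have hderiv : HasDerivAt remainder 0 0 :=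
    ((hasDerivAt_chiLocal_zero L (e := e) (k₁ := k₁) (k₂ := k₂) hw hxw).sub
      ((((hasDerivAt_id (0 : ℂ)).mul_const a).div (hasDerivAt_momentumRoot_zero L e)
        (by simp)).const_add 1)).congr_deriv (by simp [ha])
  obtain ⟨g, hg, hremainder⟩ :=
    exists_analyticAt_eq_sq_mul hanalytic (by simp [remainder, chiLocal_zero L hw hxw]) hderiv
  have hbound := hz.isBigO_sq.mul ((hg.continuousAt.tendsto.comp hz.tendsto_zero).isBigO_one ℂ)
  simp only [mul_one] at hbound
  refine hbound.congr' ?_ .rfl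
  filter_upwards [hz.eventually_chi_eq w x, hz.eventually_I_mul_mul,
    eventually_mem_cutPlane_cobounded, Bornology.eventually_ne_cobounded (0 : ℂ)]
    with k hchi hroot hkD hk
  have hz₀ := hz.ne_zero hkD
  have hI := Complex.I_ne_zero
  simp only [Function.comp_apply]
  rw [← hremainder, hchi]
  simp only [remainder]
  rw [← hroot, ha, chiCoefficient]
  field_simp
  linear_combination (2 * (-weierstrassZeta L (x - w) - weierstrassZeta L w) + x * e) *
    Complex.I_sq

omit hz in
lemma hasDerivAt_chiCoefficient (e : ℂ) (hxw : (x : ℂ) - w ∉ L.lattice) :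
    HasDerivAt (chiCoefficient L e w) (2 * L.weierstrassP (x - w) + e) x :=
  HasDerivAt.comp_ofReal <| (((((hasDerivAt_weierstrassZeta L hxw).comp_sub_const _ w).const_mul
    (-2)).sub_const (2 * weierstrassZeta L w)).add
      ((hasDerivAt_id (x : ℂ)).const_mul e)).congr_deriv (by ring)

end Infinity

/-! ### Rectangular lattices -/

section RectangularLattice

variable {ω ω' : ℝ} (hω : 0 < ω) (hω' : 0 < ω')

lemma mem_rectPeriods_lattice {u : ℂ} : u ∈ (rectPeriods ω ω' hω hω').lattice ↔
    ∃ m n : ℤ, u.re = 2 * ω * m ∧ u.im = 2 * ω' * n := by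
  rw [PeriodPair.mem_lattice]
  refine exists_congr fun m => exists_congr fun n => ?_
  rw [Complex.ext_iff]
  simp [rectPeriods, mul_comm, mul_left_comm, eq_comm]

lemma odd_mul_ne_even_mul {a : ℝ} (ha : a ≠ 0) (m n : ℤ) : (2 * m + 1) * a ≠ 2 * a * n := by
  intro h
  have hparity : ((2 * m + 1 : ℤ) : ℝ) = ((2 * n : ℤ) : ℝ) := by
    push_cast
    exact mul_right_cancel₀ ha (by linarith)
  have := Int.cast_injective hparity
  omega

lemma notMem_rectPeriods_of_im {u : ℂ} (m : ℤ) (hu : u.im = (2 * m + 1) * ω') :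
    u ∉ (rectPeriods ω ω' hω hω').lattice := by
  rw [mem_rectPeriods_lattice]
  rintro ⟨-, n, -, hn⟩
  exact odd_mul_ne_even_mul hω'.ne' m n (hu.symm.trans hn)

lemma notMem_rectPeriods_of_re {u : ℂ} (m : ℤ) (hu : u.re = (2 * m + 1) * ω) :
    u ∉ (rectPeriods ω ω' hω hω').lattice := by
  rw [mem_rectPeriods_lattice]
  rintro ⟨n, -, hn, -⟩
  exact odd_mul_ne_even_mul hω.ne' m n (hu.symm.trans hn)

lemma isHalfPeriod_rectPeriods_h₁ : IsHalfPeriod (rectPeriods ω ω' hω hω') ω where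
  two_mul_mem := (mem_rectPeriods_lattice hω hω').mpr ⟨1, 0, by simp, by simp⟩
  notMem := notMem_rectPeriods_of_re hω hω' 0 (by simp)

lemma isHalfPeriod_rectPeriods_w :
    IsHalfPeriod (rectPeriods ω ω' hω hω') (ω + Complex.I * ω') where
  two_mul_mem := (mem_rectPeriods_lattice hω hω').mpr ⟨1, 1, by simp, by simp⟩
  notMem := notMem_rectPeriods_of_im hω hω' 0 (by simp)

lemma isHalfPeriod_rectPeriods_h₃ : IsHalfPeriod (rectPeriods ω ω' hω hω') (Complex.I * ω') where
  two_mul_mem := (mem_rectPeriods_lattice hω hω').mpr ⟨0, 1, by simp, by simp⟩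
  notMem := notMem_rectPeriods_of_im hω hω' 0 (by simp)

end RectangularLattice

/-! ### Differences of half-period values as row sums -/

section RowSums

lemma sin_pi_mul_ne_zero {z : ℂ} (hz : z.im ≠ 0) : Complex.sin (Real.pi * z) ≠ 0 := by
  rw [Complex.sin_ne_zero_iff]
  intro n h
  have hint : z = n :=
    mul_left_cancel₀ (Complex.ofReal_ne_zero.mpr Real.pi_ne_zero) (h.trans (mul_comm _ _))
  simp [hint] at hz

lemma hasDerivAt_pi_mul_cot_pi_mul {z : ℂ} (hz : Complex.sin (Real.pi * z) ≠ 0) :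
    HasDerivAt (fun z : ℂ => Real.pi * Complex.cot (Real.pi * z))
      (-(Real.pi ^ 2 / Complex.sin (Real.pi * z) ^ 2)) z := by
  have hmul : HasDerivAt (fun z : ℂ => (Real.pi : ℂ) * z) Real.pi z := by
    simpa using (hasDerivAt_id z).const_mul (Real.pi : ℂ)
  refine ((hmul.ccos.div hmul.csin hz).const_mul (Real.pi : ℂ)).congr_deriv ?_
  field_simp
  linear_combination -Complex.sin_sq_add_cos_sq (Real.pi * z)

-- Differentiate the partial fraction expansion of `π cot(πz)`.
lemma hasSum_one_div_add_int_sq_of_im_pos {z : ℂ} (hz : 0 < z.im) :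
    HasSum (fun n : ℤ => 1 / (z + n) ^ 2) (Real.pi ^ 2 / Complex.sin (Real.pi * z) ^ 2) := by
  have hsummable : Summable fun n : ℤ => 1 / (z + n) ^ 2 :=
    (EisensteinSeries.linear_right_summable z 1 (k := 2) le_rfl).congr fun n => by simp
  have hcot := iteratedDerivWithin_cot_pi_mul_eq_mul_tsum_div_pow (k := 1) le_rfl hz
  rw [iteratedDerivWithin_one, derivWithin_of_isOpen UpperHalfPlane.isOpen_upperHalfPlaneSet hz,
    (hasDerivAt_pi_mul_cot_pi_mul (sin_pi_mul_ne_zero hz.ne')).deriv] at hcot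
  convert hsummable.hasSum using 1
  simpa using hcot

lemma hasSum_one_div_add_int_sq {z : ℂ} (hz : z.im ≠ 0) :
    HasSum (fun n : ℤ => 1 / (z + n) ^ 2) (Real.pi ^ 2 / Complex.sin (Real.pi * z) ^ 2) := by
  rcases hz.lt_or_gt with hneg | hpos
  · have hsum := hasSum_one_div_add_int_sq_of_im_pos (z := -z) (by simpa using hneg)
    rw [mul_neg, Complex.sin_neg, neg_sq] at hsum
    refine ((Equiv.neg ℤ).hasSum_iff.mpr hsum).congr_fun fun n => ?_
    simp only [Function.comp_apply, Equiv.neg_apply]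
    push_cast
    congr 1
    ring
  · exact hasSum_one_div_add_int_sq_of_im_pos hpos

/-- The function `1 / cosh² (π y) + 1 / sinh² (π y)`, which is `π⁻²` times the sum of
`1 / (1/2 + iy + n)² - 1 / (iy + n)²` over `n ∈ ℤ`, that is, over a row of the lattice. -/
def rowTerm (y : ℝ) : ℝ :=
  1 / Real.cosh (Real.pi * y) ^ 2 + 1 / Real.sinh (Real.pi * y) ^ 2

/-- The sum of `rowTerm` over the rows of a rectangular lattice of aspect ratio `t`, as seen from
a half-period: the rows lie at the heights `(ℤ + 1/2) t`. -/
def rowSum (t : ℝ) : ℝ := ∑' n : ℤ, rowTerm ((n + 1 / 2) * t)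

lemma rowSum_neg (t : ℝ) : rowSum (-t) = rowSum t := by simp [rowSum, rowTerm]

lemma hasSum_row {y : ℝ} (hy : y ≠ 0) :
    HasSum (fun n : ℤ => 1 / (1 / 2 + Complex.I * y + n) ^ 2 - 1 / (Complex.I * y + n) ^ 2)
      ((Real.pi ^ 2 * rowTerm y : ℝ) : ℂ) := by
  have hcosh : Complex.sin (Real.pi * (1 / 2 + Complex.I * y)) = Complex.cosh (Real.pi * y) := by
    rw [show (Real.pi : ℂ) * (1 / 2 + Complex.I * y) = Real.pi * y * Complex.I + Real.pi / 2 by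
      ring, Complex.sin_add_pi_div_two, Complex.cos_mul_I]
  have hsinh : Complex.sin (Real.pi * (Complex.I * y)) =
      Complex.sinh (Real.pi * y) * Complex.I := by
    rw [show (Real.pi : ℂ) * (Complex.I * y) = Real.pi * y * Complex.I by ring,
      Complex.sin_mul_I]
  have hvalue : ((Real.pi ^ 2 * rowTerm y : ℝ) : ℂ) =
      Real.pi ^ 2 / Complex.sin (Real.pi * (1 / 2 + Complex.I * y)) ^ 2 -
        Real.pi ^ 2 / Complex.sin (Real.pi * (Complex.I * y)) ^ 2 := by
    rw [hcosh, hsinh, mul_pow, Complex.I_sq, rowTerm]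
    push_cast
    ring
  rw [hvalue]
  exact (hasSum_one_div_add_int_sq (by simpa using hy)).sub
    (hasSum_one_div_add_int_sq (by simpa using hy))

lemma hasSum_weierstrassP_sub (L : PeriodPair) (z z' : ℂ) :
    HasSum (fun p : ℤ × ℤ => 1 / (z + (p.1 * L.ω₁ + p.2 * L.ω₂)) ^ 2 -
      1 / (z' + (p.1 * L.ω₁ + p.2 * L.ω₂)) ^ 2) (L.weierstrassP z - L.weierstrassP z') := by
  have hlattice := ((Equiv.neg (ℤ × ℤ)).trans L.latticeEquivProd.symm.toEquiv).hasSum_iff.mpr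
    ((L.hasSum_weierstrassP z).sub (L.hasSum_weierstrassP z'))
  refine hlattice.congr_fun fun p => ?_
  have hperiod : ((L.latticeEquivProd.symm (-p) : L.lattice) : ℂ) =
      -(p.1 * L.ω₁ + p.2 * L.ω₂) := by
    rw [L.latticeEquiv_symm_apply]
    simp only [Prod.fst_neg, Prod.snd_neg]
    push_cast
    ring
  simp only [Function.comp_apply, Equiv.trans_apply, Equiv.neg_apply, LinearEquiv.coe_toEquiv,
    hperiod]
  ring

lemma int_add_half_ne_zero (n : ℤ) : (n : ℝ) + 1 / 2 ≠ 0 := by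
  have := odd_mul_ne_even_mul one_ne_zero n 0
  contrapose! this
  push_cast
  linarith

lemma hasSum_lattice_eq_rowSum {a b s : ℂ} {t : ℝ} (ht : t ≠ 0) (hb : b = Complex.I * t * a)
    (hs : HasSum (fun p : ℤ × ℤ => 1 / ((a + b) / 2 + (p.1 * a + p.2 * b)) ^ 2 -
      1 / (b / 2 + (p.1 * a + p.2 * b)) ^ 2) s) : s = (Real.pi / a) ^ 2 * rowSum t := by
  have hrow (n : ℤ) : HasSum (fun m : ℤ => 1 / ((a + b) / 2 + (m * a + n * b)) ^ 2 -
      1 / (b / 2 + (m * a + n * b)) ^ 2)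
      (1 / a ^ 2 * ((Real.pi ^ 2 * rowTerm ((n + 1 / 2) * t) : ℝ) : ℂ)) := by
    refine ((hasSum_row (mul_ne_zero (int_add_half_ne_zero n) ht)).mul_left
      (1 / a ^ 2)).congr_fun fun m => ?_
    rw [hb, mul_sub, one_div_mul_one_div, one_div_mul_one_div, ← mul_pow, ← mul_pow]
    push_cast
    congr 3 <;> ring
  have hrows := ((Equiv.prodComm ℤ ℤ).hasSum_iff.mpr hs).prod_fiberwise hrow
  rw [← hrows.tsum_eq, tsum_mul_left, ← Complex.ofReal_tsum, tsum_mul_left, rowSum]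
  push_cast
  ring

variable {ω ω' : ℝ} (hω : 0 < ω) (hω' : 0 < ω')

lemma weierstrassP_w_sub_h₃ :
    (rectPeriods ω ω' hω hω').weierstrassP (ω + Complex.I * ω') -
      (rectPeriods ω ω' hω hω').weierstrassP (Complex.I * ω') =
    ((Real.pi / (2 * ω)) ^ 2 * rowSum (ω' / ω) : ℝ) := by
  have hω₀ : (ω : ℂ) ≠ 0 := Complex.ofReal_ne_zero.mpr hω.ne'
  have hsum := hasSum_weierstrassP_sub (rectPeriods ω ω' hω hω')
    (ω + Complex.I * ω') (Complex.I * ω')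
  push_cast
  refine hasSum_lattice_eq_rowSum (a := 2 * ω) (b := 2 * (Complex.I * ω')) (t := ω' / ω)
    (div_pos hω' hω).ne' (by push_cast; field_simp) ?_
  refine hsum.congr_fun fun p => ?_
  simp only [rectPeriods]
  congr 3 <;> ring

-- The columns of the lattice are the rows for the pair of periods `2iω'`, `2ω`.
lemma weierstrassP_h₁_sub_w :
    (rectPeriods ω ω' hω hω').weierstrassP ω -
      (rectPeriods ω ω' hω hω').weierstrassP (ω + Complex.I * ω') =
    ((Real.pi / (2 * ω')) ^ 2 * rowSum (ω / ω') : ℝ) := by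
  have hω₀' : (ω' : ℂ) ≠ 0 := Complex.ofReal_ne_zero.mpr hω'.ne'
  have hsum := (Equiv.prodComm ℤ ℤ).hasSum_iff.mpr
    (hasSum_weierstrassP_sub (rectPeriods ω ω' hω hω') (ω + Complex.I * ω') ω)
  have hcolumns := hasSum_lattice_eq_rowSum (a := 2 * (Complex.I * ω')) (b := 2 * ω)
    (t := -(ω / ω')) (neg_ne_zero.mpr (div_pos hω hω').ne')
    (by push_cast; field_simp; simp) (by
      refine hsum.congr_fun fun p => ?_
      simp only [rectPeriods, Function.comp_apply, Equiv.prodComm_apply, Prod.fst_swap,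
        Prod.snd_swap]
      congr 3 <;> ring)
  rw [← neg_sub, hcolumns, rowSum_neg]
  push_cast
  simp only [div_pow, mul_pow, Complex.I_sq]
  ring

end RowSums

/-! ### Existence of the half-periods -/

section RowSumAnalysis

lemma rowTerm_pos {y : ℝ} (hy : y ≠ 0) : 0 < rowTerm y := by
  have := Real.cosh_pos (Real.pi * y)
  unfold rowTerm
  positivity

lemma rowTerm_mul_pos {t : ℝ} (ht : 0 < t) (n : ℤ) : 0 < rowTerm ((n + 1 / 2) * t) :=
  rowTerm_pos (mul_ne_zero (int_add_half_ne_zero n) ht.ne')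

lemma sq_le_sinh_sq (y : ℝ) : y ^ 2 ≤ Real.sinh y ^ 2 := by
  rw [sq_le_sq, Real.abs_sinh]
  exact Real.self_le_sinh_iff.mpr (abs_nonneg y)

lemma rowTerm_le {y : ℝ} (hy : y ≠ 0) : rowTerm y ≤ 2 / Real.pi ^ 2 * (1 / y ^ 2) := by
  have := Real.pi_pos
  have : 0 < (Real.pi * y) ^ 2 := by positivity
  have hsinh := sq_le_sinh_sq (Real.pi * y)
  have hcosh : (Real.pi * y) ^ 2 ≤ Real.cosh (Real.pi * y) ^ 2 := by
    rw [Real.cosh_sq]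
    linarith
  calc rowTerm y ≤ 1 / (Real.pi * y) ^ 2 + 1 / (Real.pi * y) ^ 2 := by
        unfold rowTerm
        gcongr
    _ = 2 / Real.pi ^ 2 * (1 / y ^ 2) := by
        field_simp
        norm_num

lemma continuousAt_rowTerm {y : ℝ} (hy : y ≠ 0) : ContinuousAt rowTerm y := by
  have hcosh := (Real.cosh_pos (Real.pi * y)).ne'
  have : Real.sinh (Real.pi * y) ≠ 0 := by
    rw [Ne, Real.sinh_eq_zero]
    exact mul_ne_zero Real.pi_ne_zero hy
  unfold rowTerm
  fun_prop (disch := simp_all)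

lemma summable_one_div_int_add_half_sq : Summable fun n : ℤ => 1 / ((n : ℝ) + 1 / 2) ^ 2 := by
  refine ((Real.summable_one_div_int_add_rpow (1 / 2) 2).mpr (by norm_num)).congr fun n => ?_
  norm_cast
  rw [sq_abs]

lemma rowTerm_mul_le {a t : ℝ} (ha : 0 < a) (hat : a ≤ t) (n : ℤ) :
    rowTerm ((n + 1 / 2) * t) ≤ 2 / (Real.pi ^ 2 * a ^ 2) * (1 / ((n : ℝ) + 1 / 2) ^ 2) := by
  have hn := int_add_half_ne_zero n
  have := Real.pi_pos
  calc rowTerm ((n + 1 / 2) * t)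
      ≤ 2 / Real.pi ^ 2 * (1 / (((n : ℝ) + 1 / 2) * t) ^ 2) :=
        rowTerm_le (mul_ne_zero hn (ha.trans_le hat).ne')
    _ ≤ 2 / Real.pi ^ 2 * (1 / (((n : ℝ) + 1 / 2) * a) ^ 2) := by
        simp only [mul_pow]
        gcongr
    _ = 2 / (Real.pi ^ 2 * a ^ 2) * (1 / ((n : ℝ) + 1 / 2) ^ 2) := by
        field_simp

lemma summable_rowTerm {t : ℝ} (ht : 0 < t) :
    Summable fun n : ℤ => rowTerm ((n + 1 / 2) * t) :=
  .of_nonneg_of_le (fun n => (rowTerm_mul_pos ht n).le) (rowTerm_mul_le ht le_rfl)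
    (summable_one_div_int_add_half_sq.mul_left _)

lemma rowTerm_le_rowSum {t : ℝ} (ht : 0 < t) : rowTerm (1 / 2 * t) ≤ rowSum t := by
  simpa [rowSum] using (summable_rowTerm ht).le_tsum 0 fun n _ => (rowTerm_mul_pos ht n).le

lemma rowSum_pos {t : ℝ} (ht : 0 < t) : 0 < rowSum t :=
  (rowTerm_pos (by positivity)).trans_le (rowTerm_le_rowSum ht)

lemma continuousOn_rowSum : ContinuousOn rowSum (Set.Ioi 0) := by
  intro t ht
  have hhalf : 0 < t / 2 := half_pos ht
  refine ((continuousOn_tsum (s := Set.Ici (t / 2)) (fun n s hs => ?_)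
    (summable_one_div_int_add_half_sq.mul_left (2 / (Real.pi ^ 2 * (t / 2) ^ 2)))
    fun n s hs => ?_).continuousAt (Ici_mem_nhds (half_lt_self ht))).continuousWithinAt
  · exact (ContinuousAt.comp (g := rowTerm) (f := fun s => ((n : ℝ) + 1 / 2) * s)
      (continuousAt_rowTerm (mul_ne_zero (int_add_half_ne_zero n) (hhalf.trans_le hs).ne'))
      (by fun_prop)).continuousWithinAt
  · rw [Real.norm_of_nonneg (rowTerm_mul_pos (hhalf.trans_le hs) n).le]
    exact rowTerm_mul_le hhalf hs n

lemma sq_mul_rowSum_le {t : ℝ} (ht : 0 < t) :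
    t ^ 2 * rowSum t ≤ 2 / Real.pi ^ 2 * ∑' n : ℤ, 1 / ((n : ℝ) + 1 / 2) ^ 2 := by
  have hsum := (summable_rowTerm ht).tsum_le_tsum (rowTerm_mul_le ht le_rfl)
    (summable_one_div_int_add_half_sq.mul_left _)
  rw [tsum_mul_left] at hsum
  calc t ^ 2 * rowSum t
      ≤ t ^ 2 * (2 / (Real.pi ^ 2 * t ^ 2) * ∑' n : ℤ, 1 / ((n : ℝ) + 1 / 2) ^ 2) := by
        gcongr
        exact hsum
    _ = 2 / Real.pi ^ 2 * ∑' n : ℤ, 1 / ((n : ℝ) + 1 / 2) ^ 2 := by field_simp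

lemma tendsto_rowSum_nhdsGT_zero : Tendsto rowSum (𝓝[>] 0) atTop := by
  have hsinh : Tendsto (fun t : ℝ => Real.sinh (Real.pi * (1 / 2 * t)) ^ 2) (𝓝[>] 0) (𝓝[>] 0) := by
    refine tendsto_nhdsWithin_iff.mpr ⟨?_, ?_⟩
    · have hcont : Continuous fun t : ℝ => Real.sinh (Real.pi * (1 / 2 * t)) ^ 2 := by fun_prop
      simpa using (hcont.tendsto 0).mono_left nhdsWithin_le_nhds
    · filter_upwards [self_mem_nhdsWithin] with t (ht : 0 < t)
      have : 0 < Real.sinh (Real.pi * (1 / 2 * t)) := Real.sinh_pos_iff.mpr (by positivity)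
      exact pow_pos this 2
  refine tendsto_atTop_mono' _ ?_ hsinh.inv_tendsto_nhdsGT_zero
  filter_upwards [self_mem_nhdsWithin] with t ht
  refine le_trans ?_ (rowTerm_le_rowSum ht)
  rw [rowTerm, ← one_div]
  exact le_add_of_nonneg_left (by positivity)

/-- The ratio `(e₂ - e₃) / (e₁ - e₂)` for the rectangular lattice with `ω' / ω = t`. -/
def rowRatio (t : ℝ) : ℝ := t ^ 2 * rowSum t / rowSum t⁻¹

lemma rowRatio_pos {t : ℝ} (ht : 0 < t) : 0 < rowRatio t :=
  div_pos (mul_pos (pow_pos ht 2) (rowSum_pos ht)) (rowSum_pos (inv_pos.mpr ht))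

lemma rowRatio_inv {t : ℝ} (ht : 0 < t) : rowRatio t⁻¹ = (rowRatio t)⁻¹ := by
  have := rowSum_pos ht
  rw [rowRatio, rowRatio, inv_inv]
  field_simp

lemma continuousOn_rowRatio : ContinuousOn rowRatio (Set.Ioi 0) :=
  ((continuousOn_id.pow 2).mul continuousOn_rowSum).div
    (continuousOn_rowSum.comp (continuousOn_inv₀.mono fun _ ht => ne_of_gt ht)
      fun _ ht => Set.mem_Ioi.mpr (inv_pos.mpr ht)) fun _ ht => (rowSum_pos (inv_pos.mpr ht)).ne'

lemma tendsto_rowRatio_atTop : Tendsto rowRatio atTop (𝓝 0) := by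
  refine squeeze_zero' ?_ ?_
    ((tendsto_rowSum_nhdsGT_zero.comp tendsto_inv_atTop_nhdsGT_zero).const_div_atTop
      (2 / Real.pi ^ 2 * ∑' n : ℤ, 1 / ((n : ℝ) + 1 / 2) ^ 2))
  · filter_upwards [eventually_gt_atTop 0] with t ht using (rowRatio_pos ht).le
  · filter_upwards [eventually_gt_atTop 0] with t ht
    exact div_le_div_of_nonneg_right (sq_mul_rowSum_le ht) (rowSum_pos (inv_pos.mpr ht)).le

lemma exists_rowRatio_lt {c : ℝ} (hc : 0 < c) : ∃ t : ℝ, 0 < t ∧ rowRatio t < c :=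
  ((eventually_gt_atTop 0).and (tendsto_rowRatio_atTop.eventually_lt_const hc)).exists

lemma exists_rowRatio_eq {c : ℝ} (hc : 0 < c) : ∃ t : ℝ, 0 < t ∧ rowRatio t = c := by
  obtain ⟨a, ha, hac⟩ := exists_rowRatio_lt hc
  obtain ⟨b, hb, hbc⟩ := exists_rowRatio_lt (inv_pos.mpr hc)
  have hcb : c ≤ rowRatio b⁻¹ := by
    rw [rowRatio_inv hb]
    exact (le_inv_comm₀ hc (rowRatio_pos hb)).mpr hbc.le
  exact isPreconnected_Ioi.intermediate_value (Set.mem_Ioi.mpr ha)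
    (Set.mem_Ioi.mpr (inv_pos.mpr hb)) continuousOn_rowRatio ⟨hac.le, hcb⟩

end RowSumAnalysis

section Existence

lemma exists_weierstrassP_sub_eq {a b : ℝ} (ha : 0 < a) (hb : 0 < b) :
    ∃ (ω ω' : ℝ) (hω : 0 < ω) (hω' : 0 < ω'),
      (rectPeriods ω ω' hω hω').weierstrassP (ω + Complex.I * ω') -
        (rectPeriods ω ω' hω hω').weierstrassP (Complex.I * ω') = a ∧
      (rectPeriods ω ω' hω hω').weierstrassP ω -
        (rectPeriods ω ω' hω hω').weierstrassP (ω + Complex.I * ω') = b := by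
  obtain ⟨t, ht, hratio⟩ := exists_rowRatio_eq (div_pos ha hb)
  have := Real.pi_pos
  have hsum := rowSum_pos ht
  have hsum' := rowSum_pos (inv_pos.mpr ht)
  set ω := Real.pi / 2 * √(rowSum t / a) with hω_def
  have hω : 0 < ω := by positivity
  have hω_sq : ω ^ 2 = Real.pi ^ 2 / 4 * (rowSum t / a) := by
    rw [hω_def, mul_pow, Real.sq_sqrt (by positivity)]
    ring
  have hrows : (Real.pi / (2 * ω)) ^ 2 * rowSum t = a := by
    rw [div_pow, mul_pow, hω_sq]
    field_simp
    norm_num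
  have hcolumns : (Real.pi / (2 * (t * ω))) ^ 2 * rowSum t⁻¹ = b := by
    rw [rowRatio, div_eq_div_iff hsum'.ne' hb.ne', ← one_div] at hratio
    rw [div_pow, mul_pow, mul_pow, hω_sq, div_mul_eq_mul_div, div_eq_iff (by positivity)]
    field_simp
    linear_combination -4 * hratio
  refine ⟨ω, t * ω, hω, mul_pos ht hω, ?_, ?_⟩
  · rw [weierstrassP_w_sub_h₃, mul_div_cancel_right₀ _ hω.ne', hrows]
  · rw [weierstrassP_h₁_sub_w, div_mul_cancel_right₀ hω.ne', hcolumns]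

lemma sum_eq_zero_of_cubic {g₂ g₃ a b c : ℂ} (ha : 4 * a ^ 3 - g₂ * a - g₃ = 0)
    (hb : 4 * b ^ 3 - g₂ * b - g₃ = 0) (hc : 4 * c ^ 3 - g₂ * c - g₃ = 0)
    (hab : a - b ≠ 0) (hbc : b - c ≠ 0) (hac : a - c ≠ 0) : a + b + c = 0 := by
  have hquadratic : 4 * (a ^ 2 + a * b + b ^ 2) - g₂ = 0 :=
    mul_left_cancel₀ hab (by linear_combination ha - hb)
  have hquadratic' : 4 * (b ^ 2 + b * c + c ^ 2) - g₂ = 0 :=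
    mul_left_cancel₀ hbc (by linear_combination hb - hc)
  exact mul_left_cancel₀ hac (by linear_combination (hquadratic - hquadratic') / 4)

lemma IsHalfPeriod.weierstrassP_cubic {L : PeriodPair} {h : ℂ} (hh : IsHalfPeriod L h) :
    4 * L.weierstrassP h ^ 3 - L.g₂ * L.weierstrassP h - L.g₃ = 0 := by
  rw [← L.derivWeierstrassP_sq h hh.notMem, derivWeierstrassP_half L hh.two_mul_mem,
    zero_pow two_ne_zero]

theorem exists_areHalfPeriods {k₁ k₂ : ℝ} (hk₁ : 0 < k₁) (hk₂ : k₁ < k₂) :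
    ∃ (ω ω' : ℝ) (hω : 0 < ω) (hω' : 0 < ω'), AreHalfPeriods k₁ k₂ ω ω' hω hω' := by
  have hk₁_sq : 0 < k₁ ^ 2 := pow_pos hk₁ 2
  have hsub : 0 < k₂ ^ 2 - k₁ ^ 2 := by nlinarith
  obtain ⟨ω, ω', hω, hω', hw₃, h₁w⟩ := exists_weierstrassP_sub_eq hk₁_sq hsub
  have hsum := sum_eq_zero_of_cubic (isHalfPeriod_rectPeriods_h₁ hω hω').weierstrassP_cubic
    (isHalfPeriod_rectPeriods_w hω hω').weierstrassP_cubic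
    (isHalfPeriod_rectPeriods_h₃ hω hω').weierstrassP_cubic
    (by rw [h₁w]; exact_mod_cast hsub.ne') (by rw [hw₃]; exact_mod_cast hk₁_sq.ne')
    (by rw [← sub_add_sub_cancel, h₁w, hw₃]; exact_mod_cast (add_pos hsub hk₁_sq).ne')
  push_cast at hw₃ h₁w
  refine ⟨ω, ω', hω, hω', ?_, ?_, ?_⟩
  · rw [ofReal_e₁, ofReal_e₃]
    linear_combination (hsum + 2 * h₁w + hw₃) / 3
  · rw [ofReal_e₂, ofReal_e₃]
    linear_combination (hsum - h₁w + hw₃) / 3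
  · rw [ofReal_e₃]
    linear_combination (hsum - h₁w - 2 * hw₃) / 3

end Existence

/-! ### The contour problem -/

lemma AreHalfPeriods.halfPeriodValues {k₁ k₂ ω ω' : ℝ} {hω : 0 < ω} {hω' : 0 < ω'}
    (h : AreHalfPeriods k₁ k₂ ω ω' hω hω') (hk₁ : 0 < k₁) (hk₂ : k₁ < k₂) :
    HalfPeriodValues (rectPeriods ω ω' hω hω') k₁ k₂ ω (ω + Complex.I * ω') (Complex.I * ω') where
  pos := hk₁
  lt := hk₂
  isHalfPeriod_h₁ := isHalfPeriod_rectPeriods_h₁ hω hω'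
  isHalfPeriod_w := isHalfPeriod_rectPeriods_w hω hω'
  isHalfPeriod_h₃ := isHalfPeriod_rectPeriods_h₃ hω hω'
  weierstrassP_h₁ := h.1
  weierstrassP_w := h.2.1
  weierstrassP_h₃ := h.2.2

theorem HalfPeriodValues.solvesContourProblem {L : PeriodPair} {k₁ k₂ : ℝ} {h₁ w h₃ : ℂ}
    (H : HalfPeriodValues L k₁ k₂ h₁ w h₃) {z : ℂ → ℂ}
    (hz : IsSpectralBranch L k₁ k₂ (e₃ k₁ k₂) z) (hw : ∀ x : ℝ, (x : ℂ) - w ∉ L.lattice) :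
    SolvesContourProblem k₁ k₂ (fun _ => 1) (fun _ => 1) 0 (chi L w k₁ k₂ z)
      (chiCoefficient L (e₃ k₁ k₂) w) where
  analytic := H.analyticOnNhd_chi hz hw
  jumps := by simpa using H.exists_jumps hz hw
  asymptotic x := (hz.chi_isBigO H.isHalfPeriod_w.notMem (hw x)).mono inf_le_left
  endpoints := H.exists_endpoint_bound hz

lemma ofReal_sub_notMem_rectPeriods {ω ω' : ℝ} (hω : 0 < ω) (hω' : 0 < ω') (x : ℝ) :
    (x : ℂ) - (ω + Complex.I * ω') ∉ (rectPeriods ω ω' hω hω').lattice :=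
  notMem_rectPeriods_of_im hω hω' (-1) (by norm_num)

lemma weierstrassP_ofReal_sub_w {ω ω' : ℝ} (hω : 0 < ω) (hω' : 0 < ω') (x : ℝ) :
    (rectPeriods ω ω' hω hω').weierstrassP (x - (ω + Complex.I * ω')) =
      (rectPeriods ω ω' hω hω').weierstrassP (x + Complex.I * ω' - ω) := by
  rw [← weierstrassP_add_mem _ (isHalfPeriod_rectPeriods_h₃ hω hω').two_mul_mem]
  ring_nf

end PrimitivePotential

end

theorem mainTheorem1 (k₁ k₂ : ℝ) (hk₁ : 0 < k₁) (hk₂ : k₁ < k₂) :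
    (∃ (ω ω' : ℝ) (hω : 0 < ω) (hω' : 0 < ω'),
      PrimitivePotential.AreHalfPeriods k₁ k₂ ω ω' hω hω') ∧
    ∀ (ω ω' : ℝ) (hω : 0 < ω) (hω' : 0 < ω'),
      PrimitivePotential.AreHalfPeriods k₁ k₂ ω ω' hω hω' →
      (∃ z : ℂ → ℂ, PrimitivePotential.IsSpectralBranch
        (PrimitivePotential.rectPeriods ω ω' hω hω') k₁ k₂ (PrimitivePotential.e₃ k₁ k₂) z) ∧
      ∀ z : ℂ → ℂ, PrimitivePotential.IsSpectralBranch
        (PrimitivePotential.rectPeriods ω ω' hω hω') k₁ k₂ (PrimitivePotential.e₃ k₁ k₂) z →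
        ∃ Q : ℝ → ℂ,
          PrimitivePotential.SolvesContourProblem k₁ k₂ (fun _ => 1) (fun _ => 1) 0
            (PrimitivePotential.chi (PrimitivePotential.rectPeriods ω ω' hω hω')
              (ω + Complex.I * ω') k₁ k₂ z) Q ∧
          ∀ x : ℝ, HasDerivAt Q
            (2 * (PrimitivePotential.rectPeriods ω ω' hω hω').weierstrassP
                (x + Complex.I * ω' - ω) + PrimitivePotential.e₃ k₁ k₂) x := by
  refine ⟨PrimitivePotential.exists_areHalfPeriods hk₁ hk₂, fun ω ω' hω hω' hvalues => ?_⟩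
  have H := hvalues.halfPeriodValues hk₁ hk₂
  have hw := PrimitivePotential.ofReal_sub_notMem_rectPeriods hω hω'
  refine ⟨H.exists_isSpectralBranch, fun z hz => ⟨_, H.solvesContourProblem hz hw, fun x => ?_⟩⟩
  rw [← PrimitivePotential.weierstrassP_ofReal_sub_w hω hω' x]
  exact PrimitivePotential.hasDerivAt_chiCoefficient _ (hw x)
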